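/- **Setting.** Let $\beta\neq 0$, $\beta=|\beta|e^{ib}$ with $b\in[\frac{\pi}{2},\frac{3\pi}{2}]$, and assume $c_\beta:=e^{-\Re\beta}-2\cos(\Im\beta)>0$ and $|\beta|\le\pi$. Let $\theta\in[-\frac\pi2,\frac\pi2]$ be the angle with $b+\theta=\pi \pmod{2\pi}$, and write $s=s(t)=1+te^{i\theta}$ for $t\ge 0$. Let $(y)_m=y(y+1)\cdots(y+m-1)$. Let $F$ be a function with the following properties. 1. $F$ is analytic in $\mathbb{C}\setminus(1+e^{i\theta}[0,\infty))$, and near every point $1+te^{i\theta}$ with $t>0$ it can be continued analytically through the cut from either side. 2. The singularity at $p=1$ is integrable: for some $\delta>0$ and $K$, $\int_0^\delta|F(1+re^{i\omega})|\,dr\le K$ for all $\omega\in(\theta,\theta+2\pi)$. 3. There are $\alpha>1$ and $C$ with $|F(p)|\le C|p|^{-\alpha}$ for all large $|p|$ off the cut. Let $\Delta F(1+te^{i\theta})=F(1+te^{i\theta^+})-F(1+te^{i\theta^-})$ be the branch jump, and for $\Re(xe^{-ib})>0$ (that is, $\arg x\in(b-\frac\pi2,b+\frac\pi2)$) let $$f(x)=\int_0^{\infty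 e^{-ib}}e^{-xp}F(p)\,dp .$$ For $x\in\mathbb{C}\setminus e^{ib}(-\infty,0]$, $t\ge 0$ and integers $n,\ell\ge 0$, $k,N\ge 1$ define the following remainders. With $$\rho_n(z,y)=(1-z)\sum_{j\ge n}z^j\frac{j!}{(y)_{j+1}}$$ (the remainder of the factorial series of the Lerch function $\Phi(\frac{z}{z-1},1,y)$), let $$\rho_{n,0}(t)=\rho_n\Big(\frac{e^{\beta s}}{e^{\beta s}-1},\frac{x}{\beta}\Big),\qquad \rho_{\ell,k}(t)=\rho_\ell\Big(\frac{e^{\beta s/2^k}}{e^{\beta s/2^k}+1},\frac{2^kx}{\beta}\Big).$$ For $\varphi$ with $|\varphi+b|<\frac\pi2$ and $\Re(xe^{i\varphi})>0$ (so $\varphi=-b$ is allowed when $\Re(xe^{-ib})>0$) let $$R_N(t)=\int_0^{\infty e^{i\varphi}}e^{-xp}\,\frac{\beta}{2^{N-1}}\left(\frac{1}{\beta(s-p)/2^{N-1}}+\frac{e^{-\beta s/2^{N-1}}}{e^{-\beta s/2^{N-1}}-e^{-\beta p/2^{N-1}}}\right)dp .$$ **Theorem.** The function $f$ has an analytic continuation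 (also denoted $f$) to $\mathbb{C}\setminus e^{ib}(-\infty,0]$. For every $x$ in this cut plane, all $n,\ell\ge 0$, $N\ge1$ and every $\varphi$ as above, $$f(x)=\sum_{m=1}^{n}\frac{(m-1)!}{(x/\beta)_m}d_{m,0}+\sum_{k=1}^{N-1}\sum_{m=1}^{\ell}\frac{(m-1)!}{(2^kx/\beta)_m}d_{m,k}+\mathcal R_{n,N,\ell},$$ where $$d_{m,0}=\frac{e^{i\theta}}{2\pi i}\int_0^\infty\Delta F(1+te^{i\theta})\frac{e^{\beta s(m-1)}}{(e^{\beta s}-1)^m}dt,\qquad d_{m,k}=\frac{e^{i\theta}}{2\pi i}\int_0^\infty\Delta F(1+te^{i\theta})\frac{e^{\beta s(m-1)/2^k}}{(e^{\beta s/2^k}+1)^m}dt,$$ $$\mathcal R_{n,N,\ell}=\frac{e^{i\theta}}{2\pi i}\int_0^\infty\Delta F(1+te^{i\theta})\Big(-\rho_{n,0}(t)+\sum_{k=1}^{N-1}\rho_{\ell,k}(t)+R_N(t)\Big)dt,$$ and $\Delta F(1+te^{i\theta})$ is integrable on $(0,\infty)$; all integrals and series written here converge absolutely. Moreover: * For every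 $x$ in the cut plane and $k\ge1$, as $\ell\to\infty$, with $o(1)$ uniform in $t\ge0$, $$\rho_{\ell,k}(t)=\frac{e^{\beta s\ell/2^k}(\ell-1)!}{(e^{\beta s/2^k}+1)^\ell(2^kx/\beta)_\ell}(1+o(1)).$$ * For every $x$ in the cut plane, as $n\to\infty$, with $o(1)$ uniform in $t\ge0$, $$\rho_{n,0}(t)=\frac{e^{\beta sn}(n-1)!}{(e^{\beta s}-1)^n(x/\beta)_n}(1+o(1)).$$ * For every $\varphi$ with $|\varphi+b|<\frac\pi2$ there is $c_0>0$ such that $|1-e^{\beta s}e^{-\beta p}|>c_0$ and $|1+e^{\beta s/2^k}e^{-\beta p/2^k}|>c_0$ for all $t\ge0$, $p\in e^{i\varphi}[0,\infty)$, $k\ge1$. For every such $c_0$, all $x$ with $\Re(xe^{i\varphi})>0$, all $N\ge1$ and all $t\ge0$, $$|R_N(t)|\le\frac{1}{2^{N-1}}\frac{|\beta|}{c_0}\frac{1}{\Re(xe^{i\varphi})}.$$ * Let $c_1=\max\{1/\sqrt{1+c_\beta},\,1/\sqrt2\}<1$, and let $c_0$ be a constant as above for $\varphi=-b$. If $\Re(x/\beta)>0$,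 then for all $t\ge0$, $n,\ell\ge0$ and $k\ge1$, $$|\rho_{n,0}(t)|\le\frac{c_1^n}{c_0}\frac{1}{\Re(x/\beta)}\frac{n!}{|(x/\beta)_n|},\qquad |\rho_{\ell,k}(t)|\le\frac{c_1^\ell}{c_0}\frac1{2^k}\frac{1}{\Re(x/\beta)}\frac{\ell!}{|(2^kx/\beta)_\ell|}.$$ * For every $x$ in the cut plane, $$f(x)=\sum_{m\ge1}\frac{(m-1)!}{(x/\beta)_m}d_{m,0}+\sum_{k\ge1}\sum_{m\ge1}\frac{(m-1)!}{(2^kx/\beta)_m}d_{m,k},$$ where the single series and the double series converge absolutely. -/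

import Mathlib

open Set Filter Topology MeasureTheory

noncomputable section

/-! ### The Borel plane -/

/-- The point `s = 1 + t e^{iθ}`. -/
def cutPoint (θ t : ℝ) : ℂ := 1 + (t : ℂ) * Complex.exp (θ * Complex.I)

/-- The cut `1 + e^{iθ} [0, ∞)`. -/
def borelCut (θ : ℝ) : Set ℂ := {p | ∃ t : ℝ, 0 ≤ t ∧ p = cutPoint θ t}

/-- `F` is a function element with an integrable branch point at `1` and cut `1 + e^{iθ} [0, ∞)`. -/
structure IsFunctionElement (θ : ℝ) (F : ℂ → ℂ) : Prop where
  /-- `F` is analytic in the cut plane. -/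
  analytic : AnalyticOnNhd ℂ F (borelCut θ)ᶜ
  /-- `F` continues analytically through the cut from the side of larger arguments. -/
  continuation_pos : ∀ t : ℝ, 0 < t → ∃ r : ℝ, 0 < r ∧ ∃ G : ℂ → ℂ,
    AnalyticOnNhd ℂ G (Metric.ball (cutPoint θ t) r) ∧
    ∀ p ∈ Metric.ball (cutPoint θ t) r,
      0 < ((p - 1) * Complex.exp (-(θ * Complex.I))).im → F p = G p
  /-- `F` continues analytically through the cut from the side of smaller arguments. -/
  continuation_neg : ∀ t : ℝ, 0 < t → ∃ r : ℝ, 0 < r ∧ ∃ G : ℂ → ℂ,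
    AnalyticOnNhd ℂ G (Metric.ball (cutPoint θ t) r) ∧
    ∀ p ∈ Metric.ball (cutPoint θ t) r,
      ((p - 1) * Complex.exp (-(θ * Complex.I))).im < 0 → F p = G p
  /-- The singularity at `1` is integrable: `F` is `L¹` near `1` along the rays issuing from `1`,
  with a bound that does not depend on the ray. -/
  integrable_branch : ∃ δ : ℝ, 0 < δ ∧ ∃ K : NNReal, ∀ ω ∈ Ioo θ (θ + 2 * Real.pi),
    ∫⁻ r in Ioo (0 : ℝ) δ, ‖F (cutPoint ω r)‖ₑ ≤ K
  /-- `F` decays at infinity. -/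
  decay : ∃ α : ℝ, 1 < α ∧ ∃ C R : ℝ, 0 < R ∧
    ∀ p ∈ (borelCut θ)ᶜ, R ≤ ‖p‖ → ‖F p‖ ≤ C * ‖p‖ ^ (-α)

/-- The branch jump `ΔF(1 + t e^{iθ}) = F(1 + t e^{iθ⁺}) - F(1 + t e^{iθ⁻})`. -/
def branchJump (θ : ℝ) (F : ℂ → ℂ) (t : ℝ) : ℂ :=
  limUnder (𝓝[>] (0 : ℝ)) (fun ε : ℝ => F (cutPoint (θ + ε) t)) -
    limUnder (𝓝[>] (0 : ℝ)) (fun ε : ℝ => F (cutPoint (θ - ε) t))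

/-! ### The Laplace transform -/

/-- The point `r e^{iφ}` of the ray with angle `φ` from the origin. -/
def rayPoint (φ r : ℝ) : ℂ := (r : ℂ) * Complex.exp (φ * Complex.I)

/-- The integrand of the Laplace transform along the ray with angle `φ`, in the parameter `r`
(`p = r e^{iφ}`, `dp = e^{iφ} dr`). -/
def laplaceIntegrand (φ : ℝ) (G : ℂ → ℂ) (x : ℂ) (r : ℝ) : ℂ :=
  Complex.exp (-x * rayPoint φ r) * G (rayPoint φ r) * Complex.exp (φ * Complex.I)

/-- `∫_0^{∞ e^{iφ}} e^{-xp} G(p) dp`. -/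
def laplaceRay (φ : ℝ) (G : ℂ → ℂ) (x : ℂ) : ℂ := ∫ r in Ioi (0 : ℝ), laplaceIntegrand φ G x r

/-- The cut plane `ℂ ∖ e^{ib} (-∞, 0]`. -/
def laplaceDomain (b : ℝ) : Set ℂ := {x | ∀ r : ℝ, r ≤ 0 → x ≠ rayPoint b r}

/-! ### Constants and coefficients -/

/-- `c_β = e^{-Re β} - 2 cos (Im β)`. -/
def cBeta (β : ℂ) : ℝ := Real.exp (-β.re) - 2 * Real.cos β.im

/-- `c₁ = max (1/√(1 + c_β)) (1/√2)`. -/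
def cOne (β : ℂ) : ℝ := max (1 / √(1 + cBeta β)) (1 / √2)

/-- `c₀` is a positive lower bound of the denominators of the dyadic decomposition of
`1/(s - p)`, for `p` on the ray with angle `φ` and `s` on the cut. -/
def IsDenominatorBound (β : ℂ) (θ φ c₀ : ℝ) : Prop :=
  0 < c₀ ∧ ∀ t r : ℝ, 0 ≤ t → 0 ≤ r →
    c₀ < ‖1 - Complex.exp (β * cutPoint θ t) * Complex.exp (-β * rayPoint φ r)‖ ∧
    ∀ k : ℕ, 1 ≤ k →
      c₀ < ‖1 + Complex.exp (β * cutPoint θ t / 2 ^ k) * Complex.exp (-β * rayPoint φ r / 2 ^ k)‖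

/-- The rising factorial `(y)_m = y (y + 1) ⋯ (y + m - 1)`. -/
def poch (y : ℂ) (m : ℕ) : ℂ := (ascPochhammer ℂ m).eval y

/-- The integrand of `d_{m,0}` (for `m ≥ 1`). -/
def coeffZeroIntegrand (β : ℂ) (θ : ℝ) (F : ℂ → ℂ) (m : ℕ) (t : ℝ) : ℂ :=
  branchJump θ F t *
    (Complex.exp (β * cutPoint θ t * ((m - 1 : ℕ) : ℂ)) /
      (Complex.exp (β * cutPoint θ t) - 1) ^ m)

/-- The integrand of `d_{m,k}` (for `m, k ≥ 1`). -/
def coeffIntegrand (β : ℂ) (θ : ℝ) (F : ℂ → ℂ) (m k : ℕ) (t : ℝ) : ℂ :=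
  branchJump θ F t *
    (Complex.exp (β * cutPoint θ t * ((m - 1 : ℕ) : ℂ) / 2 ^ k) /
      (Complex.exp (β * cutPoint θ t / 2 ^ k) + 1) ^ m)

/-- The factor `e^{iθ} / (2πi)`. -/
def cauchyFactor (θ : ℝ) : ℂ := Complex.exp (θ * Complex.I) / (2 * Real.pi * Complex.I)

/-- The coefficient `d_{m,0}`. -/
def coeffZero (β : ℂ) (θ : ℝ) (F : ℂ → ℂ) (m : ℕ) : ℂ :=
  cauchyFactor θ * ∫ t in Ioi (0 : ℝ), coeffZeroIntegrand β θ F m t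

/-- The coefficient `d_{m,k}`, `k ≥ 1`. -/
def coeff (β : ℂ) (θ : ℝ) (F : ℂ → ℂ) (m k : ℕ) : ℂ :=
  cauchyFactor θ * ∫ t in Ioi (0 : ℝ), coeffIntegrand β θ F m k t

/-! ### Remainders -/

/-- The term `z^j j! / (y)_{j+1}` of the factorial series of the Lerch transcendent,
`Φ(z/(z-1), 1, y) = (1 - z) ∑_{j ≥ 0} z^j j! / (y)_{j+1}`. -/
def lerchTerm (z y : ℂ) (j : ℕ) : ℂ := z ^ j * (j.factorial : ℂ) / poch y (j + 1)

/-- The remainder of that series after the terms `j = 0, …, n - 1`. -/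
def lerchTail (n : ℕ) (z y : ℂ) : ℂ := (1 - z) * ∑' j : ℕ, lerchTerm z y (n + j)

/-- `z = e^{βs} / (e^{βs} - 1)`, for which `z / (z - 1) = e^{βs}`. -/
def zZero (β : ℂ) (θ t : ℝ) : ℂ :=
  Complex.exp (β * cutPoint θ t) / (Complex.exp (β * cutPoint θ t) - 1)

/-- `z = e^{βs/2^k} / (e^{βs/2^k} + 1)`, for which `z / (z - 1) = -e^{βs/2^k}`. -/
def zDyadic (β : ℂ) (θ : ℝ) (k : ℕ) (t : ℝ) : ℂ :=
  Complex.exp (β * cutPoint θ t / 2 ^ k) / (Complex.exp (β * cutPoint θ t / 2 ^ k) + 1)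

/-- `ρ_{n,0}(t)`: the remainder, after `n` terms, of the factorial series of
`Φ(e^{βs}, 1, x/β)`. -/
def rhoZero (β : ℂ) (θ : ℝ) (n : ℕ) (x : ℂ) (t : ℝ) : ℂ :=
  lerchTail n (zZero β θ t) (x / β)

/-- `ρ_{ℓ,k}(t)`: the remainder, after `ℓ` terms, of the factorial series of
`Φ(-e^{βs/2^k}, 1, 2^k x/β)`. -/
def rhoDyadic (β : ℂ) (θ : ℝ) (l k : ℕ) (x : ℂ) (t : ℝ) : ℂ :=
  lerchTail l (zDyadic β θ k t) (2 ^ k * x / β)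

/-- The remainder `ρ_{N,β}(p, s)`, `N ≥ 1`, of the dyadic decomposition of `1/(s - p)` in which
the sum over `k` is taken from `1` to `N - 1`. -/
def kernelRemainder (β : ℂ) (N : ℕ) (p s : ℂ) : ℂ :=
  β / 2 ^ (N - 1) * (1 / (β * (s - p) / 2 ^ (N - 1)) +
    Complex.exp (-β * s / 2 ^ (N - 1)) /
      (Complex.exp (-β * s / 2 ^ (N - 1)) - Complex.exp (-β * p / 2 ^ (N - 1))))

/-- `R_N(t) = ∫_0^{∞ e^{iφ}} e^{-xp} ρ_{N,β}(p, s) dp`. -/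
def dyadicRemainder (β : ℂ) (θ φ : ℝ) (N : ℕ) (x : ℂ) (t : ℝ) : ℂ :=
  laplaceRay φ (fun p => kernelRemainder β N p (cutPoint θ t)) x

/-- The integrand of the total remainder. -/
def remainderIntegrand (β : ℂ) (θ φ : ℝ) (F : ℂ → ℂ) (n N l : ℕ) (x : ℂ) (t : ℝ) : ℂ :=
  branchJump θ F t *
    (-rhoZero β θ n x t + ∑ k ∈ Finset.Icc 1 (N - 1), rhoDyadic β θ l k x t +
      dyadicRemainder β θ φ N x t)

/-- The total remainder `𝓡_{n,N,ℓ}`. -/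
def totalRemainder (β : ℂ) (θ φ : ℝ) (F : ℂ → ℂ) (n N l : ℕ) (x : ℂ) : ℂ :=
  cauchyFactor θ * ∫ t in Ioi (0 : ℝ), remainderIntegrand β θ φ F n N l x t

end

noncomputable section

/-! ### Rising factorials and the coefficients `j! / (y)_{j+1}` -/

/-! The proof represents `F` by its jump across the cut, reduces the Laplace transform to that of
the Cauchy kernel, and expands that kernel dyadically into terms whose Laplace transforms are Lerch
functions.

Collapsing a contour onto the cut gives F(p) = e^{iθ}/(2πi) ∫ ΔF(t)/(s-p) dt
(`IsFunctionElement.cauchy_formula`). The large circle disappears by decay. On the small circle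
integrability gives no pointwise bound, but the limit exists because all other terms of the identity
converge, and a nonzero limit would contradict integrability in the radius
(`circleEdge_limit_eq_zero`). Fubini then reduces `f` to the Laplace transform of 1/(s-p)
(`AdmissibleParameter.laplaceRay_eq_totalRemainder`).

With u = β(s-p), the identity 2/(1-E²) = 1/(1-E) + 1/(1+E), iterated with E = e^{u/2^k}, splits
1/(s-p) into -β/(1-e^u), the terms (β/2^k)/(1+e^{u/2^k}), and a remainder that tends to zero
(`kernelRemainder_succ_eq_add`, `tendsto_kernelRemainder`). A geometric expansion shows that the
Laplace transform of such a term is a Lerch series ∑ w^j/(y+j). Euler's transformation z = w/(w-1)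
turns it into a factorial series (`hasSum_lerchTail_zero`, `laplaceRay_geometric`).

Along the cut βs = β - t|β|, so bounds on z only involve real shifts of the exponent. They give |z|
≤ c₁ < 1, hence convergence and the remainder bounds. The double series needs more: for large k the
bound on |z| approaches 1/2, while j!/(y)_{j+1} at y = 2^k x/β is at most a constant times 2^{-k}
M^j with M < 2, by a Beta integral along a rotated ray (`norm_betaCoeff_le`). The product of the two
ratios is eventually below 1, and 2^{-k} gives convergence in k
(`AdmissibleParameter.summable_dyadicRatio_pow_mul`).

The sum of the series does not depend on the direction φ of integration, and it equals the Laplace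
integral along φ on the half-plane Re(x e^{iφ}) > 0. These half-planes, for |φ+b| < π/2, cover the
cut plane, which gives the analytic continuation. -/

theorem poch_zero (y : ℂ) : poch y 0 = 1 := by simp [poch]

theorem poch_succ (y : ℂ) (m : ℕ) : poch y (m + 1) = poch y m * (y + m) := by
  simp [poch, ascPochhammer_succ_eval]

theorem poch_succ_left (y : ℂ) (m : ℕ) : poch y (m + 1) = y * poch (y + 1) m := by
  simp [poch, ascPochhammer_succ_left]

theorem add_natCast_ne_zero_of_mem_slitPlane {y : ℂ} (hy : y ∈ Complex.slitPlane) (i : ℕ) :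
    y + i ≠ 0 := by
  intro h
  rcases Complex.mem_slitPlane_iff.1 hy with h1 | h1
  · have := congrArg Complex.re h
    simp at this
    have h2 : (0 : ℝ) ≤ i := Nat.cast_nonneg i
    linarith
  · have := congrArg Complex.im h
    simp at this
    exact h1 this

theorem poch_ne_zero {y : ℂ} (hy : ∀ i : ℕ, y + i ≠ 0) (m : ℕ) : poch y m ≠ 0 := by
  induction m with
  | zero => simp [poch_zero]
  | succ m ih => rw [poch_succ]; exact mul_ne_zero ih (hy m)

/-- The coefficient `j! / (y)_{j+1} = B(j + 1, y)`. -/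
def betaCoeff (y : ℂ) (j : ℕ) : ℂ := (j.factorial : ℂ) / poch y (j + 1)

theorem lerchTerm_eq (z y : ℂ) (j : ℕ) : lerchTerm z y j = z ^ j * betaCoeff y j := by
  rw [lerchTerm, betaCoeff, mul_div_assoc]

theorem betaCoeff_zero (y : ℂ) : betaCoeff y 0 = 1 / y := by
  simp [betaCoeff, poch_succ, poch_zero]

theorem betaCoeff_succ_eq_mul {y : ℂ} (j : ℕ) :
    betaCoeff y (j + 1) = betaCoeff y j * ((j + 1 : ℂ) / (y + j + 1)) := by
  rw [betaCoeff, betaCoeff, poch_succ y (j + 1), Nat.factorial_succ, div_mul_div_comm]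
  push_cast
  ring

theorem betaCoeff_ne_zero {y : ℂ} (hy : ∀ i : ℕ, y + i ≠ 0) (j : ℕ) : betaCoeff y j ≠ 0 :=
  div_ne_zero (by exact_mod_cast j.factorial_ne_zero) (poch_ne_zero hy _)

theorem betaCoeff_succ {y : ℂ} (hy : ∀ i : ℕ, y + i ≠ 0) (j : ℕ) :
    betaCoeff y (j + 1) = betaCoeff y j - betaCoeff (y + 1) j := by
  have h0 : y ≠ 0 := by simpa using hy 0
  have h1 : y + j + 1 ≠ 0 := by simpa [add_assoc] using hy (j + 1)
  have hP : poch y (j + 1) ≠ 0 := poch_ne_zero hy _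
  have e : poch (y + 1) (j + 1) = poch y (j + 1) * (y + j + 1) / y := by
    rw [eq_div_iff h0, mul_comm, ← poch_succ_left, poch_succ y (j + 1)]
    push_cast; ring
  rw [betaCoeff_succ_eq_mul, betaCoeff, betaCoeff, e]
  field_simp
  ring

/-! ### Beta integrals along rays. -/

theorem norm_one_sub_exp_neg_mul_le {a : ℂ} (ha : 0 < a.re) :
    ∃ M : ℝ, 0 < M ∧ M < 2 ∧ ∀ q : ℝ, 0 ≤ q → ‖1 - Complex.exp (-(q * a))‖ ≤ M := by
  have hc : ContinuousAt (fun q : ℝ => ‖1 - Complex.exp (-(q * a))‖) 0 := by fun_prop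
  have h0 : ∀ᶠ q : ℝ in 𝓝 0, ‖1 - Complex.exp (-(q * a))‖ < 1 :=
    hc.eventually_lt continuousAt_const (by simp)
  obtain ⟨q₀, hq₀, h⟩ := Metric.eventually_nhds_iff.1 h0
  -- For q below `q₀` the norm is less than 1 by continuity; beyond `q₀` the triangle inequality
  -- gives this constant. That it is strictly below 2 is what later makes the double series
  -- converge.
  refine ⟨1 + Real.exp (-(q₀ * a.re)), by positivity, ?_, fun q hq => ?_⟩
  · have : Real.exp (-(q₀ * a.re)) < 1 := Real.exp_lt_one_iff.2 (by nlinarith)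
    linarith
  · by_cases hlt : q < q₀
    · have := h (y := q) (by rw [Real.dist_eq, sub_zero, abs_of_nonneg hq]; exact hlt)
      have := Real.exp_pos (-(q₀ * a.re))
      linarith
    · refine (norm_sub_le _ _).trans ?_
      rw [norm_one, Complex.norm_exp]
      gcongr
      have : q₀ * a.re ≤ q * a.re := by
        have := ha.le
        gcongr
        exact not_lt.1 hlt
      simpa using this

theorem integrableOn_exp_neg_mul {c : ℂ} (hc : 0 < c.re) :
    IntegrableOn (fun q : ℝ => Complex.exp (-(q * c))) (Ioi 0) := by
  have := integrableOn_exp_mul_complex_Ioi (a := -c) (by simpa using hc) 0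
  refine this.congr_fun (fun q _ => ?_) measurableSet_Ioi
  ring_nf

theorem integral_exp_neg_mul {c : ℂ} (hc : 0 < c.re) :
    ∫ q in Ioi (0 : ℝ), Complex.exp (-(q * c)) = 1 / c := by
  have := integral_exp_mul_complex_Ioi (a := -c) (by simpa using hc) 0
  simp only [Complex.ofReal_zero, mul_zero, Complex.exp_zero] at this
  rw [neg_div_neg_eq] at this
  rw [← this]
  congr 1
  ext q
  ring_nf

theorem integral_exp_neg_mul_re {c : ℝ} (hc : 0 < c) :
    ∫ q in Ioi (0 : ℝ), Real.exp (-(q * c)) = 1 / c := by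
  have := integral_exp_mul_Ioi (a := -c) (by simpa using hc) 0
  simp only [mul_zero, Real.exp_zero] at this
  rw [neg_div_neg_eq] at this
  rw [← this]
  congr 1
  ext q
  ring_nf

theorem integrableOn_exp_neg_mul_re {c : ℝ} (hc : 0 < c) :
    IntegrableOn (fun q : ℝ => Real.exp (-(q * c))) (Ioi 0) := by
  have := integrableOn_exp_mul_Ioi (a := -c) (by simpa using hc) 0
  refine this.congr_fun (fun q _ => ?_) measurableSet_Ioi
  ring_nf

theorem norm_exp_neg_mul (q : ℝ) (c : ℂ) :
    ‖Complex.exp (-(q * c))‖ = Real.exp (-(q * c.re)) := by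
  rw [Complex.norm_exp]; simp

theorem integrableOn_exp_neg_mul_mul {c : ℂ} (hc : 0 < c.re) {g : ℝ → ℂ} (hg : Continuous g)
    {M : ℝ} (hM : ∀ q : ℝ, 0 ≤ q → ‖g q‖ ≤ M) :
    IntegrableOn (fun q : ℝ => Complex.exp (-(q * c)) * g q) (Ioi 0) := by
  refine (integrableOn_exp_neg_mul hc).mul_bdd (c := M) hg.aestronglyMeasurable ?_
  filter_upwards [ae_restrict_mem measurableSet_Ioi] with q hq using hM q (le_of_lt hq)

/-- This is the Beta integral taken along the ray of direction `a`. Induction on j through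
`betaCoeff_succ` avoids rotating a contour: multiplying the integrand by 1 - e^{-qa} subtracts its
value at y + 1. The condition is on Re(ya), not on Re y, so a suitable `a` reaches every y in the
slit plane. -/
theorem betaCoeff_eq_integral {a y : ℂ} (ha : 0 < a.re) (hy : 0 < (y * a).re) (j : ℕ) :
    betaCoeff y j =
      a * ∫ q in Ioi (0 : ℝ), Complex.exp (-(q * (y * a))) * (1 - Complex.exp (-(q * a))) ^ j := by
  have hya : ∀ i : ℕ, 0 < ((y + i) * a).re := fun i => by
    have : ((y + i) * a).re = (y * a).re + i * a.re := by simp [add_mul]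
    rw [this]; positivity
  have hne : a ≠ 0 := by rintro rfl; simp at ha
  obtain ⟨M, hM0, -, hM⟩ := norm_one_sub_exp_neg_mul_le ha
  induction j generalizing y with
  | zero =>
    simp only [pow_zero, mul_one]
    rw [integral_exp_neg_mul hy, betaCoeff_zero]
    have : y ≠ 0 := by rintro rfl; simp at hy
    field_simp
  | succ j ih =>
    have hnz : ∀ i : ℕ, y + i ≠ 0 := fun i h => by
      have := hya i; rw [h] at this; simp at this
    have h1 : 0 < ((y + 1) * a).re := by simpa using hya 1
    have hint : ∀ {c : ℂ}, 0 < c.re → IntegrableOn (fun q : ℝ =>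
        Complex.exp (-(q * c)) * (1 - Complex.exp (-(q * a))) ^ j) (Ioi 0) := fun {c} hc =>
      integrableOn_exp_neg_mul_mul hc (by fun_prop) (M := M ^ j) (fun q hq => by
        rw [norm_pow]; gcongr; exact hM q hq)
    have hya1 : ∀ i : ℕ, 0 < ((y + 1 + i) * a).re := fun i => by
      have := hya (i + 1); push_cast at this; rwa [add_assoc, add_comm (1 : ℂ)]
    rw [betaCoeff_succ hnz, ih hy hya, ih h1 hya1, ← mul_sub, ← integral_sub (hint hy) (hint h1)]
    congr 2
    ext q
    have : Complex.exp (-(q * ((y + 1) * a))) =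
        Complex.exp (-(q * (y * a))) * Complex.exp (-(q * a)) := by
      rw [← Complex.exp_add]; ring_nf
    rw [this]; ring

/-- The price of rotating the ray is exponential growth M^j. The gain is the factor 1/Re(ya), which
is of order 2^{-k} at y = 2^k x/β. -/
theorem norm_betaCoeff_le {a y : ℂ} (ha : 0 < a.re) (hy : 0 < (y * a).re) {M : ℝ}
    (hM : ∀ q : ℝ, 0 ≤ q → ‖1 - Complex.exp (-(q * a))‖ ≤ M) (j : ℕ) :
    ‖betaCoeff y j‖ ≤ M ^ j * (‖a‖ / (y * a).re) := by
  rw [betaCoeff_eq_integral ha hy, norm_mul]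
  have : ‖∫ q in Ioi (0 : ℝ), Complex.exp (-(q * (y * a))) * (1 - Complex.exp (-(q * a))) ^ j‖ ≤
      ∫ q in Ioi (0 : ℝ), Real.exp (-(q * (y * a).re)) * M ^ j := by
    refine norm_integral_le_of_norm_le ((integrableOn_exp_neg_mul_re hy).mul_const _) ?_
    filter_upwards [ae_restrict_mem measurableSet_Ioi] with q hq
    rw [norm_mul, norm_exp_neg_mul, norm_pow]
    gcongr
    exact hM q (le_of_lt hq)
  rw [integral_mul_const, integral_exp_neg_mul_re hy] at this
  calc ‖a‖ * _ ≤ ‖a‖ * (1 / (y * a).re * M ^ j) := by gcongr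
    _ = _ := by ring

/-! ### Convergence of factorial series and splitting off their terms. -/

theorem tendsto_succ_div_add (y : ℂ) (c : ℝ) :
    Tendsto (fun j : ℕ => c * ‖(j + 1 : ℂ) / (y + j + 1)‖) atTop (𝓝 c) := by
  have h1 : Tendsto (fun j : ℕ => (1 : ℂ) + y / (j + 1 : ℂ)) atTop (𝓝 (1 + 0)) := by
    refine tendsto_const_nhds.add ?_
    have := (tendsto_one_div_add_atTop_nhds_zero_nat (𝕜 := ℂ)).const_mul y
    simpa [div_eq_mul_inv] using this
  have h2 := ((h1.inv₀ (by simp)).norm.const_mul c)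
  simp only [add_zero, inv_one, norm_one, mul_one] at h2
  refine h2.congr (fun j => ?_)
  have : (j + 1 : ℂ) ≠ 0 := by exact_mod_cast j.succ_ne_zero
  congr 2
  rw [← inv_div]
  field_simp
  ring

/-- Ratio test. No condition on `y` is needed: `betaCoeff_succ_eq_mul` persists when a rising
factorial vanishes, since division by zero makes both sides zero. -/
theorem summable_pow_mul_norm_betaCoeff {c : ℝ} (hc0 : 0 ≤ c) (hc : c < 1) (y : ℂ) :
    Summable (fun j => c ^ j * ‖betaCoeff y j‖) := by
  obtain ⟨r, hcr, hr⟩ := exists_between hc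
  refine summable_of_ratio_norm_eventually_le (r := r) hr ?_
  filter_upwards [(tendsto_succ_div_add y c).eventually_lt_const hcr] with j hj
  rw [Real.norm_of_nonneg (by positivity), Real.norm_of_nonneg (by positivity),
    betaCoeff_succ_eq_mul, norm_mul]
  calc c ^ (j + 1) * (‖betaCoeff y j‖ * ‖(j + 1 : ℂ) / (y + j + 1)‖)
      = (c * ‖(j + 1 : ℂ) / (y + j + 1)‖) * (c ^ j * ‖betaCoeff y j‖) := by ring
    _ ≤ _ := by gcongr

theorem norm_lerchTerm_le {z : ℂ} {c : ℝ} (hz : ‖z‖ ≤ c) (y : ℂ) (j : ℕ) :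
    ‖lerchTerm z y j‖ ≤ c ^ j * ‖betaCoeff y j‖ := by
  rw [lerchTerm_eq, norm_mul, norm_pow]
  gcongr

theorem summable_lerchTerm {z : ℂ} (hz : ‖z‖ < 1) (y : ℂ) : Summable (lerchTerm z y) :=
  Summable.of_norm_bounded (summable_pow_mul_norm_betaCoeff (norm_nonneg z) hz y)
    (norm_lerchTerm_le le_rfl y)

theorem lerchTail_eq_add {z : ℂ} (hz : ‖z‖ < 1) (y : ℂ) (n : ℕ) :
    lerchTail n z y = (1 - z) * lerchTerm z y n + lerchTail (n + 1) z y := by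
  rw [lerchTail, lerchTail, ← mul_add]
  congr 1
  have hs : Summable (fun j => lerchTerm z y (n + j)) :=
    ((summable_nat_add_iff n).2 (summable_lerchTerm hz y)).congr (fun j => by rw [add_comm])
  rw [hs.tsum_eq_zero_add]
  simp only [add_zero]
  congr 2
  ext j
  congr 1
  ring

theorem lerchTail_zero_eq_sum_add {z : ℂ} (hz : ‖z‖ < 1) (y : ℂ) (n : ℕ) :
    lerchTail 0 z y = (1 - z) * ∑ j ∈ Finset.range n, lerchTerm z y j + lerchTail n z y := by
  induction n with
  | zero => simp
  | succ n ih => rw [ih, lerchTail_eq_add hz y n, Finset.sum_range_succ]; ring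

/-! ### The Lerch function -/

/-- Termwise integration of a geometric series. It is used with g = w e^{-qa} and with g = z(1 -
e^{-q}), which produce the two expansions of a Lerch function. -/
theorem hasSum_integral_exp_mul_pow {c : ℂ} (hc : 0 < c.re) {g : ℝ → ℂ} (hg : Continuous g)
    {r : ℝ} (hr0 : 0 ≤ r) (hr : r < 1) (hgr : ∀ q : ℝ, 0 ≤ q → ‖g q‖ ≤ r) :
    HasSum (fun j : ℕ => ∫ q in Ioi (0 : ℝ), Complex.exp (-(q * c)) * g q ^ j)
      (∫ q in Ioi (0 : ℝ), Complex.exp (-(q * c)) / (1 - g q)) := by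
  have hb : ∀ j : ℕ, ∀ q : ℝ, 0 ≤ q → ‖g q ^ j‖ ≤ r ^ j := fun j q hq => by
    rw [norm_pow]; gcongr; exact hgr q hq
  have hint : ∀ j : ℕ, IntegrableOn (fun q : ℝ => Complex.exp (-(q * c)) * g q ^ j) (Ioi 0) :=
    fun j => integrableOn_exp_neg_mul_mul hc (hg.pow j) (hb j)
  have hs := hasSum_integral_of_summable_integral_norm (μ := volume.restrict (Ioi (0 : ℝ))) hint ?_
  · have e : ∫ q in Ioi (0 : ℝ), Complex.exp (-(q * c)) / (1 - g q) =
        ∫ q in Ioi (0 : ℝ), ∑' j : ℕ, Complex.exp (-(q * c)) * g q ^ j := by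
      refine setIntegral_congr_fun measurableSet_Ioi fun q hq => ?_
      rw [tsum_mul_left, tsum_geometric_of_norm_lt_one ((hgr q (le_of_lt hq)).trans_lt hr),
        div_eq_mul_inv]
    rw [e]
    exact hs
  · refine Summable.of_nonneg_of_le (fun j => by positivity) (fun j => ?_)
      ((summable_geometric_of_lt_one hr0 hr).mul_left (1 / c.re))
    rw [← integral_exp_neg_mul_re hc, ← integral_mul_const]
    refine integral_mono_of_nonneg (Eventually.of_forall fun q => norm_nonneg _)
      ((integrableOn_exp_neg_mul_re hc).mul_const _) ?_
    filter_upwards [ae_restrict_mem measurableSet_Ioi] with q hq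
    rw [norm_mul, norm_exp_neg_mul]
    gcongr
    exact hb j q (le_of_lt hq)

theorem hasSum_integral_exp_div_one_sub {c a w : ℂ} (hc : 0 < c.re) (ha : 0 ≤ a.re)
    (hw : ‖w‖ < 1) :
    HasSum (fun j : ℕ => w ^ j / (c + j * a))
      (∫ q in Ioi (0 : ℝ), Complex.exp (-(q * c)) / (1 - w * Complex.exp (-(q * a)))) := by
  have := hasSum_integral_exp_mul_pow hc (g := fun q => w * Complex.exp (-(q * a)))
    (by fun_prop) (norm_nonneg w) hw (fun q hq => by
      rw [norm_mul, norm_exp_neg_mul]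
      exact mul_le_of_le_one_right (norm_nonneg w) (Real.exp_le_one_iff.2 (by simp; positivity)))
  refine this.congr_fun fun j => ?_
  have hc' : 0 < (c + j * a).re := by
    have : (c + j * a).re = c.re + j * a.re := by simp
    rw [this]; positivity
  rw [← mul_one_div, ← integral_exp_neg_mul hc', ← integral_const_mul]
  congr 1
  ext q
  rw [mul_pow, ← Complex.exp_nat_mul, mul_left_comm, ← Complex.exp_add]
  ring_nf

/-- Euler's transformation under the integral sign: z = w/(w-1) satisfies 1 - z(1 - e^{-q}) = (1 -
z)(1 - w e^{-q}), so the powers of z(1 - e^{-q}) sum to the Lerch integrand and integrate to Beta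
coefficients. -/
theorem lerchTail_zero_eq_integral {w y : ℂ} (hw1 : w ≠ 1) (hz : ‖w / (w - 1)‖ < 1)
    (hy : 0 < y.re) :
    lerchTail 0 (w / (w - 1)) y =
      ∫ q in Ioi (0 : ℝ), Complex.exp (-(q * y)) / (1 - w * Complex.exp (-q)) := by
  set z := w / (w - 1) with hzdef
  have hw1' : w - 1 ≠ 0 := sub_ne_zero.2 hw1
  have h := hasSum_integral_exp_mul_pow hy (g := fun q => z * (1 - Complex.exp (-q)))
    (by fun_prop) (norm_nonneg z) hz (fun q hq => by
      rw [norm_mul]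
      refine mul_le_of_le_one_right (norm_nonneg z) ?_
      have : (1 : ℂ) - Complex.exp (-q) = ((1 - Real.exp (-q) : ℝ) : ℂ) := by push_cast; rfl
      rw [this, Complex.norm_of_nonneg]
      · linarith [Real.exp_pos (-q)]
      · have := Real.exp_le_one_iff.2 (neg_nonpos.2 hq)
        linarith)
  have e : ∀ j : ℕ, ∫ q in Ioi (0 : ℝ),
      Complex.exp (-(q * y)) * (z * (1 - Complex.exp (-q))) ^ j = lerchTerm z y j := fun j => by
    rw [lerchTerm_eq, betaCoeff_eq_integral (a := 1) (by simp) (by simpa using hy), one_mul,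
      ← integral_const_mul]
    congr 1
    ext q
    rw [mul_pow]
    simp only [mul_one]
    ring
  simp only [e] at h
  rw [lerchTail]
  simp only [zero_add]
  rw [h.tsum_eq, ← integral_const_mul]
  congr 1
  ext q
  have h1 : 1 - z = -1 / (w - 1) := by rw [hzdef]; field_simp; ring
  have h2 : 1 - z * (1 - Complex.exp (-q)) = -(1 - w * Complex.exp (-q)) / (w - 1) := by
    rw [hzdef]; field_simp; ring
  rw [h1, h2]
  -- The integrands are compared at every real q, negative ones included, where the denominator may
  -- vanish; both sides are then 0.
  by_cases h3 : 1 - w * Complex.exp (-q) = 0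
  · simp [h3]
  · field_simp

/-- The contiguous relation `betaCoeff_succ`, summed against z^j. It is the recurrence satisfied by
∑ w^j/(y+j), and so allows y to be moved to the left in unit steps. -/
theorem lerchTail_zero_recurrence {w y : ℂ} (hw1 : w ≠ 1) (hz : ‖w / (w - 1)‖ < 1)
    (hy : ∀ i : ℕ, y + i ≠ 0) :
    lerchTail 0 (w / (w - 1)) y = 1 / y + w * lerchTail 0 (w / (w - 1)) (y + 1) := by
  set z := w / (w - 1) with hzdef
  have hw1' : w - 1 ≠ 0 := sub_ne_zero.2 hw1
  have h1 : w * (1 - z) = -z := by rw [hzdef]; field_simp; ring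
  have hs := summable_lerchTerm hz y
  have hs1 := summable_lerchTerm hz (y + 1)
  have hss : Summable fun j => lerchTerm z y (j + 1) := (summable_nat_add_iff 1).2 hs
  have e : ∑' j, lerchTerm z y (j + 1) = z * ∑' j, lerchTerm z y j -
      z * ∑' j, lerchTerm z (y + 1) j := by
    rw [← mul_sub, ← hs.tsum_sub hs1, ← tsum_mul_left]
    congr 1
    ext j
    rw [lerchTerm_eq, lerchTerm_eq, lerchTerm_eq, betaCoeff_succ hy]
    ring
  have e0 := hs.tsum_eq_zero_add
  rw [e, lerchTerm_eq, betaCoeff_zero, pow_zero, one_mul] at e0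
  simp only [lerchTail, zero_add]
  rw [← mul_assoc, h1]
  linear_combination e0

/-- For Re y > 0 both sides are the same integral. Both obey the same recurrence in y, so induction
on a bound for -Re y reaches every y that is not a pole. -/
theorem hasSum_lerchTail_zero {w y : ℂ} (hw : ‖w‖ < 1) (hz : ‖w / (w - 1)‖ < 1)
    (hy : ∀ i : ℕ, y + i ≠ 0) :
    HasSum (fun j : ℕ => w ^ j / (y + j)) (lerchTail 0 (w / (w - 1)) y) := by
  have hw1 : w ≠ 1 := by rintro rfl; simp at hw
  have key : ∀ n : ℕ, ∀ y : ℂ, (∀ i : ℕ, y + i ≠ 0) → 0 < y.re + n →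
      HasSum (fun j : ℕ => w ^ j / (y + j)) (lerchTail 0 (w / (w - 1)) y) := by
    intro n
    induction n with
    | zero =>
      intro y _ h
      simp only [Nat.cast_zero, add_zero] at h
      have := hasSum_integral_exp_div_one_sub (c := y) (a := 1) (w := w) h (by simp) hw
      simp only [mul_one] at this
      rwa [← lerchTail_zero_eq_integral hw1 hz h] at this
    | succ n ih =>
      intro y hy h
      have h1 := ih (y + 1) (fun i => by
        have := hy (i + 1); push_cast at this; rwa [add_assoc, add_comm (1 : ℂ)])
        (by push_cast at h; simp; linarith)
      rw [lerchTail_zero_recurrence hw1 hz hy]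
      refine (hasSum_nat_add_iff' 1).1 ?_
      have h2 := h1.mul_left w
      simp only [Finset.sum_range_one, pow_zero, Nat.cast_zero, add_zero, add_sub_cancel_left]
      refine h2.congr_fun fun j => ?_
      push_cast
      rw [pow_succ, add_assoc y 1, add_comm (1 : ℂ)]
      ring
  obtain ⟨n, hn⟩ := exists_nat_gt (-y.re)
  exact key n y hy (by linarith)

/-! ### Integral form and uniform bound of the tails. -/

theorem lerchIntegral_recurrence {w y : ℂ} {c₀ : ℝ} (hc₀ : 0 < c₀)
    (h0 : ∀ q : ℝ, 0 ≤ q → c₀ ≤ ‖1 - w * Complex.exp (-q)‖) (hy : 0 < y.re) (n : ℕ) :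
    (y + n) * (∫ q in Ioi (0 : ℝ), Complex.exp (-(q * (y + n))) /
        (1 - w * Complex.exp (-q)) ^ (n + 1)) +
      (n + 1) * w * (∫ q in Ioi (0 : ℝ), Complex.exp (-(q * (y + (n + 1)))) /
        (1 - w * Complex.exp (-q)) ^ (n + 2)) = 1 / (1 - w) ^ (n + 1) := by
  have hne : ∀ q : ℝ, 0 ≤ q → 1 - w * Complex.exp (-q) ≠ 0 := fun q hq h => by
    have := h0 q hq; rw [h, norm_zero] at this; linarith
  have hyn : ∀ m : ℕ, 0 < (y + m).re := fun m => by simp; positivity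
  have hI : ∀ m k : ℕ, IntegrableOn (fun q : ℝ => Complex.exp (-(q * (y + m))) /
      (1 - w * Complex.exp (-q)) ^ k) (Ioi 0) := by
    intro m k
    refine Integrable.mul_bdd (c := (c₀ ^ k)⁻¹) (integrableOn_exp_neg_mul (hyn m)) ?_ ?_
    · exact (Measurable.inv (by fun_prop)).aestronglyMeasurable
    · filter_upwards [ae_restrict_mem measurableSet_Ioi] with q hq
      rw [norm_inv, norm_pow]
      have := h0 q (le_of_lt hq)
      gcongr
  have hI1 := (hI n (n + 1)).const_mul (y + n)
  have hI2 := (hI (n + 1) (n + 2)).const_mul ((n + 1) * w)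
  push_cast at hI2
  -- Integration by parts in closed form: the two integrands together are an exact derivative, and
  -- the right-hand side of the recurrence is its boundary value at q = 0.
  have hd : ∀ q ∈ Ici (0 : ℝ), HasDerivAt (fun q : ℝ => -(Complex.exp (-(q * (y + n))) /
      (1 - w * Complex.exp (-q)) ^ (n + 1)))
      ((y + n) * (Complex.exp (-(q * (y + n))) / (1 - w * Complex.exp (-q)) ^ (n + 1)) +
        (n + 1) * w * (Complex.exp (-(q * (y + (n + 1)))) /
          (1 - w * Complex.exp (-q)) ^ (n + 2))) q := by
    intro q hq
    have hq' := hne q hq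
    have d1 : HasDerivAt (fun q : ℝ => Complex.exp (-(q * (y + n))))
        (Complex.exp (-(q * (y + n))) * (-(1 * (y + n)))) q :=
      (((Complex.ofRealCLM.hasDerivAt (x := q)).mul_const (y + n)).neg).cexp
    have d2 : HasDerivAt (fun q : ℝ => 1 - w * Complex.exp (-q))
        (-(w * (Complex.exp (-q) * (-1)))) q :=
      ((((Complex.ofRealCLM.hasDerivAt (x := q)).neg).cexp).const_mul w).const_sub 1
    have d3 := (d1.div (d2.pow (n + 1)) (pow_ne_zero _ hq')).neg
    refine d3.congr_deriv ?_
    have : Complex.exp (-(q * (y + (n + 1)))) =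
        Complex.exp (-(q * (y + n))) * Complex.exp (-q) := by
      rw [← Complex.exp_add]; ring_nf
    rw [this]
    simp only [Pi.pow_apply]
    push_cast
    field_simp
    ring
  have ht : Tendsto (fun q : ℝ => -(Complex.exp (-(q * (y + n))) /
      (1 - w * Complex.exp (-q)) ^ (n + 1))) atTop (𝓝 0) := by
    have hb : Tendsto (fun q : ℝ => Real.exp (-(q * (y + n).re)) * (c₀ ^ (n + 1))⁻¹) atTop
        (𝓝 (0 * (c₀ ^ (n + 1))⁻¹)) :=
      (Real.tendsto_exp_neg_atTop_nhds_zero.comp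
        (tendsto_id.atTop_mul_const (hyn n))).mul_const _
    rw [zero_mul] at hb
    refine squeeze_zero_norm' ?_ hb
    filter_upwards [eventually_ge_atTop 0] with q hq
    rw [norm_neg, norm_div, norm_exp_neg_mul, norm_pow, div_eq_mul_inv]
    have := h0 q hq
    gcongr
  have hint := integral_Ioi_of_hasDerivAt_of_tendsto (a := 0)
    (hd 0 (by simp)).continuousAt.continuousWithinAt (fun q hq => hd q (mem_Ici.2 (le_of_lt hq)))
    (hI1.add hI2) ht
  rw [integral_add hI1 hI2, integral_const_mul, integral_const_mul] at hint
  rw [hint]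
  simp

/-- Removing one term of the series is one integration by parts of the integral. The condition |w| <
1 is replaced by a lower bound for the denominator, because |w| = 1 can occur at the tip of the cut.
-/
theorem lerchTail_eq_integral {w y : ℂ} {c₀ : ℝ} (hz : ‖w / (w - 1)‖ < 1) (hc₀ : 0 < c₀)
    (h0 : ∀ q : ℝ, 0 ≤ q → c₀ ≤ ‖1 - w * Complex.exp (-q)‖) (hy : 0 < y.re) (n : ℕ) :
    lerchTail n (w / (w - 1)) y = (-w) ^ n * (n.factorial : ℂ) / poch y n *
      ∫ q in Ioi (0 : ℝ), Complex.exp (-(q * (y + n))) / (1 - w * Complex.exp (-q)) ^ (n + 1) := by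
  have hw1 : 1 - w ≠ 0 := fun h => by
    have := h0 0 le_rfl; simp [h] at this; linarith
  have hw1' : w - 1 ≠ 0 := fun h => hw1 (by linear_combination -h)
  have hyn : ∀ i : ℕ, y + i ≠ 0 := add_natCast_ne_zero_of_mem_slitPlane (Or.inl hy)
  induction n with
  | zero =>
    rw [lerchTail_zero_eq_integral (sub_ne_zero.1 hw1') hz hy]
    simp [poch_zero]
  | succ n ih =>
    have hrec := lerchIntegral_recurrence hc₀ h0 hy n
    have hadd := lerchTail_eq_add hz y n
    rw [ih] at hadd
    have hP := poch_ne_zero hyn n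
    have hyn' := hyn n
    have e : lerchTail (n + 1) (w / (w - 1)) y = (-w) ^ n * (n.factorial : ℂ) / poch y n *
      (∫ q in Ioi (0 : ℝ), Complex.exp (-(q * (y + n))) / (1 - w * Complex.exp (-q)) ^ (n + 1)) -
      (1 - w / (w - 1)) * lerchTerm (w / (w - 1)) y n := by linear_combination -hadd
    rw [e, lerchTerm, poch_succ, Nat.factorial_succ]
    push_cast
    have e2 : (∫ q in Ioi (0 : ℝ), Complex.exp (-(q * (y + n))) /
        (1 - w * Complex.exp (-q)) ^ (n + 1)) = (1 / (1 - w) ^ (n + 1) -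
      (n + 1) * w * (∫ q in Ioi (0 : ℝ), Complex.exp (-(q * (y + (n + 1)))) /
        (1 - w * Complex.exp (-q)) ^ (n + 2))) / (y + n) := by
      rw [eq_div_iff hyn']; linear_combination hrec
    rw [e2]
    -- Matches the removed term of the series with the boundary term at q = 0 in the integration by
    -- parts.
    have e3 : (1 - w / (w - 1)) * ((w / (w - 1)) ^ n) = (-w) ^ n / (1 - w) ^ (n + 1) := by
      have : w / (w - 1) = (-w) / (1 - w) := by
        rw [← neg_sub w 1, neg_div_neg_eq]
      rw [this, div_pow]
      field_simp
      ring
    have e4 : (1 - w / (w - 1)) * ((w / (w - 1)) ^ n * (n.factorial : ℂ) / (poch y n * (y + n))) =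
      (-w) ^ n / (1 - w) ^ (n + 1) * (n.factorial : ℂ) / (poch y n * (y + n)) := by
      rw [← e3]; ring
    rw [e4]
    generalize (∫ q in Ioi (0 : ℝ), Complex.exp (-(q * (y + (n + 1)))) /
        (1 - w * Complex.exp (-q)) ^ (n + 2)) = A
    field_simp
    ring

theorem norm_lerchTail_le {w y : ℂ} {c₀ c : ℝ} (hc : c < 1) (hc₀ : 0 < c₀)
    (h0 : ∀ q : ℝ, 0 ≤ q → c₀ ≤ ‖1 - w * Complex.exp (-q)‖)
    (hwc : ∀ q : ℝ, 0 ≤ q → ‖w * Complex.exp (-q)‖ ≤ c * ‖1 - w * Complex.exp (-q)‖)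
    (hy : 0 < y.re) (n : ℕ) :
    ‖lerchTail n (w / (w - 1)) y‖ ≤
      c ^ n / c₀ * (1 / y.re) * ((n.factorial : ℝ) / ‖poch y n‖) := by
  have hz : ‖w / (w - 1)‖ < 1 := by
    have h1 := hwc 0 le_rfl
    have h2 := h0 0 le_rfl
    simp only [Complex.ofReal_zero, neg_zero, Complex.exp_zero, mul_one] at h1 h2
    rw [norm_sub_rev] at h1 h2
    rw [norm_div, div_lt_one (by linarith)]
    nlinarith
  rw [lerchTail_eq_integral hz hc₀ h0 hy, mul_div_assoc, mul_right_comm, norm_mul, norm_div,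
    Complex.norm_natCast, ← integral_const_mul]
  refine mul_le_mul_of_nonneg_right ?_ (by positivity)
  have : c ^ n / c₀ * (1 / y.re) = ∫ q in Ioi (0 : ℝ), Real.exp (-(q * y.re)) * (c ^ n / c₀) := by
    rw [integral_mul_const, integral_exp_neg_mul_re hy, mul_comm]
  rw [this]
  refine norm_integral_le_of_norm_le ((integrableOn_exp_neg_mul_re hy).mul_const _) ?_
  filter_upwards [ae_restrict_mem measurableSet_Ioi] with q hq
  have hq0 := le_of_lt (mem_Ioi.1 hq)
  have hpos : 0 < ‖1 - w * Complex.exp (-q)‖ := hc₀.trans_le (h0 q hq0)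
  -- Distributing e^{-qn} over the n-th power isolates a ratio bounded by c at every q, which gives
  -- c^n; the one remaining denominator costs 1/c₀.
  have e : (-w) ^ n * (Complex.exp (-(q * (y + n))) / (1 - w * Complex.exp (-q)) ^ (n + 1)) =
      Complex.exp (-(q * y)) * ((-(w * Complex.exp (-q)) / (1 - w * Complex.exp (-q))) ^ n /
        (1 - w * Complex.exp (-q))) := by
    have : Complex.exp (-(q * (y + n))) = Complex.exp (-(q * y)) * Complex.exp (-q) ^ n := by
      rw [← Complex.exp_nat_mul, ← Complex.exp_add]; ring_nf
    rw [this, div_pow, ← neg_mul w, mul_pow, pow_succ]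
    have := norm_pos_iff.1 hpos
    field_simp
  rw [e, norm_mul, norm_exp_neg_mul, norm_div, norm_pow, norm_div, norm_neg]
  have h1 : ‖w * Complex.exp (-q)‖ / ‖1 - w * Complex.exp (-q)‖ ≤ c :=
    (div_le_iff₀ hpos).2 (hwc q hq0)
  have := h0 q hq0
  have hc' : 0 ≤ c := le_trans (by positivity) h1
  gcongr

/-! ### Large-index asymptotics of the tails. -/

theorem tendsto_betaCoeff_div (y : ℂ) (hy : ∀ i : ℕ, y + i ≠ 0) (i : ℕ) :
    Tendsto (fun n => betaCoeff y (n + i) / betaCoeff y n) atTop (𝓝 1) := by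
  induction i with
  | zero =>
    refine tendsto_const_nhds.congr fun n => ?_
    rw [add_zero, div_self (betaCoeff_ne_zero hy n)]
  | succ i ih =>
    have h1 : Tendsto (fun j : ℕ => (j + 1 : ℂ) / (y + j + 1)) atTop (𝓝 1) := by
      have h1 : Tendsto (fun j : ℕ => (1 : ℂ) + y / (j + 1 : ℂ)) atTop (𝓝 (1 + 0)) := by
        refine tendsto_const_nhds.add ?_
        have := (tendsto_one_div_add_atTop_nhds_zero_nat (𝕜 := ℂ)).const_mul y
        simpa [div_eq_mul_inv] using this
      have h2 := h1.inv₀ (by simp)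
      simp only [add_zero, inv_one] at h2
      refine h2.congr fun j => ?_
      have : (j + 1 : ℂ) ≠ 0 := by exact_mod_cast j.succ_ne_zero
      rw [← inv_div]
      field_simp
      ring
    have h2 := ih.mul (h1.comp (tendsto_add_atTop_nat i))
    rw [mul_one] at h2
    refine h2.congr fun n => ?_
    simp only [Function.comp]
    rw [← add_assoc, betaCoeff_succ_eq_mul]
    ring

/-- Successive coefficients b_j = j!/(y)_{j+1} have ratio tending to 1, so the tail is close to a
geometric series, which the prefactor 1 - z normalizes to 1. The relative error is (1-z) ∑ z^i
(b_{n+1+i}/b_n - 1) for the tail starting at n + 1. It is bounded uniformly for |z| ≤ c by a series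
that tends to 0 by dominated convergence. -/
theorem lerchTail_asymptotic {c : ℝ} (hc0 : 0 ≤ c) (hc : c < 1) {y : ℂ}
    (hy : ∀ i : ℕ, y + i ≠ 0) {ε : ℝ} (hε : 0 < ε) :
    ∀ᶠ n : ℕ in atTop, ∀ z : ℂ, ‖z‖ ≤ c → ∃ e : ℂ, ‖e‖ ≤ ε ∧
      lerchTail n z y = z ^ n * ((n - 1).factorial : ℂ) / poch y n * (1 + e) := by
  -- Coefficient ratios are eventually at most ρ, although they may exceed 1; cρ < 1 keeps the
  -- dominating series geometric.
  obtain ⟨ρ, hρ1, hρ⟩ : ∃ ρ : ℝ, 1 < ρ ∧ c * ρ < 1 := by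
    rcases hc0.eq_or_lt with h | h
    · exact ⟨2, by norm_num, by simp [← h]⟩
    · obtain ⟨ρ, h1, h2⟩ := exists_between (show 1 < 1 / c by rwa [lt_div_iff₀ h, one_mul])
      exact ⟨ρ, h1, by rwa [lt_div_iff₀ h, mul_comm] at h2⟩
  have hcρ : 0 ≤ c * ρ := mul_nonneg hc0 (by linarith)
  have hstep : ∀ᶠ n : ℕ in atTop, ∀ i : ℕ,
      ‖betaCoeff y (n + i) / betaCoeff y n‖ ≤ ρ ^ i := by
    have := (tendsto_succ_div_add y 1).eventually_le_const hρ1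
    obtain ⟨n₀, hn₀⟩ := eventually_atTop.1 this
    filter_upwards [eventually_ge_atTop n₀] with n hn i
    induction i with
    | zero => simp [div_self (betaCoeff_ne_zero hy n)]
    | succ i ih =>
      rw [← add_assoc, betaCoeff_succ_eq_mul, mul_div_right_comm, norm_mul, pow_succ]
      have := hn₀ (n + i) (by omega)
      rw [one_mul] at this
      gcongr
  have hlim : Tendsto (fun n : ℕ => ∑' i : ℕ,
      c ^ i * ‖betaCoeff y (n + (i + 1)) / betaCoeff y n - 1‖) atTop (𝓝 (∑' i : ℕ, (0 : ℝ))) := by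
    refine tendsto_tsum_of_dominated_convergence
      (bound := fun i => ρ * (c * ρ) ^ i + c ^ i) ?_ ?_ ?_
    · exact ((summable_geometric_of_lt_one hcρ hρ).mul_left ρ).add
        (summable_geometric_of_lt_one hc0 hc)
    · intro i
      have := (((tendsto_betaCoeff_div y hy (i + 1)).sub_const 1).norm).const_mul (c ^ i)
      simpa using this
    · filter_upwards [hstep] with n hn i
      rw [Real.norm_of_nonneg (by positivity)]
      have := norm_sub_le (betaCoeff y (n + (i + 1)) / betaCoeff y n) 1
      rw [norm_one] at this
      calc _ ≤ c ^ i * (ρ ^ (i + 1) + 1) := by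
            have := hn (i + 1)
            gcongr
            linarith
        _ = _ := by rw [mul_pow]; ring
  rw [tsum_zero] at hlim
  have hev := (tendsto_add_atTop_iff_nat 1).2 (tendsto_id (α := ℕ) (x := atTop))
  -- The tail from n + 1 is compared with the coefficient of index n, since (n-1)!/(y)_n is the
  -- coefficient preceding the tail from n.
  have h1 : ∀ᶠ n : ℕ in atTop, ∀ z : ℂ, ‖z‖ ≤ c → ∃ e : ℂ, ‖e‖ ≤ ε ∧
      lerchTail (n + 1) z y = z ^ (n + 1) * (n.factorial : ℂ) / poch y (n + 1) * (1 + e) := by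
    filter_upwards [hstep, hlim.eventually_le_const (show 0 < ε / 2 by positivity)] with n hn hn2 z hz
    have hz1 : ‖z‖ < 1 := hz.trans_lt hc
    have hB := betaCoeff_ne_zero hy n
    have hdom : ∀ i : ℕ, c ^ i * ‖betaCoeff y (n + (i + 1)) / betaCoeff y n - 1‖ ≤
        ρ * (c * ρ) ^ i + c ^ i := fun i => by
      have := norm_sub_le (betaCoeff y (n + (i + 1)) / betaCoeff y n) 1
      rw [norm_one] at this
      calc _ ≤ c ^ i * (ρ ^ (i + 1) + 1) := by
            have := hn (i + 1)
            gcongr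
            linarith
        _ = _ := by rw [mul_pow]; ring
    have hsum : Summable fun i : ℕ =>
        c ^ i * ‖betaCoeff y (n + (i + 1)) / betaCoeff y n - 1‖ :=
      Summable.of_nonneg_of_le (fun i => by positivity) hdom
        (((summable_geometric_of_lt_one hcρ hρ).mul_left ρ).add
        (summable_geometric_of_lt_one hc0 hc))
    have hle : ∀ i : ℕ, ‖z ^ i * (betaCoeff y (n + (i + 1)) / betaCoeff y n - 1)‖ ≤
        c ^ i * ‖betaCoeff y (n + (i + 1)) / betaCoeff y n - 1‖ := fun i => by
      rw [norm_mul, norm_pow]; gcongr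
    have hsz := Summable.of_norm_bounded hsum hle
    refine ⟨(1 - z) * ∑' i : ℕ, z ^ i * (betaCoeff y (n + (i + 1)) / betaCoeff y n - 1), ?_, ?_⟩
    · rw [norm_mul]
      have ha : ‖1 - z‖ ≤ 2 := by
        have := norm_sub_le 1 z
        rw [norm_one] at this
        linarith
      have hb := tsum_of_norm_bounded hsum.hasSum hle
      calc _ ≤ 2 * (ε / 2) := by
            gcongr
            exact hb.trans hn2
        _ = ε := by ring
    · have hg := tsum_geometric_of_norm_lt_one hz1
      have h1z : 1 - z ≠ 0 := fun h => by
        rw [← sub_eq_zero.1 h, norm_one] at hz1; linarith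
      have e1 : (1 : ℂ) = (1 - z) * ∑' i : ℕ, z ^ i := by
        rw [hg]; field_simp
      have e2 : 1 + (1 - z) * ∑' i : ℕ, z ^ i * (betaCoeff y (n + (i + 1)) / betaCoeff y n - 1) =
          (1 - z) * ∑' i : ℕ, z ^ i * (betaCoeff y (n + (i + 1)) / betaCoeff y n) := by
        nth_rewrite 1 [e1]
        rw [← mul_add, ← (summable_geometric_of_norm_lt_one hz1).tsum_add hsz]
        congr 2
        ext i
        ring
      rw [e2, mul_div_assoc, ← betaCoeff, lerchTail, mul_left_comm, ← tsum_mul_left (a := z ^ (n + 1) * betaCoeff y n)]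
      refine congrArg (fun S => (1 - z) * S) (tsum_congr fun i => ?_)
      rw [lerchTerm_eq, pow_add, add_right_comm n 1 i, add_assoc n i 1]
      field_simp
  obtain ⟨n₀, hn₀⟩ := eventually_atTop.1 h1
  filter_upwards [eventually_ge_atTop (n₀ + 1)] with n hn
  obtain ⟨m, rfl⟩ : ∃ m, n = m + 1 := ⟨n - 1, by omega⟩
  exact hn₀ m (by omega)

/-! ### Geometry of the parameters -/

theorem normSq_one_add_exp (γ : ℂ) : ‖1 + Complex.exp γ‖ ^ 2 =
    1 + 2 * Real.exp γ.re * Real.cos γ.im + Real.exp γ.re ^ 2 := by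
  rw [Complex.sq_norm, Complex.normSq_apply]
  simp only [Complex.add_re, Complex.one_re, Complex.add_im, Complex.one_im, Complex.exp_re,
    Complex.exp_im]
  have := Real.sin_sq_add_cos_sq γ.im
  linear_combination (Real.exp γ.re) ^ 2 * this

theorem normSq_one_sub_exp (γ : ℂ) : ‖1 - Complex.exp γ‖ ^ 2 =
    1 - 2 * Real.exp γ.re * Real.cos γ.im + Real.exp γ.re ^ 2 := by
  rw [Complex.sq_norm, Complex.normSq_apply]
  simp only [Complex.sub_re, Complex.one_re, Complex.sub_im, Complex.one_im, Complex.exp_re,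
    Complex.exp_im]
  have := Real.sin_sq_add_cos_sq γ.im
  linear_combination (Real.exp γ.re) ^ 2 * this

/-- Put ρ = |e^{γ-τ}|. After squaring, the claim is c_γ ρ² ≤ 1 - 2ρ cos(Im γ). As ρ ≤ 1 the left
side is at most c_γ ρ = ρ e^{-Re γ} - 2ρ cos(Im γ), and ρ e^{-Re γ} = e^{-τ} ≤ 1. This is the role
of the constant `cBeta`. -/
theorem norm_exp_le_mul_norm_one_sub_exp {γ : ℂ} (hγ : γ.re ≤ 0) (hc : 0 < cBeta γ) {τ : ℝ}
    (hτ : 0 ≤ τ) : ‖Complex.exp (γ - τ)‖ ≤ 1 / √(1 + cBeta γ) * ‖1 - Complex.exp (γ - τ)‖ := by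
  have hs : 0 < √(1 + cBeta γ) := Real.sqrt_pos.2 (by linarith)
  rw [one_div, ← div_eq_inv_mul, le_div_iff₀ hs]
  refine (sq_le_sq₀ (by positivity) (norm_nonneg _)).1 ?_
  rw [mul_pow, Real.sq_sqrt (by linarith), normSq_one_sub_exp, Complex.norm_exp]
  simp only [Complex.sub_re, Complex.ofReal_re, Complex.sub_im, Complex.ofReal_im, sub_zero]
  have hρ : 0 < Real.exp (γ.re - τ) := Real.exp_pos _
  have hρ1 : Real.exp (γ.re - τ) ≤ 1 := Real.exp_le_one_iff.2 (by linarith)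
  have h1 : Real.exp (γ.re - τ) * Real.exp (-γ.re) ≤ 1 := by
    rw [← Real.exp_add]; exact Real.exp_le_one_iff.2 (by linarith)
  have h2 : cBeta γ = Real.exp (-γ.re) - 2 * Real.cos γ.im := rfl
  set ρ := Real.exp (γ.re - τ)
  have h3 : cBeta γ * ρ ≤ cBeta γ := mul_le_of_le_one_right hc.le hρ1
  have h4 : ρ * (cBeta γ * ρ) ≤ ρ * cBeta γ := by gcongr
  have h5 : ρ * cBeta γ = ρ * Real.exp (-γ.re) - 2 * ρ * Real.cos γ.im := by rw [h2]; ring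
  nlinarith

theorem norm_exp_le_mul_norm_one_add_exp {γ : ℂ} (hγ : γ.re ≤ 0) (hγi : |γ.im| ≤ Real.pi / 2)
    {τ : ℝ} (hτ : 0 ≤ τ) :
    ‖Complex.exp (γ - τ)‖ ≤ 1 / √2 * ‖1 + Complex.exp (γ - τ)‖ := by
  have hs : 0 < √(2 : ℝ) := by positivity
  rw [one_div, ← div_eq_inv_mul, le_div_iff₀ hs]
  refine (sq_le_sq₀ (by positivity) (norm_nonneg _)).1 ?_
  rw [mul_pow, Real.sq_sqrt (by norm_num), normSq_one_add_exp, Complex.norm_exp]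
  simp only [Complex.sub_re, Complex.ofReal_re, Complex.sub_im, Complex.ofReal_im, sub_zero]
  have hρ : 0 < Real.exp (γ.re - τ) := Real.exp_pos _
  have hρ1 : Real.exp (γ.re - τ) ≤ 1 := Real.exp_le_one_iff.2 (by linarith)
  have hcos : 0 ≤ Real.cos γ.im := Real.cos_nonneg_of_mem_Icc (abs_le.1 hγi |>.imp (by intro h; linarith) id)
  have := mul_nonneg hρ.le hcos
  nlinarith

/-- A sharper constant than 1/√2 when the imaginary part is small: it tends to 1/2 as η → 0, which
compensates growth of the coefficients at any rate below 2. -/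
theorem norm_exp_le_mul_norm_one_add_exp_of_abs_im_le {γ : ℂ} (hγ : γ.re ≤ 0) {η : ℝ}
    (hη : η ≤ Real.pi / 2) (hγi : |γ.im| ≤ η) {τ : ℝ} (hτ : 0 ≤ τ) :
    ‖Complex.exp (γ - τ)‖ ≤ 1 / (1 + Real.cos η) * ‖1 + Complex.exp (γ - τ)‖ := by
  have hη0 : 0 ≤ η := (abs_nonneg _).trans hγi
  have hcη : 0 ≤ Real.cos η := Real.cos_nonneg_of_mem_Icc ⟨by linarith, hη⟩
  have hcos : Real.cos η ≤ Real.cos γ.im := by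
    rw [← Real.cos_abs γ.im]
    exact Real.cos_le_cos_of_nonneg_of_le_pi (abs_nonneg _) (by linarith [Real.pi_pos]) hγi
  have hcos1 := Real.cos_le_one η
  have hs : 0 < 1 + Real.cos η := by linarith
  rw [one_div, ← div_eq_inv_mul, le_div_iff₀ hs]
  refine (sq_le_sq₀ (by positivity) (norm_nonneg _)).1 ?_
  rw [mul_pow, normSq_one_add_exp, Complex.norm_exp]
  simp only [Complex.sub_re, Complex.ofReal_re, Complex.sub_im, Complex.ofReal_im, sub_zero]
  have hρ : 0 < Real.exp (γ.re - τ) := Real.exp_pos _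
  have hρ1 : Real.exp (γ.re - τ) ≤ 1 := Real.exp_le_one_iff.2 (by linarith)
  set ρ := Real.exp (γ.re - τ)
  have h1 : ρ * Real.cos η ≤ ρ * Real.cos γ.im := by gcongr
  have h2 : 0 ≤ ρ * Real.cos η := by positivity
  have h3 : ρ * Real.cos η ≤ 1 := by nlinarith
  have h4 : 0 ≤ (1 - ρ) * (ρ * Real.cos η) := mul_nonneg (by linarith) h2
  nlinarith

/-- The standing assumptions on `β` and the directions `b`, `θ`. -/
structure AdmissibleParameter (β : ℂ) (b θ : ℝ) : Prop where
  ne_zero : β ≠ 0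
  polar : β = (‖β‖ : ℂ) * Complex.exp (b * Complex.I)
  re_nonpos : β.re ≤ 0
  cBeta_pos : 0 < cBeta β
  norm_le_pi : ‖β‖ ≤ Real.pi
  exp_theta : Complex.exp (θ * Complex.I) = -Complex.exp (-(b * Complex.I))

theorem cOne_pos (β : ℂ) : 0 < cOne β := lt_max_of_lt_right (by positivity)

theorem cOne_lt_one {β : ℂ} (hc : 0 < cBeta β) : cOne β < 1 := by
  refine max_lt ?_ ?_
  · rw [div_lt_one (Real.sqrt_pos.2 (by linarith)), Real.lt_sqrt (by norm_num)]
    linarith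
  · rw [div_lt_one (by positivity), Real.lt_sqrt (by norm_num)]
    norm_num

namespace AdmissibleParameter

variable {β : ℂ} {b θ : ℝ}

theorem norm_pos (h : AdmissibleParameter β b θ) : 0 < ‖β‖ := _root_.norm_pos_iff.2 h.ne_zero

/-- The direction of the cut is chosen so that β e^{iθ} = -|β|. Along the cut βs therefore moves
left with constant imaginary part, and moving along the ray φ = -b adds another real shift. -/
theorem mul_cutPoint (h : AdmissibleParameter β b θ) (t : ℝ) :
    β * cutPoint θ t = β - ((t * ‖β‖ : ℝ) : ℂ) := by
  have e : Complex.exp (b * Complex.I) * Complex.exp (-(b * Complex.I)) = 1 := by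
    rw [← Complex.exp_add, add_neg_cancel, Complex.exp_zero]
  have e2 : β * Complex.exp (-(b * Complex.I)) = ‖β‖ := by
    conv_lhs => rw [h.polar]
    rw [mul_assoc, e, mul_one]
  rw [cutPoint, h.exp_theta]
  push_cast
  linear_combination -(t : ℂ) * e2

theorem mul_rayPoint (h : AdmissibleParameter β b θ) (φ r : ℝ) :
    β * rayPoint φ r = ((r * ‖β‖ : ℝ) : ℂ) * Complex.exp ((φ + b : ℝ) * Complex.I) := by
  conv_lhs => rw [h.polar]
  rw [rayPoint]
  push_cast
  rw [add_mul, Complex.exp_add]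
  ring

theorem mul_rayPoint_neg (h : AdmissibleParameter β b θ) (r : ℝ) :
    β * rayPoint (-b) r = ((r * ‖β‖ : ℝ) : ℂ) := by
  rw [h.mul_rayPoint]; simp

theorem abs_im_le (_ : AdmissibleParameter β b θ) : |β.im| ≤ ‖β‖ := Complex.abs_im_le_norm β

theorem div_two_pow_re_nonpos (h : AdmissibleParameter β b θ) (k : ℕ) : (β / 2 ^ k).re ≤ 0 := by
  have : β / 2 ^ k = ((1 / 2 ^ k : ℝ) : ℂ) * β := by push_cast; ring
  rw [this, Complex.re_ofReal_mul]
  exact mul_nonpos_of_nonneg_of_nonpos (by positivity) h.re_nonpos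

theorem abs_div_two_pow_im_le (h : AdmissibleParameter β b θ) (k : ℕ) :
    |(β / 2 ^ k).im| ≤ Real.pi / 2 ^ k := by
  have : β / 2 ^ k = ((1 / 2 ^ k : ℝ) : ℂ) * β := by push_cast; ring
  rw [this, Complex.im_ofReal_mul, abs_mul, abs_of_pos (by positivity), one_div, ← div_eq_inv_mul]
  have := h.abs_im_le.trans h.norm_le_pi
  gcongr

theorem pi_div_two_pow_le {k : ℕ} (hk : 1 ≤ k) : Real.pi / 2 ^ k ≤ Real.pi / 2 := by
  have : (2 : ℝ) ^ 1 ≤ 2 ^ k := pow_le_pow_right₀ (by norm_num) hk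
  have := Real.pi_pos
  gcongr
  linarith

theorem exp_mul_cutPoint_mul_exp (h : AdmissibleParameter β b θ) (t q : ℝ) :
    Complex.exp (β * cutPoint θ t) * Complex.exp (-q) =
      Complex.exp (β - ((t * ‖β‖ + q : ℝ) : ℂ)) := by
  rw [h.mul_cutPoint, ← Complex.exp_add]
  push_cast
  ring_nf

theorem exp_mul_cutPoint_div_mul_exp (h : AdmissibleParameter β b θ) (k : ℕ) (t q : ℝ) :
    Complex.exp (β * cutPoint θ t / 2 ^ k) * Complex.exp (-q) =
      Complex.exp (β / 2 ^ k - ((t * ‖β‖ / 2 ^ k + q : ℝ) : ℂ)) := by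
  rw [h.mul_cutPoint, ← Complex.exp_add]
  push_cast
  ring_nf

theorem norm_exp_le_zero (h : AdmissibleParameter β b θ) {t q : ℝ} (ht : 0 ≤ t) (hq : 0 ≤ q) :
    ‖Complex.exp (β * cutPoint θ t) * Complex.exp (-q)‖ ≤
      cOne β * ‖1 - Complex.exp (β * cutPoint θ t) * Complex.exp (-q)‖ := by
  rw [h.exp_mul_cutPoint_mul_exp]
  refine (norm_exp_le_mul_norm_one_sub_exp h.re_nonpos h.cBeta_pos (by positivity)).trans ?_
  gcongr
  exact le_max_left _ _

theorem norm_exp_le_dyadic (h : AdmissibleParameter β b θ) {k : ℕ} (hk : 1 ≤ k) {t q : ℝ}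
    (ht : 0 ≤ t) (hq : 0 ≤ q) :
    ‖-Complex.exp (β * cutPoint θ t / 2 ^ k) * Complex.exp (-q)‖ ≤
      cOne β * ‖1 - -Complex.exp (β * cutPoint θ t / 2 ^ k) * Complex.exp (-q)‖ := by
  rw [neg_mul, sub_neg_eq_add, norm_neg, h.exp_mul_cutPoint_div_mul_exp]
  refine (norm_exp_le_mul_norm_one_add_exp (h.div_two_pow_re_nonpos k)
    ((h.abs_div_two_pow_im_le k).trans (pi_div_two_pow_le hk)) (by positivity)).trans ?_
  gcongr
  exact le_max_right _ _

/-- Were the denominator zero, the bound of the exponential by a multiple of it would make an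
exponential vanish. -/
theorem exp_sub_one_ne_zero (h : AdmissibleParameter β b θ) {t : ℝ} (ht : 0 ≤ t) :
    Complex.exp (β * cutPoint θ t) - 1 ≠ 0 := by
  intro h0
  have h1 := h.norm_exp_le_zero ht le_rfl
  simp only [Complex.ofReal_zero, neg_zero, Complex.exp_zero, mul_one] at h1
  rw [norm_sub_rev, h0, norm_zero, mul_zero] at h1
  exact Complex.exp_ne_zero _ (norm_le_zero_iff.1 h1)

theorem exp_add_one_ne_zero (h : AdmissibleParameter β b θ) {k : ℕ} (hk : 1 ≤ k) {t : ℝ}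
    (ht : 0 ≤ t) : Complex.exp (β * cutPoint θ t / 2 ^ k) + 1 ≠ 0 := by
  intro h0
  have h1 := h.norm_exp_le_dyadic hk ht le_rfl
  simp only [Complex.ofReal_zero, neg_zero, Complex.exp_zero, mul_one, sub_neg_eq_add] at h1
  rw [add_comm (1 : ℂ), h0, norm_zero, mul_zero, norm_neg] at h1
  exact Complex.exp_ne_zero _ (norm_le_zero_iff.1 h1)

theorem norm_zZero_le (h : AdmissibleParameter β b θ) {t : ℝ} (ht : 0 ≤ t) :
    ‖zZero β θ t‖ ≤ cOne β := by
  have h1 := h.norm_exp_le_zero ht le_rfl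
  simp only [Complex.ofReal_zero, neg_zero, Complex.exp_zero, mul_one] at h1
  rw [norm_sub_rev] at h1
  rw [zZero, norm_div, div_le_iff₀ (norm_pos_iff.2 (h.exp_sub_one_ne_zero ht))]
  exact h1

theorem norm_zDyadic_le (h : AdmissibleParameter β b θ) {k : ℕ} (hk : 1 ≤ k) {t : ℝ}
    (ht : 0 ≤ t) : ‖zDyadic β θ k t‖ ≤ cOne β := by
  have h1 := h.norm_exp_le_dyadic hk ht le_rfl
  simp only [Complex.ofReal_zero, neg_zero, Complex.exp_zero, mul_one, sub_neg_eq_add,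
    norm_neg] at h1
  rw [add_comm (1 : ℂ)] at h1
  rw [zDyadic, norm_div, div_le_iff₀ (norm_pos_iff.2 (h.exp_add_one_ne_zero hk ht))]
  exact h1

theorem norm_zDyadic_le_cos (h : AdmissibleParameter β b θ) {k : ℕ} (hk : 1 ≤ k) {t : ℝ}
    (ht : 0 ≤ t) : ‖zDyadic β θ k t‖ ≤ 1 / (1 + Real.cos (Real.pi / 2 ^ k)) := by
  have h1 := norm_exp_le_mul_norm_one_add_exp_of_abs_im_le (h.div_two_pow_re_nonpos k)
    (pi_div_two_pow_le hk) (h.abs_div_two_pow_im_le k) (τ := t * ‖β‖ / 2 ^ k) (by positivity)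
  have e := h.exp_mul_cutPoint_div_mul_exp k t 0
  simp only [Complex.ofReal_zero, neg_zero, Complex.exp_zero, mul_one, add_zero] at e
  rw [← e, add_comm (1 : ℂ)] at h1
  rw [zDyadic, norm_div, div_le_iff₀ (norm_pos_iff.2 (h.exp_add_one_ne_zero hk ht))]
  exact h1

theorem norm_zZero_lt_one (h : AdmissibleParameter β b θ) {t : ℝ} (ht : 0 ≤ t) :
    ‖zZero β θ t‖ < 1 := (h.norm_zZero_le ht).trans_lt (cOne_lt_one h.cBeta_pos)

theorem norm_zDyadic_lt_one (h : AdmissibleParameter β b θ) {k : ℕ} (hk : 1 ≤ k) {t : ℝ}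
    (ht : 0 ≤ t) : ‖zDyadic β θ k t‖ < 1 :=
  (h.norm_zDyadic_le hk ht).trans_lt (cOne_lt_one h.cBeta_pos)

theorem zDyadic_eq (β : ℂ) (θ : ℝ) (k : ℕ) (t : ℝ) :
    zDyadic β θ k t = -Complex.exp (β * cutPoint θ t / 2 ^ k) /
      (-Complex.exp (β * cutPoint θ t / 2 ^ k) - 1) := by
  rw [zDyadic, ← neg_div_neg_eq]
  ring_nf

theorem cos_add_pos {φ : ℝ} (hφ : |φ + b| < Real.pi / 2) : 0 < Real.cos (φ + b) :=
  Real.cos_pos_of_mem_Ioo (abs_lt.1 hφ)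

/-- `β (s - p)` for `s` on the cut and `p` on a ray differs from `β` by a point of a sector. -/
theorem mul_cutPoint_sub_rayPoint (h : AdmissibleParameter β b θ) (φ t r : ℝ) :
    β * (cutPoint θ t - rayPoint φ r) = β - (((t * ‖β‖ : ℝ) : ℂ) +
      ((r * ‖β‖ : ℝ) : ℂ) * Complex.exp ((φ + b : ℝ) * Complex.I)) := by
  rw [mul_sub, h.mul_cutPoint, h.mul_rayPoint]; ring

theorem sector_bound {ψ : ℝ} (hψ : 0 < Real.cos ψ) {t r : ℝ} (ht : 0 ≤ t) (hr : 0 ≤ r) :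
    Real.cos ψ * ‖(t : ℂ) + (r : ℂ) * Complex.exp (ψ * Complex.I)‖ ≤
      ((t : ℂ) + (r : ℂ) * Complex.exp (ψ * Complex.I)).re := by
  have h1 : ((t : ℂ) + (r : ℂ) * Complex.exp (ψ * Complex.I)).re = t + r * Real.cos ψ := by
    simp [Complex.exp_ofReal_mul_I_re]
  have h2 : ‖(t : ℂ) + (r : ℂ) * Complex.exp (ψ * Complex.I)‖ ≤ t + r := by
    refine (norm_add_le _ _).trans ?_
    rw [norm_mul, Complex.norm_exp_ofReal_mul_I, mul_one, Complex.norm_of_nonneg ht,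
      Complex.norm_of_nonneg hr]
  rw [h1]
  have := Real.cos_le_one ψ
  nlinarith

/-- Near the vertex of the sector continuity applies because e^γ ≠ 1. Away from it, Re v ≥ m|v|
keeps |e^{γ-v}| below a constant less than 1. -/
theorem exists_le_norm_one_sub_exp {γ : ℂ} (hγ : γ.re ≤ 0) (hγ1 : Complex.exp γ ≠ 1) {m : ℝ}
    (hm : 0 < m) : ∃ c : ℝ, 0 < c ∧ ∀ v : ℂ, m * ‖v‖ ≤ v.re →
      c ≤ ‖1 - Complex.exp (γ - v)‖ := by
  have hpos : 0 < ‖1 - Complex.exp γ‖ := norm_pos_iff.2 (sub_ne_zero.2 hγ1.symm)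
  have hc : ContinuousAt (fun v : ℂ => ‖1 - Complex.exp (γ - v)‖) 0 := by fun_prop
  have h0 : ∀ᶠ v : ℂ in 𝓝 0, ‖1 - Complex.exp γ‖ / 2 < ‖1 - Complex.exp (γ - v)‖ :=
    continuousAt_const.eventually_lt hc (by simpa using half_lt_self hpos)
  obtain ⟨δ, hδ, h⟩ := Metric.eventually_nhds_iff.1 h0
  refine ⟨min (‖1 - Complex.exp γ‖ / 2) (1 - Real.exp (-(m * δ))), ?_, fun v hv => ?_⟩
  · have : Real.exp (-(m * δ)) < 1 := Real.exp_lt_one_iff.2 (by nlinarith)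
    exact lt_min (by linarith) (by linarith)
  · by_cases hlt : ‖v‖ < δ
    · exact (min_le_left _ _).trans (h (by simpa using hlt)).le
    · refine (min_le_right _ _).trans ?_
      have h1 : ‖Complex.exp (γ - v)‖ ≤ Real.exp (-(m * δ)) := by
        rw [Complex.norm_exp, Real.exp_le_exp, Complex.sub_re]
        have : m * δ ≤ m * ‖v‖ := by
          have := not_lt.1 hlt
          gcongr
        linarith
      have := norm_sub_norm_le (1 : ℂ) (Complex.exp (γ - v))
      rw [norm_one] at this
      linarith

/-- The bound does not depend on γ, which makes one c₀ valid for all k. For |v| ≤ π/4 the imaginary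
part of γ - v is at most 3π/4 in modulus, and with ρ = |e^{γ-v}| one gets 1 + 2ρ cos + ρ² ≥ (ρ -
√2/2)² + 1/2. For larger v the exponential is uniformly less than 1 in modulus. -/
theorem le_norm_one_add_exp {γ v : ℂ} (hγ : γ.re ≤ 0) (hγi : |γ.im| ≤ Real.pi / 2) {m : ℝ}
    (hm : 0 < m) (hv : m * ‖v‖ ≤ v.re) :
    min (1 / 2) (1 - Real.exp (-(m * (Real.pi / 4)))) ≤ ‖1 + Complex.exp (γ - v)‖ := by
  have hpi := Real.pi_pos
  by_cases hlt : ‖v‖ ≤ Real.pi / 4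
  · refine (min_le_left _ _).trans ?_
    refine (sq_le_sq₀ (by positivity) (norm_nonneg _)).1 ?_
    rw [normSq_one_add_exp]
    have him : |(γ - v).im| ≤ 3 * Real.pi / 4 := by
      rw [Complex.sub_im]
      have := (abs_sub γ.im v.im)
      have := Complex.abs_im_le_norm v
      linarith
    have hcos : -(√2 / 2) ≤ Real.cos (γ - v).im := by
      rw [← Real.cos_abs (γ - v).im]
      have : Real.cos (3 * Real.pi / 4) = -(√2 / 2) := by
        rw [show 3 * Real.pi / 4 = Real.pi - Real.pi / 4 by ring, Real.cos_pi_sub,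
          Real.cos_pi_div_four]
      rw [← this]
      exact Real.cos_le_cos_of_nonneg_of_le_pi (abs_nonneg _) (by linarith) him
    have hρ := Real.exp_pos (γ - v).re
    have hs : √(2 : ℝ) ^ 2 = 2 := Real.sq_sqrt (by norm_num)
    have : Real.exp (γ - v).re * (-(√2 / 2)) ≤ Real.exp (γ - v).re * Real.cos (γ - v).im := by
      gcongr
    nlinarith [sq_nonneg (Real.exp (γ - v).re - √2 / 2)]
  · refine (min_le_right _ _).trans ?_
    have h1 : ‖Complex.exp (γ - v)‖ ≤ Real.exp (-(m * (Real.pi / 4))) := by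
      rw [Complex.norm_exp, Real.exp_le_exp, Complex.sub_re]
      have : m * (Real.pi / 4) ≤ m * ‖v‖ := by
        have := (not_le.1 hlt).le
        gcongr
      linarith
    have := norm_sub_norm_le (1 : ℂ) (-Complex.exp (γ - v))
    rw [norm_one, norm_neg, sub_neg_eq_add] at this
    linarith

theorem exists_isDenominatorBound (h : AdmissibleParameter β b θ) {φ : ℝ}
    (hφ : |φ + b| < Real.pi / 2) : ∃ c₀ : ℝ, IsDenominatorBound β θ φ c₀ := by
  have hm := cos_add_pos hφ
  set m := Real.cos (φ + b)
  have hne : Complex.exp β ≠ 1 := by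
    have := h.exp_sub_one_ne_zero le_rfl
    simpa [cutPoint, sub_eq_zero] using this
  obtain ⟨c, hc, hcb⟩ := exists_le_norm_one_sub_exp h.re_nonpos hne hm
  set d := min (1 / 2) (1 - Real.exp (-(m * (Real.pi / 4))))
  have hd : 0 < d := by
    have : Real.exp (-(m * (Real.pi / 4))) < 1 :=
      Real.exp_lt_one_iff.2 (by have := Real.pi_pos; simp; positivity)
    exact lt_min (by norm_num) (by linarith)
  have hmin : 0 < min c d := lt_min hc hd
  -- Halving provides the strict inequality in the definition of the bound.
  refine ⟨min c d / 2, by positivity, fun t r ht hr => ⟨?_, fun k hk => ?_⟩⟩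
  · have hs := sector_bound hm (t := t * ‖β‖) (r := r * ‖β‖) (by positivity) (by positivity)
    have h1 := hcb _ hs
    rw [← h.mul_cutPoint_sub_rayPoint] at h1
    rw [← Complex.exp_add, neg_mul, ← sub_eq_add_neg, ← mul_sub]
    linarith [min_le_left c d]
  · have hs := sector_bound hm (t := t * ‖β‖ / 2 ^ k) (r := r * ‖β‖ / 2 ^ k)
      (by positivity) (by positivity)
    have h1 := le_norm_one_add_exp (h.div_two_pow_re_nonpos k)
      ((h.abs_div_two_pow_im_le k).trans (pi_div_two_pow_le hk)) hm hs
    have e : β / 2 ^ k - (((t * ‖β‖ / 2 ^ k : ℝ) : ℂ) + ((r * ‖β‖ / 2 ^ k : ℝ) : ℂ) *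
        Complex.exp ((φ + b : ℝ) * Complex.I)) =
        β * cutPoint θ t / 2 ^ k + -β * rayPoint φ r / 2 ^ k := by
      rw [← add_div, neg_mul, ← sub_eq_add_neg, ← mul_sub, h.mul_cutPoint_sub_rayPoint]
      push_cast
      ring
    rw [e, Complex.exp_add] at h1
    change d ≤ _ at h1
    linarith [min_le_right c d]

end AdmissibleParameter

/-! ### Laplace integrals along rays -/

theorem norm_laplaceIntegrand (φ : ℝ) (G : ℂ → ℂ) (x : ℂ) (r : ℝ) :
    ‖laplaceIntegrand φ G x r‖ =
      Real.exp (-(r * (x * Complex.exp (φ * Complex.I)).re)) * ‖G (rayPoint φ r)‖ := by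
  have e : -x * rayPoint φ r = -((r : ℂ) * (x * Complex.exp (φ * Complex.I))) := by
    rw [rayPoint]; ring
  rw [laplaceIntegrand, norm_mul, norm_mul, Complex.norm_exp_ofReal_mul_I, mul_one, e,
    norm_exp_neg_mul]

theorem integrableOn_laplaceIntegrand {φ : ℝ} {G : ℂ → ℂ} {x : ℂ}
    (hx : 0 < (x * Complex.exp (φ * Complex.I)).re) {M : ℝ}
    (hG : AEStronglyMeasurable (fun r => G (rayPoint φ r)) (volume.restrict (Ioi 0)))
    (hM : ∀ r : ℝ, 0 < r → ‖G (rayPoint φ r)‖ ≤ M) :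
    IntegrableOn (laplaceIntegrand φ G x) (Ioi 0) := by
  refine Integrable.mono' ((integrableOn_exp_neg_mul_re hx).mul_const M) ?_ ?_
  · unfold laplaceIntegrand rayPoint at *
    refine AEStronglyMeasurable.mul (AEStronglyMeasurable.mul ?_ hG) (by fun_prop)
    exact Continuous.aestronglyMeasurable (by fun_prop)
  · filter_upwards [ae_restrict_mem measurableSet_Ioi] with r hr
    rw [norm_laplaceIntegrand]
    have := hM r hr
    gcongr

theorem norm_laplaceRay_le {φ : ℝ} {G : ℂ → ℂ} {x : ℂ}
    (hx : 0 < (x * Complex.exp (φ * Complex.I)).re) {M : ℝ}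
    (hM : ∀ r : ℝ, 0 < r → ‖G (rayPoint φ r)‖ ≤ M) :
    ‖laplaceRay φ G x‖ ≤ M * (1 / (x * Complex.exp (φ * Complex.I)).re) := by
  have := norm_integral_le_of_norm_le (f := laplaceIntegrand φ G x)
    ((integrableOn_exp_neg_mul_re hx).mul_const M) (by
      filter_upwards [ae_restrict_mem measurableSet_Ioi] with r hr
      rw [norm_laplaceIntegrand]
      have := hM r hr
      gcongr)
  rw [integral_mul_const, integral_exp_neg_mul_re hx, mul_comm] at this
  exact this

theorem laplaceIntegrand_add (φ : ℝ) (G H : ℂ → ℂ) (x : ℂ) (r : ℝ) :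
    laplaceIntegrand φ (fun p => G p + H p) x r =
      laplaceIntegrand φ G x r + laplaceIntegrand φ H x r := by
  simp only [laplaceIntegrand]; ring

theorem laplaceRay_add {φ : ℝ} {G H : ℂ → ℂ} {x : ℂ}
    (hG : IntegrableOn (laplaceIntegrand φ G x) (Ioi 0))
    (hH : IntegrableOn (laplaceIntegrand φ H x) (Ioi 0)) :
    laplaceRay φ (fun p => G p + H p) x = laplaceRay φ G x + laplaceRay φ H x := by
  simp only [laplaceRay, laplaceIntegrand_add]
  exact integral_add hG hH

theorem laplaceRay_congr {φ : ℝ} {G H : ℂ → ℂ} {x : ℂ}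
    (h : ∀ r : ℝ, 0 < r → G (rayPoint φ r) = H (rayPoint φ r)) :
    laplaceRay φ G x = laplaceRay φ H x := by
  refine setIntegral_congr_fun measurableSet_Ioi fun r hr => ?_
  simp only [laplaceIntegrand, h r hr]

/-- Expanding in powers of w e^{-γp} and integrating term by term gives ∑ w^j/(x/γ + j); Euler's
transformation then gives the factorial series. -/
theorem laplaceRay_geometric {φ : ℝ} {w x γ : ℂ} (hw : ‖w‖ < 1) (hz : ‖w / (w - 1)‖ < 1)
    (hγ : γ ≠ 0) (hγφ : 0 ≤ (γ * Complex.exp (φ * Complex.I)).re)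
    (hx : 0 < (x * Complex.exp (φ * Complex.I)).re) (hy : ∀ i : ℕ, x / γ + i ≠ 0) :
    laplaceRay φ (fun p => γ / (1 - w * Complex.exp (-γ * p))) x =
      lerchTail 0 (w / (w - 1)) (x / γ) := by
  have h1 := (hasSum_integral_exp_div_one_sub hx hγφ hw).mul_left
    (γ * Complex.exp (φ * Complex.I))
  have h2 := hasSum_lerchTail_zero hw hz hy
  have e : ∀ j : ℕ, γ * Complex.exp (φ * Complex.I) * (w ^ j / (x * Complex.exp (φ * Complex.I) +
      j * (γ * Complex.exp (φ * Complex.I)))) = w ^ j / (x / γ + j) := fun j => by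
    have h3 : x + j * γ ≠ 0 := fun h => hy j (by field_simp; linear_combination h)
    have h4 : x * Complex.exp (φ * Complex.I) + j * (γ * Complex.exp (φ * Complex.I)) =
      Complex.exp (φ * Complex.I) * (x + j * γ) := by ring
    have h5 : x / γ + j = (x + j * γ) / γ := by field_simp
    have h6 := Complex.exp_ne_zero (φ * Complex.I)
    rw [h4, h5]
    field_simp
  simp only [e] at h1
  rw [← h1.unique h2, laplaceRay, ← integral_const_mul]
  congr 1
  ext r
  rw [laplaceIntegrand, rayPoint]
  ring_nf

/-! ### The dyadic decomposition of the Cauchy kernel -/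

/-- The term `(β / 2^k) / (1 + e^{β (s - p) / 2^k})` of the dyadic decomposition of `1/(s - p)`. -/
def dyadicKernel (β : ℂ) (k : ℕ) (p s : ℂ) : ℂ :=
  β / 2 ^ k / (1 + Complex.exp (β * (s - p) / 2 ^ k))

/-- Cancelling e^{-βs/2^M} shows that the exponential part depends on s and p only through u = β(s -
p). -/
theorem kernelRemainder_succ_eq (β : ℂ) (M : ℕ) (p s : ℂ) :
    kernelRemainder β (M + 1) p s = β / 2 ^ M * (1 / (β * (s - p) / 2 ^ M) +
      1 / (1 - Complex.exp (β * (s - p) / 2 ^ M))) := by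
  rw [kernelRemainder, Nat.add_sub_cancel]
  congr 2
  have h1 := Complex.exp_ne_zero (-β * s / 2 ^ M)
  have h2 : Complex.exp (-β * p / 2 ^ M) =
      Complex.exp (-β * s / 2 ^ M) * Complex.exp (β * (s - p) / 2 ^ M) := by
    rw [← Complex.exp_add]; ring_nf
  rw [h2, ← mul_one_sub]
  nth_rewrite 1 [← mul_one (Complex.exp (-β * s / 2 ^ M))]
  rw [mul_div_mul_left _ _ h1]

/-- With E = e^{u/2^{M+1}} this is 2/(1-E²) = 1/(1-E) + 1/(1+E), while the rational part is the same
1/(s-p) at each level. Excluding e^u = 1 suffices at all levels, since e^u is a power of e^{u/2^M}.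
-/
theorem kernelRemainder_succ_eq_add {β p s : ℂ} (h : Complex.exp (β * (s - p)) ≠ 1) (M : ℕ) :
    kernelRemainder β (M + 1) p s =
      dyadicKernel β (M + 1) p s + kernelRemainder β (M + 2) p s := by
  rw [kernelRemainder_succ_eq, kernelRemainder_succ_eq β (M + 1), dyadicKernel]
  have hu : β * (s - p) ≠ 0 := fun h0 => h (by rw [h0, Complex.exp_zero])
  set u := β * (s - p)
  have hv : Complex.exp (u / 2 ^ (M + 1)) ^ 2 = Complex.exp (u / 2 ^ M) := by
    rw [← Complex.exp_nat_mul]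
    congr 1
    rw [pow_succ]
    field_simp
    push_cast
    ring
  have hM : Complex.exp (u / 2 ^ M) ≠ 1 := fun h1 => h (by
    have : Complex.exp (u / 2 ^ M) ^ (2 ^ M) = Complex.exp u := by
      rw [← Complex.exp_nat_mul]
      congr 1
      push_cast
      field_simp
    rw [← this, h1, one_pow])
  rw [← hv] at hM ⊢
  set E := Complex.exp (u / 2 ^ (M + 1))
  have h1 : 1 - E ≠ 0 := fun h0 => hM (by rw [← sub_eq_zero.1 h0, one_pow])
  have h2 : 1 + E ≠ 0 := fun h0 => hM (by rw [eq_neg_of_add_eq_zero_right h0]; ring)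
  have h3 : 1 - E ^ 2 = (1 - E) * (1 + E) := by ring
  rw [h3]
  clear_value E u
  rw [pow_succ]
  field_simp
  ring

/-- With v = u/2^M the remainder is (β/u)(1 - v/(e^v - 1)), whenever e^v ≠ 1, and (e^v - 1)/v tends
to the derivative of exp at 0. -/
theorem tendsto_kernelRemainder {β p s : ℂ} (hu : β * (s - p) ≠ 0) :
    Tendsto (fun M : ℕ => kernelRemainder β (M + 1) p s) atTop (𝓝 0) := by
  set u := β * (s - p) with hu_def
  have hβ : β ≠ 0 := left_ne_zero_of_mul hu
  have hv : Tendsto (fun M : ℕ => u / 2 ^ M) atTop (𝓝[≠] 0) := by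
    refine tendsto_nhdsWithin_iff.2 ⟨?_, Eventually.of_forall fun M => ?_⟩
    · have := (tendsto_pow_atTop_nhds_zero_of_norm_lt_one (x := (1 / 2 : ℂ)) (by norm_num)).const_mul u
      rw [mul_zero] at this
      refine this.congr fun M => ?_
      rw [one_div, inv_pow, div_eq_mul_inv]
    · exact div_ne_zero hu (pow_ne_zero _ two_ne_zero)
  have hs := (Complex.hasDerivAt_exp 0).tendsto_slope.comp hv
  rw [Complex.exp_zero] at hs
  have h1 := ((hs.inv₀ one_ne_zero).const_sub 1).const_mul (β / u)
  rw [inv_one, sub_self, mul_zero] at h1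
  refine h1.congr fun M => ?_
  rw [kernelRemainder_succ_eq, ← hu_def]
  simp only [Function.comp, slope_def_field, sub_zero, Complex.exp_zero]
  rw [inv_div, ← neg_sub 1 (Complex.exp _), div_neg]
  have h2 : (2 : ℂ) ^ M ≠ 0 := pow_ne_zero _ two_ne_zero
  by_cases h3 : 1 - Complex.exp (u / 2 ^ M) = 0
  · rw [h3]; simp; field_simp
  · field_simp
    ring

theorem IsDenominatorBound.norm_one_sub {β : ℂ} {θ φ c₀ : ℝ} (h : IsDenominatorBound β θ φ c₀)
    {t r : ℝ} (ht : 0 ≤ t) (hr : 0 ≤ r) :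
    c₀ < ‖1 - Complex.exp (β * (cutPoint θ t - rayPoint φ r))‖ := by
  have := (h.2 t r ht hr).1
  rwa [← Complex.exp_add, neg_mul, ← sub_eq_add_neg, ← mul_sub] at this

theorem IsDenominatorBound.norm_one_add {β : ℂ} {θ φ c₀ : ℝ} (h : IsDenominatorBound β θ φ c₀)
    {t r : ℝ} (ht : 0 ≤ t) (hr : 0 ≤ r) {k : ℕ} (hk : 1 ≤ k) :
    c₀ < ‖1 + Complex.exp (β * (cutPoint θ t - rayPoint φ r) / 2 ^ k)‖ := by
  have := (h.2 t r ht hr).2 k hk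
  rwa [← Complex.exp_add, ← add_div, neg_mul, ← sub_eq_add_neg, ← mul_sub] at this

theorem IsDenominatorBound.exp_ne_one {β : ℂ} {θ φ c₀ : ℝ} (h : IsDenominatorBound β θ φ c₀)
    {t r : ℝ} (ht : 0 ≤ t) (hr : 0 ≤ r) :
    Complex.exp (β * (cutPoint θ t - rayPoint φ r)) ≠ 1 := fun h0 => by
  have := h.norm_one_sub ht hr
  rw [h0, sub_self, norm_zero] at this
  exact lt_asymm this h.1

theorem norm_dyadicKernel_le {β : ℂ} {θ φ c₀ : ℝ} (h : IsDenominatorBound β θ φ c₀)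
    {t r : ℝ} (ht : 0 ≤ t) (hr : 0 ≤ r) {k : ℕ} (hk : 1 ≤ k) :
    ‖dyadicKernel β k (rayPoint φ r) (cutPoint θ t)‖ ≤ ‖β‖ / c₀ * (1 / 2) ^ k := by
  have h0 := h.1
  have h1 := (h.norm_one_add ht hr hk).le
  rw [dyadicKernel, norm_div, norm_div, norm_pow, Complex.norm_ofNat]
  calc ‖β‖ / 2 ^ k / _ ≤ ‖β‖ / 2 ^ k / c₀ := by gcongr
    _ = _ := by rw [one_div, inv_pow]; field_simp

/-- The remainder is the sum of all later dyadic kernels, each at most (|β|/c₀) 2^{-k}. Summing from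
k = M + 1 gives exactly 2^{-M}|β|/c₀. -/
theorem norm_kernelRemainder_le {β : ℂ} {θ φ c₀ : ℝ} (h : IsDenominatorBound β θ φ c₀)
    {t r : ℝ} (ht : 0 ≤ t) (hr : 0 ≤ r) (M : ℕ) :
    ‖kernelRemainder β (M + 1) (rayPoint φ r) (cutPoint θ t)‖ ≤ 1 / 2 ^ M * (‖β‖ / c₀) := by
  have h0 := h.1
  have hne := h.exp_ne_one ht hr
  have hu : β * (cutPoint θ t - rayPoint φ r) ≠ 0 := fun h1 => hne (by rw [h1, Complex.exp_zero])
  have hK : ∀ j : ℕ, kernelRemainder β (M + 1) (rayPoint φ r) (cutPoint θ t) =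
      ∑ i ∈ Finset.range j, dyadicKernel β (M + 1 + i) (rayPoint φ r) (cutPoint θ t) +
        kernelRemainder β (M + j + 1) (rayPoint φ r) (cutPoint θ t) := by
    intro j
    induction j with
    | zero => simp
    | succ j ih =>
      rw [ih, Finset.sum_range_succ, kernelRemainder_succ_eq_add hne (M + j), add_right_comm M j 1]
      ring_nf
  have hlim : Tendsto (fun j : ℕ => kernelRemainder β (M + j + 1) (rayPoint φ r) (cutPoint θ t))
      atTop (𝓝 0) := by
    have := (tendsto_add_atTop_iff_nat M).2 (tendsto_kernelRemainder hu)
    refine this.congr fun j => ?_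
    rw [add_comm j M]
  have hle : ∀ j : ℕ, ‖kernelRemainder β (M + 1) (rayPoint φ r) (cutPoint θ t) -
      kernelRemainder β (M + j + 1) (rayPoint φ r) (cutPoint θ t)‖ ≤ 1 / 2 ^ M * (‖β‖ / c₀) := by
    intro j
    rw [hK j, add_sub_cancel_right]
    have h1 : ∀ i ∈ Finset.range j,
        ‖dyadicKernel β (M + 1 + i) (rayPoint φ r) (cutPoint θ t)‖ ≤
          (‖β‖ / c₀ * (1 / 2) ^ (M + 1)) * (1 / 2) ^ i := fun i _ => by
      rw [mul_assoc, ← pow_add]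
      exact norm_dyadicKernel_le h ht hr (by omega)
    refine (norm_sum_le_of_le _ h1).trans ?_
    rw [← Finset.mul_sum]
    have h2 := Summable.sum_le_tsum (Finset.range j) (fun i _ => by positivity)
      (summable_geometric_two)
    rw [tsum_geometric_two] at h2
    calc _ ≤ (‖β‖ / c₀ * (1 / 2) ^ (M + 1)) * 2 := by gcongr
      _ = _ := by rw [pow_succ, one_div, inv_pow]; ring
  have := (hlim.const_sub (kernelRemainder β (M + 1) (rayPoint φ r) (cutPoint θ t))).norm
  rw [sub_zero] at this
  exact le_of_tendsto' this hle

theorem measurable_cutPoint (θ : ℝ) : Measurable (cutPoint θ) := by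
  unfold cutPoint; fun_prop

theorem measurable_rayPoint (φ : ℝ) : Measurable (rayPoint φ) := by
  unfold rayPoint; fun_prop

theorem measurable_kernelRemainder (β : ℂ) (N : ℕ) {α : Type*} [MeasurableSpace α] {f g : α → ℂ}
    (hf : Measurable f) (hg : Measurable g) :
    Measurable fun a => kernelRemainder β N (f a) (g a) := by
  unfold kernelRemainder; fun_prop

theorem measurable_dyadicKernel (β : ℂ) (k : ℕ) {α : Type*} [MeasurableSpace α] {f g : α → ℂ}
    (hf : Measurable f) (hg : Measurable g) :
    Measurable fun a => dyadicKernel β k (f a) (g a) := by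
  unfold dyadicKernel; fun_prop

theorem integrableOn_laplaceIntegrand_kernelRemainder {β : ℂ} {θ φ c₀ : ℝ}
    (h : IsDenominatorBound β θ φ c₀) {x : ℂ} (hx : 0 < (x * Complex.exp (φ * Complex.I)).re)
    {t : ℝ} (ht : 0 ≤ t) (M : ℕ) :
    IntegrableOn (laplaceIntegrand φ
      (fun p => kernelRemainder β (M + 1) p (cutPoint θ t)) x) (Ioi 0) :=
  integrableOn_laplaceIntegrand hx
    (measurable_kernelRemainder β _ (measurable_rayPoint φ) measurable_const).aestronglyMeasurable
    (fun _ hr => norm_kernelRemainder_le h ht hr.le M)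

theorem integrableOn_laplaceIntegrand_dyadicKernel {β : ℂ} {θ φ c₀ : ℝ}
    (h : IsDenominatorBound β θ φ c₀) {x : ℂ} (hx : 0 < (x * Complex.exp (φ * Complex.I)).re)
    {t : ℝ} (ht : 0 ≤ t) {k : ℕ} (hk : 1 ≤ k) :
    IntegrableOn (laplaceIntegrand φ (fun p => dyadicKernel β k p (cutPoint θ t)) x) (Ioi 0) :=
  integrableOn_laplaceIntegrand hx
    (measurable_dyadicKernel β _ (measurable_rayPoint φ) measurable_const).aestronglyMeasurable
    (fun _ hr => norm_dyadicKernel_le h ht hr.le hk)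

theorem norm_dyadicRemainder_le {β : ℂ} {θ φ c₀ : ℝ}
    (h : IsDenominatorBound β θ φ c₀) {x : ℂ} (hx : 0 < (x * Complex.exp (φ * Complex.I)).re)
    {t : ℝ} (ht : 0 ≤ t) (M : ℕ) :
    ‖dyadicRemainder β θ φ (M + 1) x t‖ ≤
      1 / 2 ^ M * (‖β‖ / c₀) * (1 / (x * Complex.exp (φ * Complex.I)).re) :=
  norm_laplaceRay_le hx (fun _ hr => norm_kernelRemainder_le h ht hr.le M)

theorem measurable_dyadicRemainder (β : ℂ) (θ φ : ℝ) (N : ℕ) (x : ℂ) :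
    Measurable (dyadicRemainder β θ φ N x) := by
  have : Measurable (Function.uncurry fun (t r : ℝ) =>
      laplaceIntegrand φ (fun p => kernelRemainder β N p (cutPoint θ t)) x r) := by
    unfold laplaceIntegrand Function.uncurry
    have h1 : Measurable fun a : ℝ × ℝ => rayPoint φ a.2 := (measurable_rayPoint φ).comp measurable_snd
    have h2 : Measurable fun a : ℝ × ℝ => cutPoint θ a.1 := (measurable_cutPoint θ).comp measurable_fst
    have h3 := measurable_kernelRemainder β N h1 h2
    exact ((Complex.measurable_exp.comp (h1.const_mul (-x))).mul h3).mul_const _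
  exact (this.stronglyMeasurable.integral_prod_right (ν := volume.restrict (Ioi 0))).measurable

theorem dyadicRemainder_succ {β : ℂ} {θ φ c₀ : ℝ}
    (h : IsDenominatorBound β θ φ c₀) {x : ℂ} (hx : 0 < (x * Complex.exp (φ * Complex.I)).re)
    {t : ℝ} (ht : 0 ≤ t) (M : ℕ) :
    dyadicRemainder β θ φ (M + 1) x t =
      laplaceRay φ (fun p => dyadicKernel β (M + 1) p (cutPoint θ t)) x +
        dyadicRemainder β θ φ (M + 2) x t := by
  rw [dyadicRemainder, dyadicRemainder,
    ← laplaceRay_add (integrableOn_laplaceIntegrand_dyadicKernel h hx ht (by omega))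
      (integrableOn_laplaceIntegrand_kernelRemainder h hx ht (M + 1))]
  exact laplaceRay_congr fun r hr => kernelRemainder_succ_eq_add (h.exp_ne_one ht hr.le) M

/-! ### Laplace transforms of the dyadic kernels as Lerch functions. -/

namespace AdmissibleParameter

variable {β : ℂ} {b θ : ℝ}

theorem div_mem_slitPlane (h : AdmissibleParameter β b θ) {x : ℂ} (hx : x ∈ laplaceDomain b) :
    x / β ∈ Complex.slitPlane := by
  by_contra hn
  rw [Complex.mem_slitPlane_iff_not_le_zero, not_not, Complex.le_def] at hn
  simp only [Complex.zero_re, Complex.zero_im] at hn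
  have e : x / β = ((x / β).re : ℂ) := Complex.ext (by simp) (by simp [hn.2])
  refine hx ((x / β).re * ‖β‖) (mul_nonpos_of_nonpos_of_nonneg hn.1 (norm_nonneg _)) ?_
  have hx : x = ((x / β).re : ℂ) * β := by rw [← e]; field_simp [h.ne_zero]
  generalize (x / β).re = q at hx
  rw [rayPoint, hx]
  conv_lhs => rw [h.polar]
  push_cast
  ring

theorem two_pow_mul_div_mem_slitPlane (h : AdmissibleParameter β b θ) {x : ℂ}
    (hx : x ∈ laplaceDomain b) (k : ℕ) : 2 ^ k * x / β ∈ Complex.slitPlane := by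
  have h1 := h.div_mem_slitPlane hx
  have e : 2 ^ k * x / β = ((2 ^ k : ℝ) : ℂ) * (x / β) := by push_cast; ring
  rw [e]
  rw [Complex.mem_slitPlane_iff] at h1 ⊢
  rw [Complex.re_ofReal_mul, Complex.im_ofReal_mul]
  rcases h1 with h1 | h1
  · left; positivity
  · right; positivity

theorem mul_exp_eq (h : AdmissibleParameter β b θ) (x : ℂ) (φ : ℝ) :
    x * Complex.exp (φ * Complex.I) =
      (‖β‖ : ℂ) * (x / β * Complex.exp ((φ + b : ℝ) * Complex.I)) := by
  have h1 : x = x / β * β := by field_simp [h.ne_zero]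
  conv_lhs => rw [h1]
  conv_lhs => enter [1, 2]; rw [h.polar]
  push_cast
  rw [add_mul, Complex.exp_add]
  ring

theorem mem_laplaceDomain {x : ℂ} {φ : ℝ} (hφ : |φ + b| < Real.pi / 2)
    (hx : 0 < (x * Complex.exp (φ * Complex.I)).re) : x ∈ laplaceDomain b := by
  rintro r hr rfl
  have e : rayPoint b r * Complex.exp (φ * Complex.I) =
      (r : ℂ) * Complex.exp ((φ + b : ℝ) * Complex.I) := by
    rw [rayPoint]
    push_cast
    rw [add_mul, Complex.exp_add]
    ring
  rw [e, Complex.re_ofReal_mul, Complex.exp_ofReal_mul_I_re] at hx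
  have := cos_add_pos hφ
  nlinarith

/-- A direction of integration that is admissible for a given `x` in the cut plane. -/
theorem exists_direction (h : AdmissibleParameter β b θ) {x : ℂ} (hx : x ∈ laplaceDomain b) :
    ∃ φ : ℝ, |φ + b| < Real.pi / 2 ∧ 0 < (x * Complex.exp (φ * Complex.I)).re := by
  have hs := h.div_mem_slitPlane hx
  have h1 := Complex.neg_pi_lt_arg (x / β)
  have h2 : (x / β).arg < Real.pi :=
    lt_of_le_of_ne (Complex.arg_le_pi _) (Complex.mem_slitPlane_iff_arg.1 hs).1
  have habs : |-((x / β).arg / 2)| < Real.pi / 2 := by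
    rw [abs_lt]; constructor <;> linarith
  -- Half of the argument of x/β is rotated away: x e^{iφ} then has argument arg(x/β)/2, and φ + b
  -- is its negative, so both stay within π/2.
  refine ⟨-b - (x / β).arg / 2, ?_, ?_⟩
  · convert habs using 2; ring
  · rw [h.mul_exp_eq, Complex.re_ofReal_mul]
    refine mul_pos h.norm_pos ?_
    have e : x / β * Complex.exp ((-b - (x / β).arg / 2 + b : ℝ) * Complex.I) =
        (‖x / β‖ : ℂ) * Complex.exp (((x / β).arg / 2 : ℝ) * Complex.I) := by
      have e1 := Complex.norm_mul_exp_arg_mul_I (x / β)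
      generalize (x / β).arg = α at *
      rw [← e1, norm_mul, Complex.norm_exp_ofReal_mul_I, mul_one, Complex.norm_real, norm_norm,
        mul_assoc, ← Complex.exp_add]
      congr 2
      push_cast
      ring
    rw [e, Complex.re_ofReal_mul, Complex.exp_ofReal_mul_I_re]
    refine mul_pos (_root_.norm_pos_iff.2 (Complex.slitPlane_ne_zero hs)) ?_
    rw [abs_neg] at habs
    exact Real.cos_pos_of_mem_Ioo (abs_lt.1 habs)

theorem re_mul_exp_nonneg (h : AdmissibleParameter β b θ) {φ : ℝ} (hφ : |φ + b| < Real.pi / 2)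
    (k : ℕ) : 0 ≤ (β / 2 ^ k * Complex.exp (φ * Complex.I)).re := by
  have e : β / 2 ^ k * Complex.exp (φ * Complex.I) =
      ((‖β‖ / 2 ^ k : ℝ) : ℂ) * Complex.exp ((φ + b : ℝ) * Complex.I) := by
    conv_lhs => rw [h.polar]
    push_cast
    rw [add_mul, Complex.exp_add]
    ring
  rw [e, Complex.re_ofReal_mul, Complex.exp_ofReal_mul_I_re]
  have := (cos_add_pos hφ).le
  positivity

/-- At t = 0 the norm is e^{Re β/2^k}, which equals 1 when Re β = 0. Hence t > 0 wherever the
geometric expansion is used; one point does not affect the integrals over t. -/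
theorem norm_exp_mul_cutPoint_lt_one (h : AdmissibleParameter β b θ) {t : ℝ} (ht : 0 < t)
    (k : ℕ) : ‖Complex.exp (β * cutPoint θ t / 2 ^ k)‖ < 1 := by
  have e := h.exp_mul_cutPoint_div_mul_exp k t 0
  simp only [Complex.ofReal_zero, neg_zero, Complex.exp_zero, mul_one, add_zero] at e
  rw [e, Complex.norm_exp, Real.exp_lt_one_iff, Complex.sub_re, Complex.ofReal_re]
  have h1 := h.div_two_pow_re_nonpos k
  have h2 := h.norm_pos
  have : 0 < t * ‖β‖ / 2 ^ k := by positivity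
  linarith

theorem laplaceRay_dyadicKernel (h : AdmissibleParameter β b θ) {φ : ℝ}
    (hφ : |φ + b| < Real.pi / 2) {x : ℂ} (hx : 0 < (x * Complex.exp (φ * Complex.I)).re)
    {t : ℝ} (ht : 0 < t) {k : ℕ} (hk : 1 ≤ k) :
    laplaceRay φ (fun p => dyadicKernel β k p (cutPoint θ t)) x = rhoDyadic β θ 0 k x t := by
  have hxd := mem_laplaceDomain hφ hx
  have hy := add_natCast_ne_zero_of_mem_slitPlane (h.two_pow_mul_div_mem_slitPlane hxd k)
  have e : 2 ^ k * x / β = x / (β / 2 ^ k) := by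
    have := h.ne_zero
    field_simp
  rw [rhoDyadic, zDyadic_eq, e]
  rw [e] at hy
  rw [← laplaceRay_geometric (w := -Complex.exp (β * cutPoint θ t / 2 ^ k)) (φ := φ) ?_ ?_ ?_
    (h.re_mul_exp_nonneg hφ k) hx hy]
  · congr 1
    ext p
    rw [dyadicKernel, neg_mul, sub_neg_eq_add, ← Complex.exp_add]
    ring_nf
  · rw [norm_neg]; exact h.norm_exp_mul_cutPoint_lt_one ht k
  · rw [← zDyadic_eq]; exact h.norm_zDyadic_lt_one hk ht.le
  · exact div_ne_zero h.ne_zero (pow_ne_zero _ two_ne_zero)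

theorem laplaceRay_zero (h : AdmissibleParameter β b θ) {φ : ℝ}
    (hφ : |φ + b| < Real.pi / 2) {x : ℂ} (hx : 0 < (x * Complex.exp (φ * Complex.I)).re)
    {t : ℝ} (ht : 0 < t) :
    laplaceRay φ (fun p => β / (1 - Complex.exp (β * (cutPoint θ t - p)))) x =
      rhoZero β θ 0 x t := by
  have hxd := mem_laplaceDomain hφ hx
  have hy := add_natCast_ne_zero_of_mem_slitPlane (h.div_mem_slitPlane hxd)
  rw [rhoZero, zZero]
  have h1 := h.re_mul_exp_nonneg hφ 0
  have h2 := h.norm_exp_mul_cutPoint_lt_one ht 0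
  simp only [pow_zero, div_one] at h1 h2
  rw [← laplaceRay_geometric (w := Complex.exp (β * cutPoint θ t)) (φ := φ) h2
    (h.norm_zZero_lt_one ht.le) h.ne_zero h1 hx hy]
  congr 1
  ext p
  rw [← Complex.exp_add]
  ring_nf

theorem dyadicRemainder_one_eq (h : AdmissibleParameter β b θ) {φ : ℝ}
    (hφ : |φ + b| < Real.pi / 2) {x : ℂ} (hx : 0 < (x * Complex.exp (φ * Complex.I)).re)
    {t : ℝ} (ht : 0 < t) (M : ℕ) :
    dyadicRemainder β θ φ 1 x t =
      ∑ k ∈ Finset.Icc 1 M, rhoDyadic β θ 0 k x t + dyadicRemainder β θ φ (M + 1) x t := by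
  obtain ⟨c₀, hc⟩ := h.exists_isDenominatorBound hφ
  induction M with
  | zero => simp
  | succ M ih =>
    rw [ih, Finset.sum_Icc_succ_top (by omega), dyadicRemainder_succ hc hx ht.le M,
      h.laplaceRay_dyadicKernel hφ hx ht (by omega)]
    ring

theorem tendsto_sum_rhoDyadic (h : AdmissibleParameter β b θ) {φ : ℝ}
    (hφ : |φ + b| < Real.pi / 2) {x : ℂ} (hx : 0 < (x * Complex.exp (φ * Complex.I)).re)
    {t : ℝ} (ht : 0 < t) :
    Tendsto (fun M : ℕ => ∑ k ∈ Finset.Icc 1 M, rhoDyadic β θ 0 k x t) atTop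
      (𝓝 (dyadicRemainder β θ φ 1 x t)) := by
  obtain ⟨c₀, hc⟩ := h.exists_isDenominatorBound hφ
  have h1 : Tendsto (fun M : ℕ => dyadicRemainder β θ φ (M + 1) x t) atTop (𝓝 0) := by
    refine squeeze_zero_norm (fun M => norm_dyadicRemainder_le hc hx ht.le M) ?_
    have := (tendsto_pow_atTop_nhds_zero_of_lt_one (r := (1 / 2 : ℝ)) (by norm_num)
      (by norm_num)).mul_const (‖β‖ / c₀ * (1 / (x * Complex.exp (φ * Complex.I)).re))
    rw [zero_mul] at this
    refine this.congr fun M => ?_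
    rw [one_div, inv_pow]
    ring
  have h2 := h1.const_sub (dyadicRemainder β θ φ 1 x t)
  rw [sub_zero] at h2
  refine h2.congr fun M => ?_
  rw [h.dyadicRemainder_one_eq hφ hx ht M, add_sub_cancel_right]

/-- The case N = 1 of the decomposition: 1/(s-p) = -β/(1 - e^{β(s-p)}) plus the first kernel
remainder. -/
theorem laplaceRay_cauchyKernel (h : AdmissibleParameter β b θ) {φ : ℝ}
    (hφ : |φ + b| < Real.pi / 2) {x : ℂ} (hx : 0 < (x * Complex.exp (φ * Complex.I)).re)
    {t : ℝ} (ht : 0 < t) :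
    laplaceRay φ (fun p => 1 / (cutPoint θ t - p)) x =
      -rhoZero β θ 0 x t + dyadicRemainder β θ φ 1 x t := by
  obtain ⟨c₀, hc⟩ := h.exists_isDenominatorBound hφ
  have h0 := hc.1
  have h1 := integrableOn_laplaceIntegrand_kernelRemainder hc hx ht.le 0
  have h2 : IntegrableOn (laplaceIntegrand φ
      (fun p => -β / (1 - Complex.exp (β * (cutPoint θ t - p)))) x) (Ioi 0) := by
    refine integrableOn_laplaceIntegrand hx ?_ (M := ‖β‖ / c₀) fun r hr => ?_
    · have := measurable_rayPoint φ
      exact Measurable.aestronglyMeasurable (by fun_prop)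
    · rw [norm_div, norm_neg]
      have := (hc.norm_one_sub ht.le hr.le).le
      gcongr
  have h3 := laplaceRay_add h1 h2
  have h4 : laplaceRay φ (fun p => -β / (1 - Complex.exp (β * (cutPoint θ t - p)))) x =
      -rhoZero β θ 0 x t := by
    rw [← h.laplaceRay_zero hφ hx ht, laplaceRay, laplaceRay, ← integral_neg]
    congr 1
    ext r
    simp only [laplaceIntegrand]
    ring
  rw [h4] at h3
  rw [add_comm, dyadicRemainder, ← h3]
  refine laplaceRay_congr fun r hr => ?_
  rw [kernelRemainder_succ_eq]
  have := h.ne_zero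
  simp only [pow_zero, div_one]
  field_simp
  ring

end AdmissibleParameter

/-! ### Remainders as functions on the cut -/

theorem norm_one_sub_le_two {z : ℂ} {c : ℝ} (hz : ‖z‖ ≤ c) (hc : c < 1) : ‖1 - z‖ ≤ 2 := by
  have := norm_sub_le 1 z
  rw [norm_one] at this
  linarith

theorem exists_norm_lerchTail_le {c : ℝ} (hc0 : 0 ≤ c) (hc : c < 1) (n : ℕ) (y : ℂ) :
    ∃ C : ℝ, ∀ z : ℂ, ‖z‖ ≤ c → ‖lerchTail n z y‖ ≤ C := by
  refine ⟨2 * ∑' j : ℕ, c ^ (n + j) * ‖betaCoeff y (n + j)‖, fun z hz => ?_⟩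
  have hs : Summable fun j : ℕ => c ^ (n + j) * ‖betaCoeff y (n + j)‖ :=
    ((summable_nat_add_iff n).2 (summable_pow_mul_norm_betaCoeff hc0 hc y)).congr
      (fun j => by rw [add_comm])
  rw [lerchTail, norm_mul]
  gcongr
  · exact norm_one_sub_le_two hz hc
  · exact tsum_of_norm_bounded hs.hasSum fun j => norm_lerchTerm_le hz y _

theorem aestronglyMeasurable_lerchTail {z : ℝ → ℂ} (hz : Measurable z)
    (hz1 : ∀ t : ℝ, 0 < t → ‖z t‖ < 1) (n : ℕ) (y : ℂ) :
    AEStronglyMeasurable (fun t => lerchTail n (z t) y) (volume.restrict (Ioi 0)) := by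
  refine aestronglyMeasurable_of_tendsto_ae atTop
    (f := fun (M : ℕ) t => (1 - z t) * ∑ j ∈ Finset.range M, lerchTerm (z t) y (n + j))
    (fun M => ?_) ?_
  · simp only [lerchTerm_eq]
    exact Measurable.aestronglyMeasurable (by fun_prop)
  · filter_upwards [ae_restrict_mem measurableSet_Ioi] with t ht
    have hs : Summable fun j : ℕ => lerchTerm (z t) y (n + j) :=
      ((summable_nat_add_iff n).2 (summable_lerchTerm (hz1 t ht) y)).congr
        (fun j => by rw [add_comm])
    exact hs.hasSum.tendsto_sum_nat.const_mul _

theorem measurable_zZero (β : ℂ) (θ : ℝ) : Measurable (zZero β θ) := by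
  have := measurable_cutPoint θ
  unfold zZero; fun_prop

theorem measurable_zDyadic (β : ℂ) (θ : ℝ) (k : ℕ) : Measurable (zDyadic β θ k) := by
  have := measurable_cutPoint θ
  unfold zDyadic; fun_prop

theorem sum_Icc_one_eq_sum_range (n : ℕ) (g : ℕ → ℂ) :
    ∑ m ∈ Finset.Icc 1 n, g m = ∑ j ∈ Finset.range n, g (j + 1) := by
  induction n with
  | zero => simp
  | succ n ih => rw [Finset.sum_Icc_succ_top (by omega), Finset.sum_range_succ, ih]

namespace AdmissibleParameter

variable {β : ℂ} {b θ : ℝ}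

/-- Here 1 - z = -1/(e^{βs} - 1), whereas the dyadic analogue is 1/(e^{βs/2^k} + 1). The sign
explains why ρ_{n,0} enters the remainder with a minus and its coefficients with a plus. -/
theorem one_sub_zZero_mul_pow (h : AdmissibleParameter β b θ) {t : ℝ} (ht : 0 ≤ t) (j : ℕ) :
    (1 - zZero β θ t) * zZero β θ t ^ j = -(Complex.exp (β * cutPoint θ t * (j : ℂ)) /
      (Complex.exp (β * cutPoint θ t) - 1) ^ (j + 1)) := by
  have h1 := h.exp_sub_one_ne_zero ht
  rw [zZero, mul_comm (β * cutPoint θ t) (j : ℂ), Complex.exp_nat_mul]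
  set E := Complex.exp (β * cutPoint θ t)
  rw [div_pow, pow_succ]
  field_simp
  ring

theorem one_sub_zDyadic_mul_pow (h : AdmissibleParameter β b θ) {k : ℕ} (hk : 1 ≤ k) {t : ℝ}
    (ht : 0 ≤ t) (j : ℕ) :
    (1 - zDyadic β θ k t) * zDyadic β θ k t ^ j =
      Complex.exp (β * cutPoint θ t * (j : ℂ) / 2 ^ k) /
      (Complex.exp (β * cutPoint θ t / 2 ^ k) + 1) ^ (j + 1) := by
  have h1 := h.exp_add_one_ne_zero hk ht
  have e : β * cutPoint θ t * (j : ℂ) / 2 ^ k = j * (β * cutPoint θ t / 2 ^ k) := by ring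
  rw [zDyadic, e, Complex.exp_nat_mul]
  set E := Complex.exp (β * cutPoint θ t / 2 ^ k)
  rw [div_pow, pow_succ]
  field_simp
  ring

theorem coeffZeroIntegrand_eq (h : AdmissibleParameter β b θ) (F : ℂ → ℂ) {t : ℝ} (ht : 0 ≤ t)
    (j : ℕ) : coeffZeroIntegrand β θ F (j + 1) t =
      -(branchJump θ F t * ((1 - zZero β θ t) * zZero β θ t ^ j)) := by
  rw [coeffZeroIntegrand, h.one_sub_zZero_mul_pow ht, Nat.add_sub_cancel]
  ring

theorem coeffIntegrand_eq (h : AdmissibleParameter β b θ) (F : ℂ → ℂ) {k : ℕ} (hk : 1 ≤ k)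
    {t : ℝ} (ht : 0 ≤ t) (j : ℕ) : coeffIntegrand β θ F (j + 1) k t =
      branchJump θ F t * ((1 - zDyadic β θ k t) * zDyadic β θ k t ^ j) := by
  rw [coeffIntegrand, h.one_sub_zDyadic_mul_pow hk ht, Nat.add_sub_cancel]

theorem factorial_div_mul_coeffZero (h : AdmissibleParameter β b θ) (F : ℂ → ℂ) (y : ℂ) (j : ℕ) :
    (j.factorial : ℂ) / poch y (j + 1) * coeffZero β θ F (j + 1) = cauchyFactor θ *
      ∫ t in Ioi (0 : ℝ), -(branchJump θ F t *
        ((1 - zZero β θ t) * lerchTerm (zZero β θ t) y j)) := by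
  rw [coeffZero, mul_left_comm, ← integral_const_mul]
  congr 1
  refine setIntegral_congr_fun measurableSet_Ioi fun t ht => ?_
  rw [h.coeffZeroIntegrand_eq F (le_of_lt ht), lerchTerm_eq, betaCoeff]
  ring

theorem factorial_div_mul_coeff (h : AdmissibleParameter β b θ) (F : ℂ → ℂ) {k : ℕ} (hk : 1 ≤ k)
    (y : ℂ) (j : ℕ) :
    (j.factorial : ℂ) / poch y (j + 1) * coeff β θ F (j + 1) k = cauchyFactor θ *
      ∫ t in Ioi (0 : ℝ), branchJump θ F t *
        ((1 - zDyadic β θ k t) * lerchTerm (zDyadic β θ k t) y j) := by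
  rw [coeff, mul_left_comm, ← integral_const_mul]
  congr 1
  refine setIntegral_congr_fun measurableSet_Ioi fun t ht => ?_
  rw [h.coeffIntegrand_eq F hk (le_of_lt ht), lerchTerm_eq, betaCoeff]
  ring

theorem integrableOn_jump_mul_zero (h : AdmissibleParameter β b θ) {J : ℝ → ℂ}
    (hJ : IntegrableOn J (Ioi 0)) (y : ℂ) (j : ℕ) :
    IntegrableOn (fun t => J t * ((1 - zZero β θ t) * lerchTerm (zZero β θ t) y j)) (Ioi 0) := by
  have hz := measurable_zZero β θ
  simp only [lerchTerm_eq]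
  refine Integrable.mul_bdd (c := 2 * (1 ^ j * ‖betaCoeff y j‖)) hJ
    (Measurable.aestronglyMeasurable (by fun_prop)) ?_
  filter_upwards [ae_restrict_mem measurableSet_Ioi] with t ht
  have h1 := h.norm_zZero_lt_one (le_of_lt (mem_Ioi.1 ht))
  rw [norm_mul, ← lerchTerm_eq]
  gcongr
  · exact norm_one_sub_le_two le_rfl h1
  · exact norm_lerchTerm_le h1.le y j

theorem integrableOn_jump_mul_dyadic (h : AdmissibleParameter β b θ) {J : ℝ → ℂ}
    (hJ : IntegrableOn J (Ioi 0)) {k : ℕ} (hk : 1 ≤ k) (y : ℂ) (j : ℕ) :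
    IntegrableOn (fun t => J t * ((1 - zDyadic β θ k t) * lerchTerm (zDyadic β θ k t) y j))
      (Ioi 0) := by
  have hz := measurable_zDyadic β θ k
  simp only [lerchTerm_eq]
  refine Integrable.mul_bdd (c := 2 * (1 ^ j * ‖betaCoeff y j‖)) hJ
    (Measurable.aestronglyMeasurable (by fun_prop)) ?_
  filter_upwards [ae_restrict_mem measurableSet_Ioi] with t ht
  have h1 := h.norm_zDyadic_lt_one hk (le_of_lt (mem_Ioi.1 ht))
  rw [norm_mul, ← lerchTerm_eq]
  gcongr
  · exact norm_one_sub_le_two le_rfl h1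
  · exact norm_lerchTerm_le h1.le y j

theorem integrableOn_coeffZeroIntegrand (h : AdmissibleParameter β b θ) {F : ℂ → ℂ}
    (hJ : IntegrableOn (branchJump θ F) (Ioi 0)) {m : ℕ} (hm : 1 ≤ m) :
    IntegrableOn (coeffZeroIntegrand β θ F m) (Ioi 0) := by
  obtain ⟨j, rfl⟩ : ∃ j, m = j + 1 := ⟨m - 1, by omega⟩
  have hz := measurable_zZero β θ
  have h1 : IntegrableOn (fun t => -(branchJump θ F t *
      ((1 - zZero β θ t) * zZero β θ t ^ j))) (Ioi 0) := by
    refine Integrable.neg (Integrable.mul_bdd (c := 2 * 1 ^ j) hJ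
      (Measurable.aestronglyMeasurable (by fun_prop)) ?_)
    filter_upwards [ae_restrict_mem measurableSet_Ioi] with t ht
    have h1 := h.norm_zZero_lt_one (le_of_lt (mem_Ioi.1 ht))
    rw [norm_mul, norm_pow]
    have := h1.le
    gcongr
    exact norm_one_sub_le_two le_rfl h1
  exact h1.congr_fun (fun t ht => (h.coeffZeroIntegrand_eq F (le_of_lt ht) j).symm)
    measurableSet_Ioi

theorem integrableOn_coeffIntegrand (h : AdmissibleParameter β b θ) {F : ℂ → ℂ}
    (hJ : IntegrableOn (branchJump θ F) (Ioi 0)) {m k : ℕ} (hm : 1 ≤ m) (hk : 1 ≤ k) :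
    IntegrableOn (coeffIntegrand β θ F m k) (Ioi 0) := by
  obtain ⟨j, rfl⟩ : ∃ j, m = j + 1 := ⟨m - 1, by omega⟩
  have hz := measurable_zDyadic β θ k
  have h1 : IntegrableOn (fun t => branchJump θ F t *
      ((1 - zDyadic β θ k t) * zDyadic β θ k t ^ j)) (Ioi 0) := by
    refine Integrable.mul_bdd (c := 2 * 1 ^ j) hJ
      (Measurable.aestronglyMeasurable (by fun_prop)) ?_
    filter_upwards [ae_restrict_mem measurableSet_Ioi] with t ht
    have h1 := h.norm_zDyadic_lt_one hk (le_of_lt (mem_Ioi.1 ht))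
    rw [norm_mul, norm_pow]
    have := h1.le
    gcongr
    exact norm_one_sub_le_two le_rfl h1
  exact h1.congr_fun (fun t ht => (h.coeffIntegrand_eq F hk (le_of_lt ht) j).symm)
    measurableSet_Ioi

theorem integrableOn_jump_mul_rhoZero (h : AdmissibleParameter β b θ) {J : ℝ → ℂ}
    (hJ : IntegrableOn J (Ioi 0)) (n : ℕ) (x : ℂ) :
    IntegrableOn (fun t => J t * rhoZero β θ n x t) (Ioi 0) := by
  obtain ⟨C, hC⟩ := exists_norm_lerchTail_le (cOne_pos β).le (cOne_lt_one h.cBeta_pos) n (x / β)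
  refine Integrable.mul_bdd (c := C) hJ (aestronglyMeasurable_lerchTail (measurable_zZero β θ)
    (fun t ht => h.norm_zZero_lt_one ht.le) n _) ?_
  filter_upwards [ae_restrict_mem measurableSet_Ioi] with t ht
  exact hC _ (h.norm_zZero_le (le_of_lt ht))

theorem integrableOn_jump_mul_rhoDyadic (h : AdmissibleParameter β b θ) {J : ℝ → ℂ}
    (hJ : IntegrableOn J (Ioi 0)) (l : ℕ) {k : ℕ} (hk : 1 ≤ k) (x : ℂ) :
    IntegrableOn (fun t => J t * rhoDyadic β θ l k x t) (Ioi 0) := by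
  obtain ⟨C, hC⟩ := exists_norm_lerchTail_le (cOne_pos β).le (cOne_lt_one h.cBeta_pos) l
    (2 ^ k * x / β)
  refine Integrable.mul_bdd (c := C) hJ (aestronglyMeasurable_lerchTail (measurable_zDyadic β θ k)
    (fun t ht => h.norm_zDyadic_lt_one hk ht.le) l _) ?_
  filter_upwards [ae_restrict_mem measurableSet_Ioi] with t ht
  exact hC _ (h.norm_zDyadic_le hk (le_of_lt ht))

theorem integrableOn_jump_mul_dyadicRemainder (h : AdmissibleParameter β b θ) {J : ℝ → ℂ}
    (hJ : IntegrableOn J (Ioi 0)) {φ : ℝ} (hφ : |φ + b| < Real.pi / 2) {x : ℂ}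
    (hx : 0 < (x * Complex.exp (φ * Complex.I)).re) {N : ℕ} (hN : 1 ≤ N) :
    IntegrableOn (fun t => J t * dyadicRemainder β θ φ N x t) (Ioi 0) := by
  obtain ⟨M, rfl⟩ : ∃ M, N = M + 1 := ⟨N - 1, by omega⟩
  obtain ⟨c₀, hc⟩ := h.exists_isDenominatorBound hφ
  refine Integrable.mul_bdd hJ (measurable_dyadicRemainder β θ φ _ x).aestronglyMeasurable
    (c := 1 / 2 ^ M * (‖β‖ / c₀) * (1 / (x * Complex.exp (φ * Complex.I)).re)) ?_
  filter_upwards [ae_restrict_mem measurableSet_Ioi] with t ht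
  exact norm_dyadicRemainder_le hc hx (le_of_lt ht) M

theorem integrableOn_remainderIntegrand (h : AdmissibleParameter β b θ) {F : ℂ → ℂ}
    (hJ : IntegrableOn (branchJump θ F) (Ioi 0)) {φ : ℝ} (hφ : |φ + b| < Real.pi / 2) {x : ℂ}
    (hx : 0 < (x * Complex.exp (φ * Complex.I)).re) (n l : ℕ) {N : ℕ} (hN : 1 ≤ N) :
    IntegrableOn (remainderIntegrand β θ φ F n N l x) (Ioi 0) := by
  have h1 := (h.integrableOn_jump_mul_rhoZero hJ n x).neg
  have h2 : IntegrableOn (fun t => ∑ k ∈ Finset.Icc 1 (N - 1),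
      branchJump θ F t * rhoDyadic β θ l k x t) (Ioi 0) :=
    integrable_finsetSum _ fun k hk =>
      h.integrableOn_jump_mul_rhoDyadic hJ l (Finset.mem_Icc.1 hk).1 x
  have h3 := h.integrableOn_jump_mul_dyadicRemainder hJ hφ hx hN
  refine ((h1.add h2).add h3).congr (Eventually.of_forall fun t => ?_)
  simp only [remainderIntegrand, Pi.add_apply, Pi.neg_apply, ← Finset.mul_sum]
  ring

/-- The remainder with n = ℓ = 0, N = 1 carries the whole Laplace transform. Splitting the Lerch
series after n or ℓ terms and the first dyadic remainder after N - 1 levels gives the general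
expansion. -/
theorem remainderIntegrand_zero_one (h : AdmissibleParameter β b θ) (F : ℂ → ℂ) {φ : ℝ}
    (hφ : |φ + b| < Real.pi / 2) {x : ℂ} (hx : 0 < (x * Complex.exp (φ * Complex.I)).re)
    {t : ℝ} (ht : 0 < t) (n l : ℕ) {N : ℕ} (hN : 1 ≤ N) :
    remainderIntegrand β θ φ F 0 1 0 x t =
      ∑ j ∈ Finset.range n, -(branchJump θ F t *
          ((1 - zZero β θ t) * lerchTerm (zZero β θ t) (x / β) j)) +
        ∑ k ∈ Finset.Icc 1 (N - 1), ∑ j ∈ Finset.range l, branchJump θ F t *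
          ((1 - zDyadic β θ k t) * lerchTerm (zDyadic β θ k t) (2 ^ k * x / β) j) +
        remainderIntegrand β θ φ F n N l x t := by
  obtain ⟨M, rfl⟩ : ∃ M, N = M + 1 := ⟨N - 1, by omega⟩
  have e1 := lerchTail_zero_eq_sum_add (h.norm_zZero_lt_one ht.le) (x / β) n
  have e2 : ∑ k ∈ Finset.Icc 1 M, rhoDyadic β θ 0 k x t =
      ∑ k ∈ Finset.Icc 1 M, ∑ j ∈ Finset.range l,
        ((1 - zDyadic β θ k t) * lerchTerm (zDyadic β θ k t) (2 ^ k * x / β) j) +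
      ∑ k ∈ Finset.Icc 1 M, rhoDyadic β θ l k x t := by
    rw [← Finset.sum_add_distrib]
    refine Finset.sum_congr rfl fun k hk => ?_
    rw [rhoDyadic, lerchTail_zero_eq_sum_add (h.norm_zDyadic_lt_one (Finset.mem_Icc.1 hk).1 ht.le)
      _ l, Finset.mul_sum, rhoDyadic]
  have e3 := h.dyadicRemainder_one_eq hφ hx ht M
  rw [e2] at e3
  simp only [remainderIntegrand, Nat.add_sub_cancel, Nat.sub_self,
    Finset.sum_neg_distrib, ← Finset.mul_sum] at *
  rw [e3]
  simp only [rhoZero]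
  rw [e1]
  simp
  ring

theorem totalRemainder_zero_one (h : AdmissibleParameter β b θ) {F : ℂ → ℂ}
    (hJ : IntegrableOn (branchJump θ F) (Ioi 0)) {φ : ℝ} (hφ : |φ + b| < Real.pi / 2) {x : ℂ}
    (hx : 0 < (x * Complex.exp (φ * Complex.I)).re) (n l : ℕ) {N : ℕ} (hN : 1 ≤ N) :
    totalRemainder β θ φ F 0 1 0 x =
      ∑ m ∈ Finset.Icc 1 n, ((m - 1).factorial : ℂ) / poch (x / β) m * coeffZero β θ F m +
      ∑ k ∈ Finset.Icc 1 (N - 1), ∑ m ∈ Finset.Icc 1 l,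
        ((m - 1).factorial : ℂ) / poch (2 ^ k * x / β) m * coeff β θ F m k +
      totalRemainder β θ φ F n N l x := by
  have i1' : ∀ j ∈ Finset.range n, IntegrableOn (fun t => -(branchJump θ F t *
      ((1 - zZero β θ t) * lerchTerm (zZero β θ t) (x / β) j))) (Ioi 0) := fun j _ =>
    (h.integrableOn_jump_mul_zero hJ _ j).neg
  have i1 := integrable_finsetSum _ i1'
  have i2' : ∀ k ∈ Finset.Icc 1 (N - 1), IntegrableOn (fun t => ∑ j ∈ Finset.range l,
      branchJump θ F t * ((1 - zDyadic β θ k t) *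
        lerchTerm (zDyadic β θ k t) (2 ^ k * x / β) j)) (Ioi 0) := fun k hk =>
    integrable_finsetSum _ fun j _ =>
      h.integrableOn_jump_mul_dyadic hJ (Finset.mem_Icc.1 hk).1 _ j
  have i2 := integrable_finsetSum _ i2'
  have i3 := h.integrableOn_remainderIntegrand hJ hφ hx n l hN
  have e : ∫ t in Ioi (0 : ℝ), remainderIntegrand β θ φ F 0 1 0 x t = _ :=
    setIntegral_congr_fun measurableSet_Ioi fun t ht =>
      h.remainderIntegrand_zero_one F hφ hx (mem_Ioi.1 ht) n l hN
  have e' := integral_add (i1.add i2) i3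
  simp only [Pi.add_apply] at e'
  rw [totalRemainder, e, e', integral_add i1 i2,
    integral_finsetSum _ i1',
    integral_finsetSum _ i2', mul_add, mul_add, Finset.mul_sum, Finset.mul_sum, totalRemainder,
    sum_Icc_one_eq_sum_range n]
  congr 2
  · refine Finset.sum_congr rfl fun j _ => ?_
    rw [Nat.add_sub_cancel, h.factorial_div_mul_coeffZero]
  · refine Finset.sum_congr rfl fun k hk => ?_
    have hk1 := (Finset.mem_Icc.1 hk).1
    rw [sum_Icc_one_eq_sum_range l, integral_finsetSum _
      (fun j _ => h.integrableOn_jump_mul_dyadic hJ hk1 _ j), Finset.mul_sum]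
    refine Finset.sum_congr rfl fun j _ => ?_
    rw [Nat.add_sub_cancel, h.factorial_div_mul_coeff F hk1]

/-! ### Interchange of the Laplace and the Cauchy integrals -/

/-- If s - p could be arbitrarily small, 1 - e^{β(s-p)} would fall below the denominator bound c₀.
The positive distance between ray and cut is what dominates the Cauchy kernel in Fubini's theorem.
-/
theorem exists_le_norm_cutPoint_sub_rayPoint (h : AdmissibleParameter β b θ) {φ : ℝ}
    (hφ : |φ + b| < Real.pi / 2) : ∃ δ : ℝ, 0 < δ ∧ ∀ t r : ℝ, 0 ≤ t → 0 ≤ r →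
      δ ≤ ‖cutPoint θ t - rayPoint φ r‖ := by
  obtain ⟨c₀, hc⟩ := h.exists_isDenominatorBound hφ
  have hcont : ContinuousAt (fun u : ℂ => ‖1 - Complex.exp (β * u)‖) 0 := by fun_prop
  obtain ⟨δ, hδ, hδ'⟩ := Metric.eventually_nhds_iff.1
    (hcont.eventually_lt continuousAt_const (by simpa using hc.1))
  refine ⟨δ, hδ, fun t r ht hr => ?_⟩
  by_contra hlt
  have h1 := hδ' (y := cutPoint θ t - rayPoint φ r) (by simpa using not_le.1 hlt)
  exact lt_asymm h1 (hc.norm_one_sub ht hr)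

theorem rayPoint_notMem_borelCut (h : AdmissibleParameter β b θ) {φ : ℝ}
    (hφ : |φ + b| < Real.pi / 2) {r : ℝ} (hr : 0 ≤ r) : rayPoint φ r ∉ borelCut θ := by
  obtain ⟨δ, hδ, h1⟩ := h.exists_le_norm_cutPoint_sub_rayPoint hφ
  rintro ⟨t, ht, e⟩
  have := h1 t r ht hr
  rw [e, sub_self, norm_zero] at this
  linarith

theorem laplaceRay_eq_totalRemainder (h : AdmissibleParameter β b θ) {F : ℂ → ℂ}
    (hJ : IntegrableOn (branchJump θ F) (Ioi 0))
    (hF : ∀ p ∈ (borelCut θ)ᶜ, F p = cauchyFactor θ *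
      ∫ t in Ioi (0 : ℝ), branchJump θ F t * (1 / (cutPoint θ t - p)))
    {φ : ℝ} (hφ : |φ + b| < Real.pi / 2) {x : ℂ}
    (hx : 0 < (x * Complex.exp (φ * Complex.I)).re) :
    laplaceRay φ F x = totalRemainder β θ φ F 0 1 0 x := by
  obtain ⟨δ, hδ, h1⟩ := h.exists_le_norm_cutPoint_sub_rayPoint hφ
  have hint : Integrable (Function.uncurry fun (r t : ℝ) => branchJump θ F t *
      laplaceIntegrand φ (fun p => 1 / (cutPoint θ t - p)) x r)
      ((volume.restrict (Ioi 0)).prod (volume.restrict (Ioi 0))) := by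
    have hb := (integrableOn_exp_neg_mul_re hx).mul_prod (hJ.norm.mul_const (1 / δ))
    have hmr : Measurable fun a : ℝ × ℝ => rayPoint φ a.1 :=
      (measurable_rayPoint φ).comp measurable_fst
    have hmc : Measurable fun a : ℝ × ℝ => cutPoint θ a.2 :=
      (measurable_cutPoint θ).comp measurable_snd
    refine hb.mono' ?_ ?_
    · refine AEStronglyMeasurable.mul
        (hJ.aestronglyMeasurable.comp_snd (μ := volume.restrict (Ioi 0))) ?_
      refine Measurable.aestronglyMeasurable ?_
      unfold laplaceIntegrand
      fun_prop
    · rw [Measure.prod_restrict]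
      filter_upwards [ae_restrict_mem (measurableSet_Ioi.prod measurableSet_Ioi)] with a ha
      simp only [Function.uncurry]
      rw [norm_mul, norm_laplaceIntegrand, norm_div, norm_one]
      have := h1 a.2 a.1 (le_of_lt ha.2) (le_of_lt ha.1)
      rw [mul_left_comm]
      gcongr
  have e1 : laplaceRay φ F x = cauchyFactor θ * ∫ r in Ioi (0 : ℝ), ∫ t in Ioi (0 : ℝ),
      branchJump θ F t * laplaceIntegrand φ (fun p => 1 / (cutPoint θ t - p)) x r := by
    rw [laplaceRay, ← integral_const_mul]
    refine setIntegral_congr_fun measurableSet_Ioi fun r hr => ?_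
    simp only [laplaceIntegrand]
    rw [hF _ (h.rayPoint_notMem_borelCut hφ (le_of_lt hr)), mul_left_comm, mul_assoc,
      mul_right_comm, ← integral_const_mul]
    congr 2
    ext t
    ring
  rw [e1, integral_integral_swap hint, totalRemainder]
  congr 1
  refine setIntegral_congr_fun measurableSet_Ioi fun t ht => ?_
  simp only [integral_const_mul]
  rw [remainderIntegrand]
  simp only [Nat.sub_self, zero_lt_one, Finset.Icc_eq_empty_of_lt, Finset.sum_empty, add_zero]
  rw [← h.laplaceRay_cauchyKernel hφ hx ht, laplaceRay]

end AdmissibleParameter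

/-! ### The double factorial series -/

/-- A bound of `|z|` on the cut, for the argument `z` of the `k`-th dyadic factorial series. -/
def dyadicRatio (β : ℂ) (k : ℕ) : ℝ := min (cOne β) (1 / (1 + Real.cos (Real.pi / 2 ^ k)))

theorem tendsto_dyadicRatio (β : ℂ) : ∀ r : ℝ, 1 / 2 < r → ∀ᶠ k in atTop, dyadicRatio β k < r := by
  intro r hr
  have h1 : Tendsto (fun k : ℕ => Real.pi / 2 ^ k) atTop (𝓝 0) := by
    have := (tendsto_pow_atTop_nhds_zero_of_lt_one (r := (1 / 2 : ℝ)) (by norm_num)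
      (by norm_num)).const_mul Real.pi
    rw [mul_zero] at this
    refine this.congr fun k => ?_
    rw [one_div, inv_pow, div_eq_mul_inv]
  have h2 : Tendsto (fun k : ℕ => 1 / (1 + Real.cos (Real.pi / 2 ^ k))) atTop (𝓝 (1 / 2)) := by
    have h3 := ((Real.continuous_cos.tendsto 0).comp h1).const_add 1
    rw [Real.cos_zero] at h3
    have h4 := h3.inv₀ (by norm_num)
    norm_num at h4 ⊢
    exact h4
  filter_upwards [h2.eventually_lt_const hr] with k hk
  exact (min_le_right _ _).trans_lt hk

namespace AdmissibleParameter

variable {β : ℂ} {b θ : ℝ}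

theorem dyadicRatio_nonneg (_ : AdmissibleParameter β b θ) {k : ℕ} (hk : 1 ≤ k) :
    0 ≤ dyadicRatio β k := by
  refine le_min (cOne_pos β).le ?_
  have hpi := Real.pi_pos
  have : 0 ≤ Real.cos (Real.pi / 2 ^ k) := Real.cos_nonneg_of_mem_Icc
    ⟨by have : 0 ≤ Real.pi / 2 ^ k := by positivity
        linarith, pi_div_two_pow_le hk⟩
  positivity

theorem dyadicRatio_lt_one (h : AdmissibleParameter β b θ) (k : ℕ) : dyadicRatio β k < 1 :=
  (min_le_left _ _).trans_lt (cOne_lt_one h.cBeta_pos)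

theorem norm_zDyadic_le_dyadicRatio (h : AdmissibleParameter β b θ) {k : ℕ} (hk : 1 ≤ k) {t : ℝ}
    (ht : 0 ≤ t) : ‖zDyadic β θ k t‖ ≤ dyadicRatio β k :=
  le_min (h.norm_zDyadic_le hk ht) (h.norm_zDyadic_le_cos hk ht)

/-- For each k the ratio test suffices. Uniformity in k comes from the rotated Beta bound M^m with M
< 2 against powers of a ratio tending to at most 1/2. With ρ between M/2 and 1, the inner sum for
large k is at most 2^{-k} times a geometric constant. -/
theorem summable_dyadicRatio_pow_mul (h : AdmissibleParameter β b θ) {x : ℂ}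
    (hx : x ∈ laplaceDomain b) :
    Summable fun q : ℕ × ℕ =>
      dyadicRatio β (q.1 + 1) ^ q.2 * ‖betaCoeff (2 ^ (q.1 + 1) * x / β) q.2‖ := by
  obtain ⟨φ, hφ, hφx⟩ := h.exists_direction hx
  set a : ℂ := Complex.exp ((φ + b : ℝ) * Complex.I) with ha_def
  have ha : 0 < a.re := by
    rw [ha_def, Complex.exp_ofReal_mul_I_re]
    exact cos_add_pos hφ
  have hya : 0 < (x / β * a).re := by
    rw [h.mul_exp_eq, Complex.re_ofReal_mul] at hφx
    exact pos_of_mul_pos_right hφx (norm_nonneg _)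
  obtain ⟨M, hM0, hM2, hM⟩ := norm_one_sub_exp_neg_mul_le ha
  obtain ⟨ρ, hρ1, hρ2⟩ := exists_between (show M / 2 < 1 by linarith)
  obtain ⟨K, hK⟩ := eventually_atTop.1 (tendsto_dyadicRatio β (ρ / M) (by
    rw [lt_div_iff₀ hM0]; linarith))
  have hc0 : ∀ k, 0 ≤ dyadicRatio β (k + 1) := fun k => h.dyadicRatio_nonneg (by omega)
  have hsum : ∀ k : ℕ, Summable fun m : ℕ =>
      dyadicRatio β (k + 1) ^ m * ‖betaCoeff (2 ^ (k + 1) * x / β) m‖ := fun k =>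
    summable_pow_mul_norm_betaCoeff (hc0 k) (h.dyadicRatio_lt_one _) _
  refine (summable_prod_of_nonneg fun q => mul_nonneg (pow_nonneg (hc0 _) _) (norm_nonneg _)).2
    ⟨hsum, ?_⟩
  have hρ0 : 0 ≤ ρ := by linarith
  -- Only finitely many k precede the range where the ratio is below ρ/M; they do not affect
  -- summability.
  refine (summable_nat_add_iff K).1 (Summable.of_nonneg_of_le
    (fun k => tsum_nonneg fun m => mul_nonneg (pow_nonneg (hc0 _) _) (norm_nonneg _)) (fun k => ?_)
    ((summable_geometric_two).mul_left ((1 - ρ)⁻¹ * (‖a‖ / (x / β * a).re))))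
  have hre : (2 ^ (k + K + 1) * x / β * a).re = 2 ^ (k + K + 1) * (x / β * a).re := by
    have : 2 ^ (k + K + 1) * x / β * a = ((2 ^ (k + K + 1) : ℝ) : ℂ) * (x / β * a) := by
      push_cast; ring
    rw [this, Complex.re_ofReal_mul]
  have hpos : 0 < (2 ^ (k + K + 1) * x / β * a).re := by rw [hre]; positivity
  have hle : ∀ m : ℕ, dyadicRatio β (k + K + 1) ^ m *
      ‖betaCoeff (2 ^ (k + K + 1) * x / β) m‖ ≤
      ρ ^ m * (‖a‖ / (2 ^ (k + K + 1) * x / β * a).re) := fun m => by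
    have h1 := norm_betaCoeff_le ha hpos hM m
    have h2 : dyadicRatio β (k + K + 1) * M ≤ ρ := by
      have := (hK (k + K + 1) (by omega)).le
      rwa [le_div_iff₀ hM0] at this
    have h3 := hc0 (k + K)
    calc _ ≤ dyadicRatio β (k + K + 1) ^ m *
          (M ^ m * (‖a‖ / (2 ^ (k + K + 1) * x / β * a).re)) := by gcongr
      _ = (dyadicRatio β (k + K + 1) * M) ^ m *
          (‖a‖ / (2 ^ (k + K + 1) * x / β * a).re) := by rw [mul_pow]; ring
      _ ≤ _ := by gcongr
  have hg := (summable_geometric_of_lt_one hρ0 hρ2).mul_right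
    (‖a‖ / (2 ^ (k + K + 1) * x / β * a).re)
  refine ((hsum (k + K)).tsum_le_tsum hle hg).trans ?_
  rw [tsum_mul_right, tsum_geometric_of_lt_one hρ0 hρ2, hre, mul_assoc]
  have h1ρ : 0 < 1 - ρ := by linarith
  gcongr
  have : (1 / 2 : ℝ) ^ (k + K + 1) ≤ (1 / 2) ^ k :=
    pow_le_pow_of_le_one (by norm_num) (by norm_num) (by omega)
  calc ‖a‖ / (2 ^ (k + K + 1) * (x / β * a).re)
      = ‖a‖ / (x / β * a).re * (1 / 2) ^ (k + K + 1) := by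
        rw [one_div, inv_pow]; field_simp
    _ ≤ _ := by gcongr

/-- Absolute convergence permits summing over m first. The resulting Lerch functions have partial
sums in k that telescope to the first dyadic remainder. -/
theorem hasSum_dyadic (h : AdmissibleParameter β b θ) {φ : ℝ}
    (hφ : |φ + b| < Real.pi / 2) {x : ℂ} (hx : 0 < (x * Complex.exp (φ * Complex.I)).re)
    {t : ℝ} (ht : 0 < t) :
    HasSum (fun q : ℕ × ℕ => (1 - zDyadic β θ (q.1 + 1) t) *
      lerchTerm (zDyadic β θ (q.1 + 1) t) (2 ^ (q.1 + 1) * x / β) q.2)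
      (dyadicRemainder β θ φ 1 x t) := by
  have hs : Summable fun q : ℕ × ℕ => (1 - zDyadic β θ (q.1 + 1) t) *
      lerchTerm (zDyadic β θ (q.1 + 1) t) (2 ^ (q.1 + 1) * x / β) q.2 := by
    refine Summable.of_norm_bounded
      ((h.summable_dyadicRatio_pow_mul (mem_laplaceDomain hφ hx)).mul_left 2) fun q => ?_
    have h1 := h.norm_zDyadic_le_dyadicRatio (k := q.1 + 1) (by omega) ht.le
    rw [norm_mul]
    gcongr
    · exact norm_one_sub_le_two h1 (h.dyadicRatio_lt_one _)
    · exact norm_lerchTerm_le h1 _ _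
  have h1 := hs.hasSum.prod_fiberwise (g := fun k => rhoDyadic β θ 0 (k + 1) x t) fun k => by
    have := (summable_lerchTerm (h.norm_zDyadic_lt_one (k := k + 1) (by omega) ht.le)
      (2 ^ (k + 1) * x / β)).hasSum.mul_left (1 - zDyadic β θ (k + 1) t)
    simpa [rhoDyadic, lerchTail] using this
  have h2 := h.tendsto_sum_rhoDyadic hφ hx ht
  simp only [sum_Icc_one_eq_sum_range] at h2
  rw [← tendsto_nhds_unique h1.tendsto_sum_nat h2]
  exact hs.hasSum

theorem factorialSeries (h : AdmissibleParameter β b θ) {F : ℂ → ℂ}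
    (hJ : IntegrableOn (branchJump θ F) (Ioi 0)) {φ : ℝ} (hφ : |φ + b| < Real.pi / 2) {x : ℂ}
    (hx : 0 < (x * Complex.exp (φ * Complex.I)).re) :
    Summable (fun m : ℕ => ‖(m.factorial : ℂ) / poch (x / β) (m + 1) *
      coeffZero β θ F (m + 1)‖) ∧
    Summable (fun q : ℕ × ℕ => ‖(q.2.factorial : ℂ) / poch (2 ^ (q.1 + 1) * x / β) (q.2 + 1) *
      coeff β θ F (q.2 + 1) (q.1 + 1)‖) ∧
    totalRemainder β θ φ F 0 1 0 x =
      ∑' m : ℕ, (m.factorial : ℂ) / poch (x / β) (m + 1) * coeffZero β θ F (m + 1) +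
      ∑' q : ℕ × ℕ, (q.2.factorial : ℂ) / poch (2 ^ (q.1 + 1) * x / β) (q.2 + 1) *
        coeff β θ F (q.2 + 1) (q.1 + 1) := by
  set J := branchJump θ F with hJ_def
  have hxd := mem_laplaceDomain hφ hx
  set c := cOne β
  have hc1 : c < 1 := cOne_lt_one h.cBeta_pos
  let f₀ : ℕ → ℝ → ℂ := fun m t =>
    -(J t * ((1 - zZero β θ t) * lerchTerm (zZero β θ t) (x / β) m))
  let f₁ : ℕ × ℕ → ℝ → ℂ := fun q t => J t * ((1 - zDyadic β θ (q.1 + 1) t) *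
      lerchTerm (zDyadic β θ (q.1 + 1) t) (2 ^ (q.1 + 1) * x / β) q.2)
  have i₀ : ∀ m, IntegrableOn (f₀ m) (Ioi 0) := fun m => (h.integrableOn_jump_mul_zero hJ _ m).neg
  have i₁ : ∀ q, IntegrableOn (f₁ q) (Ioi 0) := fun q =>
    h.integrableOn_jump_mul_dyadic hJ (by omega) _ _
  have s₀ : Summable fun m => ∫ t in Ioi (0 : ℝ), ‖f₀ m t‖ := by
    refine Summable.of_nonneg_of_le (fun m => by positivity) (fun m => ?_)
      ((summable_pow_mul_norm_betaCoeff (cOne_pos β).le hc1 (x / β)).mul_left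
        ((∫ t in Ioi (0 : ℝ), ‖J t‖) * 2))
    rw [mul_assoc, ← integral_mul_const]
    refine integral_mono_of_nonneg (Eventually.of_forall fun _ => norm_nonneg _)
      (hJ.norm.mul_const _) ?_
    filter_upwards [ae_restrict_mem measurableSet_Ioi] with t ht
    have h1 := h.norm_zZero_le (le_of_lt (mem_Ioi.1 ht))
    simp only [f₀]
    rw [norm_neg, norm_mul, norm_mul]
    gcongr
    · exact norm_one_sub_le_two h1 hc1
    · exact norm_lerchTerm_le h1 _ _
  have s₁ : Summable fun q => ∫ t in Ioi (0 : ℝ), ‖f₁ q t‖ := by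
    refine Summable.of_nonneg_of_le (fun m => by positivity) (fun q => ?_)
      ((h.summable_dyadicRatio_pow_mul hxd).mul_left ((∫ t in Ioi (0 : ℝ), ‖J t‖) * 2))
    rw [mul_assoc, ← integral_mul_const]
    refine integral_mono_of_nonneg (Eventually.of_forall fun _ => norm_nonneg _)
      (hJ.norm.mul_const _) ?_
    filter_upwards [ae_restrict_mem measurableSet_Ioi] with t ht
    have h1 := h.norm_zDyadic_le_dyadicRatio (k := q.1 + 1) (by omega) (le_of_lt (mem_Ioi.1 ht))
    simp only [f₁]
    rw [norm_mul, norm_mul]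
    gcongr
    · exact norm_one_sub_le_two h1 (h.dyadicRatio_lt_one _)
    · exact norm_lerchTerm_le h1 _ _
  have t₀ : ∀ m : ℕ, (m.factorial : ℂ) / poch (x / β) (m + 1) * coeffZero β θ F (m + 1) =
      cauchyFactor θ * ∫ t in Ioi (0 : ℝ), f₀ m t := fun m =>
    h.factorial_div_mul_coeffZero F _ m
  have t₁ : ∀ q : ℕ × ℕ, (q.2.factorial : ℂ) / poch (2 ^ (q.1 + 1) * x / β) (q.2 + 1) *
      coeff β θ F (q.2 + 1) (q.1 + 1) = cauchyFactor θ * ∫ t in Ioi (0 : ℝ), f₁ q t := fun q =>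
    h.factorial_div_mul_coeff F (by omega) _ q.2
  have H₀ := hasSum_integral_of_summable_integral_norm i₀ s₀
  have H₁ := hasSum_integral_of_summable_integral_norm i₁ s₁
  have e₀ : ∀ t ∈ Ioi (0 : ℝ), ∑' m, f₀ m t = -(J t * rhoZero β θ 0 x t) := fun t ht => by
    simp only [f₀, tsum_neg, tsum_mul_left, rhoZero, lerchTail, zero_add]
  have e₁ : ∀ t ∈ Ioi (0 : ℝ), ∑' q, f₁ q t = J t * dyadicRemainder β θ φ 1 x t := fun t ht =>
    ((h.hasSum_dyadic hφ hx ht).mul_left (J t)).tsum_eq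
  rw [setIntegral_congr_fun measurableSet_Ioi e₀] at H₀
  rw [setIntegral_congr_fun measurableSet_Ioi e₁] at H₁
  simp only [t₀, t₁]
  refine ⟨?_, ?_, ?_⟩
  · simp only [norm_mul]
    exact (Summable.of_nonneg_of_le (fun m => norm_nonneg _)
      (fun m => norm_integral_le_integral_norm _) s₀).mul_left _
  · simp only [norm_mul]
    exact (Summable.of_nonneg_of_le (fun m => norm_nonneg _)
      (fun m => norm_integral_le_integral_norm _) s₁).mul_left _
  · rw [(H₀.mul_left _).tsum_eq, (H₁.mul_left _).tsum_eq, ← mul_add, totalRemainder]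
    congr 1
    have i2 := h.integrableOn_jump_mul_dyadicRemainder hJ hφ hx le_rfl
    have e := integral_add (h.integrableOn_jump_mul_rhoZero hJ 0 x).neg i2
    simp only [Pi.neg_apply] at e
    rw [← e]
    congr 1
    ext t
    simp only [remainderIntegrand, Nat.sub_self, zero_lt_one, Finset.Icc_eq_empty_of_lt,
      Finset.sum_empty, add_zero]
    ring

end AdmissibleParameter

/-! ### Boundary values on the cut -/

theorem cutPoint_sub_one_mul (θ η t : ℝ) :
    (cutPoint (θ + η) t - 1) * Complex.exp (-(θ * Complex.I)) =
      (t : ℂ) * Complex.exp (η * Complex.I) := by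
  rw [cutPoint, add_sub_cancel_left, mul_assoc, ← Complex.exp_add]
  push_cast
  ring_nf

theorem im_cutPoint_sub_one_mul (θ η t : ℝ) :
    ((cutPoint (θ + η) t - 1) * Complex.exp (-(θ * Complex.I))).im = t * Real.sin η := by
  rw [cutPoint_sub_one_mul, Complex.im_ofReal_mul, Complex.exp_ofReal_mul_I_im]

theorem re_cutPoint_sub_one_mul (θ η t : ℝ) :
    ((cutPoint (θ + η) t - 1) * Complex.exp (-(θ * Complex.I))).re = t * Real.cos η := by
  rw [cutPoint_sub_one_mul, Complex.re_ofReal_mul, Complex.exp_ofReal_mul_I_re]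

theorem mem_borelCut_iff (θ : ℝ) (p : ℂ) : p ∈ borelCut θ ↔
    ((p - 1) * Complex.exp (-(θ * Complex.I))).im = 0 ∧
      0 ≤ ((p - 1) * Complex.exp (-(θ * Complex.I))).re := by
  constructor
  · rintro ⟨t, ht, rfl⟩
    have h1 := im_cutPoint_sub_one_mul θ 0 t
    have h2 := re_cutPoint_sub_one_mul θ 0 t
    simp only [add_zero, Real.sin_zero, mul_zero, Real.cos_zero, mul_one] at h1 h2
    exact ⟨h1, by rw [h2]; exact ht⟩
  · rintro ⟨h1, h2⟩
    refine ⟨_, h2, ?_⟩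
    have e : (((((p - 1) * Complex.exp (-(θ * Complex.I))).re : ℝ)) : ℂ) =
        (p - 1) * Complex.exp (-(θ * Complex.I)) := Complex.ext (by simp) (by simp [h1])
    rw [cutPoint, e, mul_assoc, ← Complex.exp_add, neg_add_cancel, Complex.exp_zero]
    ring

theorem isClosed_borelCut (θ : ℝ) : IsClosed (borelCut θ) := by
  have : borelCut θ = {p : ℂ | ((p - 1) * Complex.exp (-(θ * Complex.I))).im = 0} ∩
      {p : ℂ | 0 ≤ ((p - 1) * Complex.exp (-(θ * Complex.I))).re} :=
    Set.ext (mem_borelCut_iff θ)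
  rw [this]
  exact (isClosed_eq (by fun_prop) continuous_const).inter
    (isClosed_le continuous_const (by fun_prop))

theorem cutPoint_notMem_borelCut (θ : ℝ) {η t : ℝ} (ht : 0 < t) (hη : 0 < η)
    (hη2 : η < 2 * Real.pi) : cutPoint (θ + η) t ∉ borelCut θ := by
  rw [mem_borelCut_iff, im_cutPoint_sub_one_mul, re_cutPoint_sub_one_mul]
  rintro ⟨h1, h2⟩
  have h3 : Real.sin η = 0 := by
    rcases mul_eq_zero.1 h1 with h | h
    · exact absurd h ht.ne'
    · exact h
  have h4 : η = Real.pi := by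
    rcases lt_trichotomy η Real.pi with h | h | h
    · exact absurd h3 (Real.sin_pos_of_pos_of_lt_pi hη h).ne'
    · exact h
    · have := Real.sin_neg_of_neg_of_neg_pi_lt (x := η - 2 * Real.pi) (by linarith) (by linarith)
      rw [Real.sin_sub_two_pi] at this
      exact absurd h3 this.ne
  rw [h4, Real.cos_pi] at h2
  linarith

theorem cutPoint_add_two_pi (ω t : ℝ) : cutPoint (ω + 2 * Real.pi) t = cutPoint ω t := by
  rw [cutPoint, cutPoint]
  push_cast
  rw [add_mul, Complex.exp_add, Complex.exp_two_pi_mul_I, mul_one]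

theorem le_norm_cutPoint (ω : ℝ) {t : ℝ} (ht : 0 ≤ t) : t - 1 ≤ ‖cutPoint ω t‖ := by
  have h := norm_sub_norm_le ((t : ℂ) * Complex.exp (ω * Complex.I)) (-1)
  rw [norm_mul, Complex.norm_exp_ofReal_mul_I, mul_one, Complex.norm_of_nonneg ht, norm_neg,
    norm_one, sub_neg_eq_add, add_comm] at h
  exact h

/-- The boundary value of `F` on the cut from the side `σ = ±1`. -/
def boundaryValue (θ σ : ℝ) (F : ℂ → ℂ) (t : ℝ) : ℂ :=
  limUnder (𝓝[>] (0 : ℝ)) (fun ε : ℝ => F (cutPoint (θ + σ * ε) t))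

theorem branchJump_eq (θ : ℝ) (F : ℂ → ℂ) (t : ℝ) :
    branchJump θ F t = boundaryValue θ 1 F t - boundaryValue θ (-1) F t := by
  simp only [branchJump, boundaryValue, one_mul, neg_one_mul, ← sub_eq_add_neg]

/-- `F` continues analytically across the cut at every `cutPoint θ t`, `t > 0`,
from the side `σ = ±1`. -/
def ContinuesAcross (θ σ : ℝ) (F : ℂ → ℂ) : Prop :=
  ∀ t : ℝ, 0 < t → ∃ r : ℝ, 0 < r ∧ ∃ G : ℂ → ℂ,
    AnalyticOnNhd ℂ G (Metric.ball (cutPoint θ t) r) ∧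
    ∀ p ∈ Metric.ball (cutPoint θ t) r,
      0 < σ * ((p - 1) * Complex.exp (-(θ * Complex.I))).im → F p = G p

theorem IsFunctionElement.continuesAcross_one {θ : ℝ} {F : ℂ → ℂ} (hF : IsFunctionElement θ F) :
    ContinuesAcross θ 1 F := by
  simpa only [ContinuesAcross, one_mul] using hF.continuation_pos

theorem IsFunctionElement.continuesAcross_neg_one {θ : ℝ} {F : ℂ → ℂ}
    (hF : IsFunctionElement θ F) : ContinuesAcross θ (-1) F := by
  simpa only [ContinuesAcross, neg_one_mul, neg_pos] using hF.continuation_neg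

/-- The disc need not be centred at the point considered: one local continuation gives the boundary
values at every cut point in its disc, and hence their continuity. -/
theorem tendsto_of_continuation {θ σ : ℝ} (hσ : σ = 1 ∨ σ = -1) {F G : ℂ → ℂ} {c : ℂ} {r t : ℝ}
    (hG : AnalyticOnNhd ℂ G (Metric.ball c r))
    (hFG : ∀ p ∈ Metric.ball c r,
      0 < σ * ((p - 1) * Complex.exp (-(θ * Complex.I))).im → F p = G p)
    (ht : 0 < t) (htc : cutPoint θ t ∈ Metric.ball c r) :
    Tendsto (fun ε : ℝ => F (cutPoint (θ + σ * ε) t)) (𝓝[>] 0) (𝓝 (G (cutPoint θ t))) := by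
  have hc : ContinuousAt (fun ε : ℝ => cutPoint (θ + σ * ε) t) 0 := by
    unfold cutPoint; fun_prop
  have hc0 : Tendsto (fun ε : ℝ => cutPoint (θ + σ * ε) t) (𝓝[>] 0) (𝓝 (cutPoint θ t)) := by
    have := hc.tendsto
    simp only [mul_zero, add_zero] at this
    exact this.mono_left nhdsWithin_le_nhds
  refine ((hG _ htc).continuousAt.tendsto.comp hc0).congr' ?_
  filter_upwards [hc0 (Metric.isOpen_ball.mem_nhds htc), self_mem_nhdsWithin,
    nhdsWithin_le_nhds (Iio_mem_nhds Real.pi_pos)] with ε h1 h2 h3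
  refine (hFG _ h1 ?_).symm
  rw [im_cutPoint_sub_one_mul]
  have h4 := Real.sin_pos_of_pos_of_lt_pi h2 h3
  rcases hσ with rfl | rfl
  · rw [one_mul, one_mul]; positivity
  · rw [neg_one_mul, neg_one_mul, Real.sin_neg]; nlinarith [mul_pos ht h4]

theorem boundaryValue_eq_of_continuation {θ σ : ℝ} (hσ : σ = 1 ∨ σ = -1) {F G : ℂ → ℂ} {c : ℂ}
    {r t : ℝ} (hG : AnalyticOnNhd ℂ G (Metric.ball c r))
    (hFG : ∀ p ∈ Metric.ball c r,
      0 < σ * ((p - 1) * Complex.exp (-(θ * Complex.I))).im → F p = G p)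
    (ht : 0 < t) (htc : cutPoint θ t ∈ Metric.ball c r) :
    boundaryValue θ σ F t = G (cutPoint θ t) :=
  (tendsto_of_continuation hσ hG hFG ht htc).limUnder_eq

theorem tendsto_boundaryValue {θ σ : ℝ} (hσ : σ = 1 ∨ σ = -1) {F : ℂ → ℂ}
    (hF : ContinuesAcross θ σ F) {t : ℝ} (ht : 0 < t) :
    Tendsto (fun ε : ℝ => F (cutPoint (θ + σ * ε) t)) (𝓝[>] 0) (𝓝 (boundaryValue θ σ F t)) := by
  obtain ⟨r, hr, G, hG, hFG⟩ := hF t ht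
  have hm : cutPoint θ t ∈ Metric.ball (cutPoint θ t) r := Metric.mem_ball_self hr
  rw [boundaryValue_eq_of_continuation hσ hG hFG ht hm]
  exact tendsto_of_continuation hσ hG hFG ht hm

theorem continuousOn_boundaryValue {θ σ : ℝ} (hσ : σ = 1 ∨ σ = -1) {F : ℂ → ℂ}
    (hF : ContinuesAcross θ σ F) : ContinuousOn (boundaryValue θ σ F) (Ioi 0) := by
  intro t ht
  obtain ⟨r, hr, G, hG, hFG⟩ := hF t ht
  have hm : cutPoint θ t ∈ Metric.ball (cutPoint θ t) r := Metric.mem_ball_self hr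
  have hc : ContinuousAt (cutPoint θ) t := by unfold cutPoint; fun_prop
  refine ContinuousAt.continuousWithinAt ?_
  refine (ContinuousAt.comp (g := G) (hG _ hm).continuousAt hc).congr ?_
  filter_upwards [hc (Metric.isOpen_ball.mem_nhds hm), Ioi_mem_nhds ht] with t' h1 h2
  exact (boundaryValue_eq_of_continuation hσ hG hFG h2 h1).symm

/-- The ray at angle θ - ε is also the ray at θ + 2π - ε, which lies in the range where the
integrability bound is assumed. -/
theorem cutPoint_side {θ σ : ℝ} (hσ : σ = 1 ∨ σ = -1) {ε : ℝ} (hε : 0 < ε)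
    (hε2 : ε < 2 * Real.pi) : ∃ η : ℝ, 0 < η ∧ η < 2 * Real.pi ∧
      ∀ t, cutPoint (θ + σ * ε) t = cutPoint (θ + η) t := by
  rcases hσ with rfl | rfl
  · exact ⟨ε, hε, hε2, fun t => by rw [one_mul]⟩
  · refine ⟨2 * Real.pi - ε, by linarith, by linarith, fun t => ?_⟩
    rw [← cutPoint_add_two_pi]
    congr 1
    ring

theorem IsFunctionElement.continuousOn_ray {θ : ℝ} {F : ℂ → ℂ} (hF : IsFunctionElement θ F)
    {η : ℝ} (h0 : 0 < η) (h1 : η < 2 * Real.pi) :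
    ContinuousOn (fun t => F (cutPoint (θ + η) t)) (Ioi 0) := by
  intro t ht
  have hc : ContinuousAt (cutPoint (θ + η)) t := by unfold cutPoint; fun_prop
  exact (ContinuousAt.comp (g := F)
    (hF.analytic _ (cutPoint_notMem_borelCut θ ht h0 h1)).continuousAt hc).continuousWithinAt

/-- Fatou's lemma along rays closing on the cut transfers the uniform L¹ bound near the branch
point. Decay controls the far part, and continuity the compact part between them. -/
theorem IsFunctionElement.integrableOn_boundaryValue {θ : ℝ} {F : ℂ → ℂ}
    (hF : IsFunctionElement θ F) {σ : ℝ} (hσ : σ = 1 ∨ σ = -1) (hc : ContinuesAcross θ σ F) :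
    IntegrableOn (boundaryValue θ σ F) (Ioi 0) := by
  have hpi := Real.pi_gt_three
  have hcont := continuousOn_boundaryValue hσ hc
  obtain ⟨δ, hδ, K, hK⟩ := hF.integrable_branch
  obtain ⟨α, hα, C, R, hR, hdec⟩ := hF.decay
  have near : IntegrableOn (boundaryValue θ σ F) (Ioo 0 δ) := by
    refine ⟨(hcont.mono Ioo_subset_Ioi_self).aestronglyMeasurable measurableSet_Ioo, ?_⟩
    let u : ℕ → ℝ := fun n => 1 / (n + 1)
    have hu0 : ∀ n, 0 < u n := fun n => Nat.one_div_pos_of_nat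
    have hu1 : ∀ n, u n < 2 * Real.pi := fun n => by
      have : u n ≤ 1 := by
        simp only [u]
        rw [div_le_one (by positivity)]
        have : (0 : ℝ) ≤ n := Nat.cast_nonneg n
        linarith
      linarith
    have hu : Tendsto u atTop (𝓝[>] 0) := tendsto_nhdsWithin_iff.2
      ⟨tendsto_one_div_add_atTop_nhds_zero_nat, Eventually.of_forall hu0⟩
    have hle : ∀ n, ∫⁻ t in Ioo 0 δ, ‖F (cutPoint (θ + σ * u n) t)‖ₑ ≤ K := fun n => by
      obtain ⟨η, h0, h1, h2⟩ := cutPoint_side (θ := θ) hσ (hu0 n) (hu1 n)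
      simp only [h2]
      exact hK (θ + η) ⟨by linarith, by linarith⟩
    have hmeas : ∀ n, AEMeasurable (fun t => ‖F (cutPoint (θ + σ * u n) t)‖ₑ)
        (volume.restrict (Ioo 0 δ)) := fun n => by
      obtain ⟨η, h0, h1, h2⟩ := cutPoint_side (θ := θ) hσ (hu0 n) (hu1 n)
      simp only [h2]
      exact (((hF.continuousOn_ray h0 h1).mono Ioo_subset_Ioi_self).aestronglyMeasurable
        measurableSet_Ioo).enorm
    have hfatou := lintegral_liminf_le' (u := atTop) hmeas
    have hlim : ∫⁻ t in Ioo 0 δ, ‖boundaryValue θ σ F t‖ₑ =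
        ∫⁻ t in Ioo 0 δ, liminf (fun n => ‖F (cutPoint (θ + σ * u n) t)‖ₑ) atTop := by
      refine setLIntegral_congr_fun measurableSet_Ioo fun t ht => ?_
      exact (((tendsto_boundaryValue hσ hc ht.1).comp hu).enorm).liminf_eq.symm
    have hfin : ∫⁻ t in Ioo 0 δ, ‖boundaryValue θ σ F t‖ₑ ≤ K := by
      rw [hlim]
      refine hfatou.trans ?_
      exact (liminf_le_liminf (Eventually.of_forall hle)).trans (by simp)
    exact hfin.trans_lt ENNReal.coe_lt_top
  -- For t > T both t/2 ≤ t - 1 ≤ |s| and |s| ≥ R hold, so the decay hypothesis applies and can be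
  -- stated in t.
  set T := max 2 (R + 1)
  have hT2 : 2 ≤ T := le_max_left _ _
  have far : IntegrableOn (boundaryValue θ σ F) (Ioi T) := by
    have hi := (integrableOn_Ioi_rpow_of_lt (show -α < -1 by linarith)
      (show 0 < T by linarith)).const_mul (|C| * 2 ^ α)
    refine Integrable.mono' hi ((hcont.mono (Ioi_subset_Ioi (by linarith))).aestronglyMeasurable
      measurableSet_Ioi) ?_
    filter_upwards [ae_restrict_mem measurableSet_Ioi] with t ht
    have htT : T < t := ht
    have ht0 : 0 < t := by linarith
    refine le_of_tendsto (tendsto_boundaryValue hσ hc ht0).norm ?_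
    filter_upwards [self_mem_nhdsWithin,
      nhdsWithin_le_nhds (Iio_mem_nhds (show (0 : ℝ) < 2 * Real.pi by linarith))] with ε h1 h2
    obtain ⟨η, h3, h4, h5⟩ := cutPoint_side (θ := θ) hσ h1 h2
    rw [h5]
    have h6 := le_norm_cutPoint (θ + η) ht0.le
    have h7 : R + 1 ≤ T := le_max_right _ _
    have h8 : t / 2 ≤ ‖cutPoint (θ + η) t‖ := by linarith
    refine (hdec _ (cutPoint_notMem_borelCut θ ht0 h3 h4) (by linarith)).trans ?_
    have h9 : ‖cutPoint (θ + η) t‖ ^ (-α) ≤ (t / 2) ^ (-α) :=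
      Real.rpow_le_rpow_of_nonpos (by linarith) h8 (by linarith)
    have h10 : (t / 2) ^ (-α) = 2 ^ α * t ^ (-α) := by
      rw [Real.div_rpow ht0.le (by norm_num), Real.rpow_neg (by norm_num : (0 : ℝ) ≤ 2),
        div_inv_eq_mul, mul_comm]
    calc C * ‖cutPoint (θ + η) t‖ ^ (-α) ≤ |C| * (t / 2) ^ (-α) := by
          have := le_abs_self C
          gcongr
      _ = _ := by rw [h10]; ring
  have mid : IntegrableOn (boundaryValue θ σ F) (Icc (δ / 2) T) :=
    (hcont.mono fun t ht => lt_of_lt_of_le (by positivity) ht.1).integrableOn_Icc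
  refine ((near.union mid).union far).mono_set fun t ht => ?_
  by_cases h1 : t < δ
  · exact Or.inl (Or.inl ⟨ht, h1⟩)
  · by_cases h2 : t ≤ T
    · exact Or.inl (Or.inr ⟨by linarith [not_lt.1 h1], h2⟩)
    · exact Or.inr (not_le.1 h2)

theorem IsFunctionElement.integrableOn_branchJump {θ : ℝ} {F : ℂ → ℂ}
    (hF : IsFunctionElement θ F) : IntegrableOn (branchJump θ F) (Ioi 0) := by
  have := (hF.integrableOn_boundaryValue (Or.inl rfl) hF.continuesAcross_one).sub
    (hF.integrableOn_boundaryValue (Or.inr rfl) hF.continuesAcross_neg_one)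
  exact this.congr (Eventually.of_forall fun t => (branchJump_eq θ F t).symm)

theorem IsFunctionElement.continuousOn_branchJump {θ : ℝ} {F : ℂ → ℂ}
    (hF : IsFunctionElement θ F) : ContinuousOn (branchJump θ F) (Ioi 0) := by
  have := (continuousOn_boundaryValue (Or.inl rfl) hF.continuesAcross_one).sub
    (continuousOn_boundaryValue (Or.inr rfl) hF.continuesAcross_neg_one)
  exact this.congr fun t _ => branchJump_eq θ F t

/-! ### The contour around the cut, in logarithmic coordinates -/

/-- The map `v ↦ 1 + e^{v + iθ}` from the strip `0 < Im v < 2π` onto the cut plane. -/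
def stripMap (θ : ℝ) (v : ℂ) : ℂ := 1 + Complex.exp (v + θ * Complex.I)

theorem stripMap_eq (θ : ℝ) (v : ℂ) : stripMap θ v = cutPoint (θ + v.im) (Real.exp v.re) := by
  rw [stripMap, cutPoint, Complex.ofReal_exp, ← Complex.exp_add]
  conv_lhs => rw [← Complex.re_add_im v]
  push_cast
  ring_nf

theorem continuous_stripMap (θ : ℝ) : Continuous (stripMap θ) := by
  unfold stripMap; fun_prop

theorem stripMap_notMem_borelCut (θ : ℝ) {v : ℂ} (h0 : 0 < v.im) (h1 : v.im < 2 * Real.pi) :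
    stripMap θ v ∉ borelCut θ := by
  rw [stripMap_eq]
  exact cutPoint_notMem_borelCut θ (Real.exp_pos _) h0 h1

theorem im_stripMap_sub_one_mul (θ : ℝ) (v : ℂ) :
    ((stripMap θ v - 1) * Complex.exp (-(θ * Complex.I))).im =
      Real.exp v.re * Real.sin v.im := by
  rw [stripMap_eq, im_cutPoint_sub_one_mul]

/-- `F ∘ stripMap`, extended to the boundary of the strip by the boundary values of `F`. -/
def stripValue (θ : ℝ) (F : ℂ → ℂ) (v : ℂ) : ℂ :=
  if v.im ≤ 0 then boundaryValue θ 1 F (Real.exp v.re)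
  else if 2 * Real.pi ≤ v.im then boundaryValue θ (-1) F (Real.exp v.re)
  else F (stripMap θ v)

theorem stripValue_of_mem {θ : ℝ} {F : ℂ → ℂ} {v : ℂ} (h0 : 0 < v.im)
    (h1 : v.im < 2 * Real.pi) : stripValue θ F v = F (stripMap θ v) := by
  rw [stripValue, if_neg (not_le.2 h0), if_neg (not_le.2 h1)]

/-- The difference quotient of `F` at `p` on the strip. -/
def stripSlope (θ : ℝ) (F : ℂ → ℂ) (p v : ℂ) : ℂ :=
  if 0 < v.im ∧ v.im < 2 * Real.pi then dslope F p (stripMap θ v)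
  else (stripValue θ F v - F p) / (stripMap θ v - p)

theorem stripSlope_eq {θ : ℝ} {F : ℂ → ℂ} {p v : ℂ} (h : stripMap θ v ≠ p) :
    stripSlope θ F p v = (stripValue θ F v - F p) / (stripMap θ v - p) := by
  rw [stripSlope]
  split_ifs with h1
  · rw [dslope_of_ne _ h, slope_def_field, stripValue_of_mem h1.1 h1.2]
  · rfl

/-- The integrand of the contour integral around the cut. -/
def stripIntegrand (θ : ℝ) (F : ℂ → ℂ) (p v : ℂ) : ℂ :=
  stripSlope θ F p v * Complex.exp (v + θ * Complex.I)

theorem stripMap_mem_borelCut (θ : ℝ) {v : ℂ} (h : v.im = 0 ∨ v.im = 2 * Real.pi) :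
    stripMap θ v = cutPoint θ (Real.exp v.re) := by
  rw [stripMap_eq]
  rcases h with h | h
  · rw [h, add_zero]
  · rw [h, cutPoint_add_two_pi]

theorem IsFunctionElement.differentiableOn {θ : ℝ} {F : ℂ → ℂ} (hF : IsFunctionElement θ F) :
    DifferentiableOn ℂ F (borelCut θ)ᶜ := hF.analytic.differentiableOn

/-- Within π of either edge of the strip, sin(Im v) has the sign of the corresponding side of the
cut, so `F` agrees there with its continuation `G`, and so do the boundary values on the edge. -/
theorem continuousWithinAt_stripValue {θ : ℝ} {F : ℂ → ℂ} (hF : IsFunctionElement θ F) {v : ℂ}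
    (h0 : 0 ≤ v.im) (h1 : v.im ≤ 2 * Real.pi) :
    ContinuousWithinAt (stripValue θ F) {v | 0 ≤ v.im ∧ v.im ≤ 2 * Real.pi} v := by
  have hpi := Real.pi_pos
  have hs := (continuous_stripMap θ).continuousAt (x := v)
  have him := Complex.continuous_im.continuousAt (x := v)
  rcases h0.eq_or_lt with h0 | h0
  · obtain ⟨r, hr, G, hG, hFG⟩ := hF.continuesAcross_one (Real.exp v.re) (Real.exp_pos _)
    have hv : stripMap θ v = cutPoint θ (Real.exp v.re) := stripMap_mem_borelCut θ (Or.inl h0.symm)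
    have hm : stripMap θ v ∈ Metric.ball (cutPoint θ (Real.exp v.re)) r := by
      rw [hv]; exact Metric.mem_ball_self hr
    have heq : ∀ w : ℂ, 0 ≤ w.im → w.im < Real.pi →
        stripMap θ w ∈ Metric.ball (cutPoint θ (Real.exp v.re)) r →
        stripValue θ F w = G (stripMap θ w) := by
      intro w h2 h3 h4
      rcases h2.eq_or_lt with h2 | h2
      · rw [stripValue, if_pos h2.symm.le]
        rw [stripMap_mem_borelCut θ (Or.inl h2.symm)] at h4 ⊢
        exact boundaryValue_eq_of_continuation (Or.inl rfl) hG hFG (Real.exp_pos _) h4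
      · rw [stripValue_of_mem h2 (by linarith)]
        refine hFG _ h4 ?_
        rw [im_stripMap_sub_one_mul, one_mul]
        exact mul_pos (Real.exp_pos _) (Real.sin_pos_of_pos_of_lt_pi h2 h3)
    refine (ContinuousAt.comp (g := G) (hG _ hm).continuousAt hs).continuousWithinAt.congr_of_eventuallyEq ?_
      (heq v h0.le (by linarith) hm)
    filter_upwards [self_mem_nhdsWithin, nhdsWithin_le_nhds
      (hs (Metric.isOpen_ball.mem_nhds hm)), nhdsWithin_le_nhds
      (him (Iio_mem_nhds (show v.im < Real.pi by linarith)))] with w h2 h3 h4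
    exact heq w h2.1 h4 h3
  rcases h1.eq_or_lt with h1 | h1
  · obtain ⟨r, hr, G, hG, hFG⟩ := hF.continuesAcross_neg_one (Real.exp v.re) (Real.exp_pos _)
    have hv : stripMap θ v = cutPoint θ (Real.exp v.re) := stripMap_mem_borelCut θ (Or.inr h1)
    have hm : stripMap θ v ∈ Metric.ball (cutPoint θ (Real.exp v.re)) r := by
      rw [hv]; exact Metric.mem_ball_self hr
    have heq : ∀ w : ℂ, w.im ≤ 2 * Real.pi → Real.pi < w.im →
        stripMap θ w ∈ Metric.ball (cutPoint θ (Real.exp v.re)) r →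
        stripValue θ F w = G (stripMap θ w) := by
      intro w h2 h3 h4
      rcases h2.eq_or_lt with h2 | h2
      · rw [stripValue, if_neg (by linarith), if_pos h2.symm.le]
        rw [stripMap_mem_borelCut θ (Or.inr h2)] at h4 ⊢
        exact boundaryValue_eq_of_continuation (Or.inr rfl) hG hFG (Real.exp_pos _) h4
      · rw [stripValue_of_mem (by linarith) h2]
        refine hFG _ h4 ?_
        rw [im_stripMap_sub_one_mul, neg_one_mul, neg_pos]
        have := Real.sin_neg_of_neg_of_neg_pi_lt (x := w.im - 2 * Real.pi) (by linarith)
          (by linarith)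
        rw [Real.sin_sub_two_pi] at this
        exact mul_neg_of_pos_of_neg (Real.exp_pos _) this
    refine (ContinuousAt.comp (g := G) (hG _ hm).continuousAt hs).continuousWithinAt.congr_of_eventuallyEq ?_
      (heq v h1.le (by linarith) hm)
    filter_upwards [self_mem_nhdsWithin, nhdsWithin_le_nhds
      (hs (Metric.isOpen_ball.mem_nhds hm)), nhdsWithin_le_nhds
      (him (Ioi_mem_nhds (show Real.pi < v.im by linarith)))] with w h2 h3 h4
    exact heq w h2.2 h4 h3
  · refine ContinuousAt.continuousWithinAt ?_
    refine (ContinuousAt.comp (g := F)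
      (hF.analytic _ (stripMap_notMem_borelCut θ h0 h1)).continuousAt hs).congr ?_
    filter_upwards [him (Ioo_mem_nhds h0 h1)] with w hw
    exact (stripValue_of_mem hw.1 hw.2).symm

/-- Using `dslope` removes the singularity at p, so the rectangle theorem needs no residue; the
factor e^{v+iθ} is the derivative of `stripMap`. -/
theorem differentiableAt_stripIntegrand {θ : ℝ} {F : ℂ → ℂ} (hF : IsFunctionElement θ F) {p : ℂ}
    (hp : p ∈ (borelCut θ)ᶜ) {v : ℂ} (h0 : 0 < v.im) (h1 : v.im < 2 * Real.pi) :
    DifferentiableAt ℂ (stripIntegrand θ F p) v := by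
  have hop := (isClosed_borelCut θ).isOpen_compl
  have hd : DifferentiableOn ℂ (dslope F p) (borelCut θ)ᶜ :=
    (Complex.differentiableOn_dslope (hop.mem_nhds hp)).2 hF.differentiableOn
  have hd' : DifferentiableAt ℂ (dslope F p) (stripMap θ v) :=
    hd.differentiableAt (hop.mem_nhds (stripMap_notMem_borelCut θ h0 h1))
  have hs : DifferentiableAt ℂ (stripMap θ) v := by unfold stripMap; fun_prop
  have h2 : DifferentiableAt ℂ
      (fun v => dslope F p (stripMap θ v) * Complex.exp (v + θ * Complex.I)) v :=
    (hd'.comp v hs).mul (by fun_prop)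
  refine h2.congr_of_eventuallyEq ?_
  filter_upwards [Complex.continuous_im.continuousAt (Ioo_mem_nhds h0 h1)] with w hw
  rw [stripIntegrand, stripSlope, if_pos ⟨hw.1, hw.2⟩]

theorem continuousOn_stripIntegrand {θ : ℝ} {F : ℂ → ℂ} (hF : IsFunctionElement θ F) {p : ℂ}
    (hp : p ∈ (borelCut θ)ᶜ) :
    ContinuousOn (stripIntegrand θ F p) {v | 0 ≤ v.im ∧ v.im ≤ 2 * Real.pi} := by
  intro v hv
  by_cases hin : 0 < v.im ∧ v.im < 2 * Real.pi
  · exact (differentiableAt_stripIntegrand hF hp hin.1 hin.2).continuousAt.continuousWithinAt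
  · have hb : v.im = 0 ∨ v.im = 2 * Real.pi := by
      rcases hv.1.eq_or_lt with h | h
      · exact Or.inl h.symm
      · exact Or.inr (le_antisymm hv.2 (not_lt.1 fun h1 => hin ⟨h, h1⟩))
    have hne : stripMap θ v ≠ p := by
      rintro rfl
      exact hp ⟨_, (Real.exp_pos _).le, stripMap_mem_borelCut θ hb⟩
    have hs := (continuous_stripMap θ).continuousAt (x := v)
    have h1 : ContinuousWithinAt (fun v => (stripValue θ F v - F p) / (stripMap θ v - p) *
        Complex.exp (v + θ * Complex.I)) {v | 0 ≤ v.im ∧ v.im ≤ 2 * Real.pi} v := by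
      refine ContinuousWithinAt.mul (ContinuousWithinAt.div
        ((continuousWithinAt_stripValue hF hv.1 hv.2).sub continuousWithinAt_const)
        (hs.continuousWithinAt.sub continuousWithinAt_const) (sub_ne_zero.2 hne)) ?_
      exact Continuous.continuousWithinAt (by fun_prop)
    refine h1.congr_of_eventuallyEq ?_ (by rw [stripIntegrand, stripSlope_eq hne])
    filter_upwards [nhdsWithin_le_nhds (hs (isOpen_ne.mem_nhds hne))] with w hw
    rw [stripIntegrand, stripSlope_eq hw]

/-- The integral over the circle of radius `ρ` around the branch point. -/
def circleEdge (θ : ℝ) (F : ℂ → ℂ) (p : ℂ) (ρ : ℝ) : ℂ :=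
  ∫ y in Ioo (0 : ℝ) (2 * Real.pi), F (cutPoint (θ + y) ρ) / (cutPoint (θ + y) ρ - p) *
    ((ρ : ℂ) * Complex.exp ((θ + y : ℝ) * Complex.I))

theorem exp_log_add_mul_I (y : ℝ) {ρ : ℝ} (hρ : 0 < ρ) (θ : ℝ) :
    Complex.exp ((Real.log ρ : ℂ) + y * Complex.I + θ * Complex.I) =
      (ρ : ℂ) * Complex.exp ((θ + y : ℝ) * Complex.I) := by
  rw [add_assoc, Complex.exp_add, ← Complex.ofReal_exp, Real.exp_log hρ]
  push_cast
  ring_nf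

theorem stripMap_log_add (y : ℝ) {ρ : ℝ} (hρ : 0 < ρ) (θ : ℝ) :
    stripMap θ ((Real.log ρ : ℂ) + y * Complex.I) = cutPoint (θ + y) ρ := by
  rw [stripMap, exp_log_add_mul_I y hρ, cutPoint]

theorem cutPoint_ne_of_norm_ne {p : ℂ} {ρ : ℝ} (hρ : 0 < ρ) (h : ρ ≠ ‖p - 1‖) (ω : ℝ) :
    cutPoint ω ρ - p ≠ 0 := by
  intro h0
  apply h
  rw [← sub_eq_zero.1 h0, cutPoint, add_sub_cancel_left, norm_mul,
    Complex.norm_exp_ofReal_mul_I, mul_one, Complex.norm_of_nonneg hρ.le]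

theorem I_mul_integral_circle {θ ρ : ℝ} {p : ℂ} :
    Complex.I * ∫ y in Ioo (0 : ℝ) (2 * Real.pi), (1 / (cutPoint (θ + y) ρ - p) *
      ((ρ : ℂ) * Complex.exp ((θ + y : ℝ) * Complex.I))) =
      ∮ z in C(0, ρ), (z - (p - 1) * Complex.exp (-(θ * Complex.I)))⁻¹ := by
  rw [circleIntegral, intervalIntegral.integral_of_le (by positivity),
    integral_Ioc_eq_integral_Ioo, ← integral_const_mul]
  congr 1
  ext y
  rw [deriv_circleMap, smul_eq_mul, circleMap, cutPoint]
  have e1 : Complex.exp (θ * Complex.I) * Complex.exp (-(θ * Complex.I)) = 1 := by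
    rw [← Complex.exp_add, add_neg_cancel, Complex.exp_zero]
  have e2 : Complex.exp ((θ + y : ℝ) * Complex.I) =
      Complex.exp (θ * Complex.I) * Complex.exp (y * Complex.I) := by
    rw [← Complex.exp_add]; push_cast; ring_nf
  have e3 : 1 + (ρ : ℂ) * Complex.exp ((θ + y : ℝ) * Complex.I) - p =
      Complex.exp (θ * Complex.I) * (0 + ρ * Complex.exp (y * Complex.I) -
        (p - 1) * Complex.exp (-(θ * Complex.I))) := by
    rw [e2]
    linear_combination (p - 1) * e1
  rw [e3, e2]
  have := Complex.exp_ne_zero (θ * Complex.I)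
  rw [one_div, mul_inv, zero_add]
  field_simp

/-- Away from the circle through p, the difference quotient splits into the integral of F(s)/(s-p)
and F(p) times a winding integral, which is where F(p) re-enters. -/
theorem circleEdge_eq {θ : ℝ} {F : ℂ → ℂ} (hF : IsFunctionElement θ F) {p : ℂ}
    (hp : p ∈ (borelCut θ)ᶜ) {ρ : ℝ} (hρ : 0 < ρ) (h : ρ ≠ ‖p - 1‖) :
    Complex.I * ∫ y in (0 : ℝ)..(2 * Real.pi),
      stripIntegrand θ F p ((Real.log ρ : ℂ) + y * Complex.I) =
      Complex.I * circleEdge θ F p ρ -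
        F p * ∮ z in C(0, ρ), (z - (p - 1) * Complex.exp (-(θ * Complex.I)))⁻¹ := by
  rw [← I_mul_integral_circle (θ := θ), mul_left_comm, ← mul_sub,
    intervalIntegral.integral_of_le (by positivity), integral_Ioc_eq_integral_Ioo]
  congr 1
  have hne : ∀ y : ℝ, cutPoint (θ + y) ρ - p ≠ 0 := fun y => cutPoint_ne_of_norm_ne hρ h _
  have i1 : IntegrableOn (fun y : ℝ => stripIntegrand θ F p
      ((Real.log ρ : ℂ) + y * Complex.I)) (Ioo 0 (2 * Real.pi)) := by
    refine (ContinuousOn.integrableOn_Icc ?_).mono_set Ioo_subset_Icc_self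
    refine (continuousOn_stripIntegrand hF hp).comp (by fun_prop) fun y hy => ?_
    simpa using hy
  have i2 : IntegrableOn (fun y : ℝ => 1 / (cutPoint (θ + y) ρ - p) *
      ((ρ : ℂ) * Complex.exp ((θ + y : ℝ) * Complex.I))) (Ioo 0 (2 * Real.pi)) := by
    refine (Continuous.continuousOn ?_).integrableOn_Icc.mono_set Ioo_subset_Icc_self
    refine Continuous.mul (Continuous.div continuous_const ?_ hne) (by fun_prop)
    unfold cutPoint
    fun_prop
  rw [eq_sub_iff_add_eq, ← integral_const_mul, ← integral_add i1 (i2.const_mul _), circleEdge]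
  refine setIntegral_congr_fun measurableSet_Ioo fun y hy => ?_
  have e : stripMap θ ((Real.log ρ : ℂ) + y * Complex.I) = cutPoint (θ + y) ρ :=
    stripMap_log_add y hρ θ
  rw [stripIntegrand, stripSlope_eq (by rw [e]; exact sub_ne_zero.1 (hne y)),
    stripValue_of_mem (by simpa using hy.1) (by simpa using hy.2), e, exp_log_add_mul_I y hρ]
  have := hne y
  field_simp
  ring

theorem integral_comp_exp_mul {g : ℝ → ℂ} (hg : ContinuousOn g (Ioi 0)) {ε R : ℝ} (hε : 0 < ε)
    (hR : 0 < R) :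
    ∫ a in (Real.log ε)..(Real.log R), (Real.exp a : ℂ) * g (Real.exp a) = ∫ t in ε..R, g t := by
  have h := intervalIntegral.integral_deriv_smul_comp' (a := Real.log ε) (b := Real.log R)
    (f := Real.exp) (f' := Real.exp) (g := g) (fun x _ => Real.hasDerivAt_exp x)
    Real.continuous_exp.continuousOn
    (hg.mono (by rintro _ ⟨x, -, rfl⟩; exact Real.exp_pos x))
  rw [Real.exp_log hε, Real.exp_log hR] at h
  rw [← h]
  congr 1

/-- In logarithmic coordinates the keyhole contour is a rectangle. Its horizontal edges map to the
same points of the cut, so the F(p) terms cancel and the jump remains. The vertical edges are the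
circles of radius ε and R, around which the winding integrals are 0 and 2πi. -/
theorem contour_identity {θ : ℝ} {F : ℂ → ℂ} (hF : IsFunctionElement θ F) {p : ℂ}
    (hp : p ∈ (borelCut θ)ᶜ) {ε R : ℝ} (hε : 0 < ε) (hεp : ε < ‖p - 1‖) (hR : ‖p - 1‖ < R) :
    2 * Real.pi * Complex.I * F p =
      Complex.exp (θ * Complex.I) *
        (∫ t in ε..R, branchJump θ F t * (1 / (cutPoint θ t - p))) +
      Complex.I * circleEdge θ F p R - Complex.I * circleEdge θ F p ε := by
  have hpi := Real.pi_pos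
  have hR0 : 0 < R := hε.trans (hεp.trans hR)
  have hεR : ε ≤ R := (hεp.trans hR).le
  have hlog : Real.log ε ≤ Real.log R := Real.log_le_log hε hεR
  have hcut : ∀ t : ℝ, 0 < t → cutPoint θ t - p ≠ 0 := fun t ht h =>
    hp ⟨t, ht.le, (sub_eq_zero.1 h).symm⟩
  have hrect := Complex.integral_boundary_rect_eq_zero_of_continuousOn_of_differentiableOn
    (stripIntegrand θ F p) ⟨Real.log ε, 0⟩ ⟨Real.log R, 2 * Real.pi⟩
    ((continuousOn_stripIntegrand hF hp).mono fun v hv => by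
      have := hv.2
      rw [mem_preimage, uIcc_of_le (by positivity)] at this
      exact this)
    (fun v hv => by
      have := hv.2
      simp only [mem_preimage, min_eq_left (show (0 : ℝ) ≤ 2 * Real.pi by positivity),
        max_eq_right (show (0 : ℝ) ≤ 2 * Real.pi by positivity)] at this
      exact (differentiableAt_stripIntegrand hF hp this.1 this.2).differentiableWithinAt)
  simp only [smul_eq_mul] at hrect
  rw [circleEdge_eq hF hp hR0 hR.ne', circleEdge_eq hF hp hε hεp.ne] at hrect
  have hnorm : ‖(p - 1) * Complex.exp (-(θ * Complex.I))‖ = ‖p - 1‖ := by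
    have : -((θ : ℂ) * Complex.I) = ((-θ : ℝ) : ℂ) * Complex.I := by push_cast; ring
    rw [norm_mul, this, Complex.norm_exp_ofReal_mul_I, mul_one]
  have hout : (∮ z in C(0, R), (z - (p - 1) * Complex.exp (-(θ * Complex.I)))⁻¹) =
      2 * Real.pi * Complex.I := by
    refine circleIntegral.integral_sub_inv_of_mem_ball ?_
    rw [mem_ball_zero_iff, hnorm]
    exact hR
  have hin : (∮ z in C(0, ε), (z - (p - 1) * Complex.exp (-(θ * Complex.I)))⁻¹) = 0 := by
    have hne : ∀ z ∈ Metric.closedBall (0 : ℂ) ε,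
        z - (p - 1) * Complex.exp (-(θ * Complex.I)) ≠ 0 := fun z hz h0 => by
      rw [mem_closedBall_zero_iff, sub_eq_zero.1 h0, hnorm] at hz
      linarith
    refine Complex.circleIntegral_eq_zero_of_differentiable_on_off_countable hε.le
      countable_empty (ContinuousOn.inv₀ (by fun_prop) hne) fun z hz => ?_
    exact DifferentiableAt.inv (by fun_prop) (hne z (Metric.ball_subset_closedBall hz.1))
  rw [hout, hin] at hrect
  have c1 : Continuous fun a : ℝ => ((a : ℂ) + ((0 : ℝ) : ℂ) * Complex.I) := by fun_prop
  have c2 : Continuous fun a : ℝ => ((a : ℂ) + ((2 * Real.pi : ℝ) : ℂ) * Complex.I) := by fun_prop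
  have i1 : IntervalIntegrable (fun a : ℝ => stripIntegrand θ F p
      ((a : ℂ) + ((0 : ℝ) : ℂ) * Complex.I)) volume (Real.log ε) (Real.log R) := by
    refine ContinuousOn.intervalIntegrable ?_
    refine (continuousOn_stripIntegrand hF hp).comp c1.continuousOn fun a _ => ?_
    simp; positivity
  have i2 : IntervalIntegrable (fun a : ℝ => stripIntegrand θ F p
      ((a : ℂ) + ((2 * Real.pi : ℝ) : ℂ) * Complex.I)) volume (Real.log ε) (Real.log R) := by
    refine ContinuousOn.intervalIntegrable ?_
    refine (continuousOn_stripIntegrand hF hp).comp c2.continuousOn fun a _ => ?_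
    simp; positivity
  have hedge : (∫ a in (Real.log ε)..(Real.log R), stripIntegrand θ F p
        ((a : ℂ) + ((0 : ℝ) : ℂ) * Complex.I)) -
      (∫ a in (Real.log ε)..(Real.log R), stripIntegrand θ F p
        ((a : ℂ) + ((2 * Real.pi : ℝ) : ℂ) * Complex.I)) =
      Complex.exp (θ * Complex.I) *
        ∫ t in ε..R, branchJump θ F t * (1 / (cutPoint θ t - p)) := by
    have hg : ContinuousOn (fun t => branchJump θ F t * (1 / (cutPoint θ t - p))) (Ioi 0) := by
      refine hF.continuousOn_branchJump.mul (continuousOn_const.div ?_ fun t ht => hcut t ht)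
      unfold cutPoint
      fun_prop
    rw [← intervalIntegral.integral_sub i1 i2, ← integral_comp_exp_mul hg hε hR0,
      ← intervalIntegral.integral_const_mul]
    congr 1
    ext a
    have im1 : ((a : ℂ) + ((0 : ℝ) : ℂ) * Complex.I).im = 0 := by simp
    have im2 : ((a : ℂ) + ((2 * Real.pi : ℝ) : ℂ) * Complex.I).im = 2 * Real.pi := by simp
    have re1 : ((a : ℂ) + ((0 : ℝ) : ℂ) * Complex.I).re = a := by simp
    have re2 : ((a : ℂ) + ((2 * Real.pi : ℝ) : ℂ) * Complex.I).re = a := by simp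
    have s1 := stripMap_mem_borelCut θ (Or.inl im1)
    have s2 := stripMap_mem_borelCut θ (Or.inr im2)
    rw [re1] at s1
    rw [re2] at s2
    have hne := hcut _ (Real.exp_pos a)
    have hne' := sub_ne_zero.1 hne
    have ex : ∀ v : ℂ, Complex.exp (v + θ * Complex.I) = stripMap θ v - 1 := fun v => by
      rw [stripMap, add_sub_cancel_left]
    have hc1 : cutPoint θ (Real.exp a) - 1 = Real.exp a * Complex.exp (θ * Complex.I) := by
      rw [cutPoint, add_sub_cancel_left]
    rw [stripIntegrand, stripIntegrand, stripSlope_eq (by rw [s1]; exact hne'),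
      stripSlope_eq (by rw [s2]; exact hne'), ex, ex, s1, s2, stripValue, stripValue,
      if_pos im1.le, if_neg (by rw [im2]; linarith), if_pos im2.symm.le, re1, re2,
      branchJump_eq, hc1]
    field_simp
    ring
  rw [hedge] at hrect
  linear_combination -hrect

/-! ### The Cauchy formula -/

theorem sub_le_norm_cutPoint_sub (ω : ℝ) (p : ℂ) {ρ : ℝ} (hρ : 0 ≤ ρ) :
    ρ - ‖p - 1‖ ≤ ‖cutPoint ω ρ - p‖ := by
  have h := norm_sub_norm_le ((ρ : ℂ) * Complex.exp (ω * Complex.I)) (p - 1)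
  rw [norm_mul, Complex.norm_exp_ofReal_mul_I, mul_one, Complex.norm_of_nonneg hρ] at h
  have e : cutPoint ω ρ - p = (ρ : ℂ) * Complex.exp (ω * Complex.I) - (p - 1) := by
    rw [cutPoint]; ring
  rwa [e]

theorem sub_le_norm_cutPoint_sub' (ω : ℝ) (p : ℂ) {ρ : ℝ} (hρ : 0 ≤ ρ) :
    ‖p - 1‖ - ρ ≤ ‖cutPoint ω ρ - p‖ := by
  have h := norm_sub_norm_le (p - 1) ((ρ : ℂ) * Complex.exp (ω * Complex.I))
  rw [norm_mul, Complex.norm_exp_ofReal_mul_I, mul_one, Complex.norm_of_nonneg hρ] at h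
  have e : cutPoint ω ρ - p = -(p - 1 - (ρ : ℂ) * Complex.exp (ω * Complex.I)) := by
    rw [cutPoint]; ring
  rwa [e, norm_neg]

theorem norm_ofReal_mul_exp {ρ : ℝ} (hρ : 0 ≤ ρ) (ω : ℝ) :
    ‖(ρ : ℂ) * Complex.exp (ω * Complex.I)‖ = ρ := by
  rw [norm_mul, Complex.norm_exp_ofReal_mul_I, mul_one, Complex.norm_of_nonneg hρ]

theorem tendsto_circleEdge_atTop {θ : ℝ} {F : ℂ → ℂ} (hF : IsFunctionElement θ F) (p : ℂ) :
    Tendsto (circleEdge θ F p) atTop (𝓝 0) := by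
  obtain ⟨α, hα, C, R, hR, hdec⟩ := hF.decay
  have hlim : Tendsto (fun ρ : ℝ => |C| * (ρ / 2) ^ (-α) * 2 * (volume.real (Ioo 0 (2 * Real.pi))))
      atTop (𝓝 0) := by
    have h1 := (tendsto_rpow_neg_atTop (show 0 < α by linarith)).comp
      (tendsto_id.atTop_div_const (show (0 : ℝ) < 2 by norm_num))
    have h2 := ((h1.const_mul |C|).mul_const 2).mul_const (volume.real (Ioo 0 (2 * Real.pi)))
    simpa using h2
  refine squeeze_zero_norm' ?_ hlim
  filter_upwards [eventually_ge_atTop 2, eventually_ge_atTop (R + 1),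
    eventually_ge_atTop (2 * ‖p - 1‖)] with ρ h2 hR1 hp
  have hρ : 0 < ρ := by linarith
  refine norm_setIntegral_le_of_norm_le_const measure_Ioo_lt_top fun y hy => ?_
  have h3 := le_norm_cutPoint (θ + y) hρ.le
  have h4 := sub_le_norm_cutPoint_sub (θ + y) p hρ.le
  have h5 := hdec _ (cutPoint_notMem_borelCut θ hρ hy.1 hy.2) (by linarith)
  have h6 : ‖cutPoint (θ + y) ρ‖ ^ (-α) ≤ (ρ / 2) ^ (-α) :=
    Real.rpow_le_rpow_of_nonpos (by linarith) (by linarith) (by linarith)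
  have h7 : ‖F (cutPoint (θ + y) ρ)‖ ≤ |C| * (ρ / 2) ^ (-α) := by
    refine h5.trans ?_
    have := le_abs_self C
    gcongr
  have h8 : ρ / 2 ≤ ‖cutPoint (θ + y) ρ - p‖ := by linarith
  rw [norm_mul, norm_div, norm_ofReal_mul_exp hρ.le]
  calc _ ≤ |C| * (ρ / 2) ^ (-α) / (ρ / 2) * ρ := by gcongr
    _ = _ := by field_simp

/-- Tonelli: the bound on rays is uniform in the angle and the range of angles is finite. -/
theorem IsFunctionElement.lintegral_circle_lt_top {θ : ℝ} {F : ℂ → ℂ}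
    (hF : IsFunctionElement θ F) : ∃ δ : ℝ, 0 < δ ∧
      ∫⁻ r in Ioo (0 : ℝ) δ, ∫⁻ y in Ioo (0 : ℝ) (2 * Real.pi), ‖F (cutPoint (θ + y) r)‖ₑ < ⊤ := by
  obtain ⟨δ, hδ, K, hK⟩ := hF.integrable_branch
  refine ⟨δ, hδ, ?_⟩
  have hcont : ContinuousOn (fun a : ℝ × ℝ => F (cutPoint (θ + a.2) a.1))
      (Ioo 0 δ ×ˢ Ioo 0 (2 * Real.pi)) := by
    intro a ha
    have hc : ContinuousAt (fun a : ℝ × ℝ => cutPoint (θ + a.2) a.1) a := by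
      unfold cutPoint; fun_prop
    exact (ContinuousAt.comp (g := F) (f := fun a : ℝ × ℝ => cutPoint (θ + a.2) a.1) (x := a)
      (hF.analytic _ (cutPoint_notMem_borelCut θ ha.1.1 ha.2.1
      ha.2.2)).continuousAt hc).continuousWithinAt
  have hmeas : AEMeasurable (Function.uncurry fun r y : ℝ => ‖F (cutPoint (θ + y) r)‖ₑ)
      ((volume.restrict (Ioo 0 δ)).prod (volume.restrict (Ioo 0 (2 * Real.pi)))) := by
    rw [Measure.prod_restrict]
    exact (hcont.aestronglyMeasurable (measurableSet_Ioo.prod measurableSet_Ioo)).enorm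
  rw [lintegral_lintegral_swap hmeas]
  have : ∫⁻ y in Ioo (0 : ℝ) (2 * Real.pi), ∫⁻ r in Ioo (0 : ℝ) δ, ‖F (cutPoint (θ + y) r)‖ₑ ≤
      ∫⁻ _ in Ioo (0 : ℝ) (2 * Real.pi), (K : ENNReal) := by
    refine setLIntegral_mono' measurableSet_Ioo fun y hy => ?_
    exact hK (θ + y) ⟨by linarith [hy.1], by linarith [hy.2]⟩
  refine this.trans_lt ?_
  rw [setLIntegral_const, Real.volume_Ioo]
  exact ENNReal.mul_lt_top ENNReal.coe_lt_top ENNReal.ofReal_lt_top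

/-- Near the branch point |s - p| ≥ d/2, so the circle integral is at most (2ρ/d) times the angular
integral of |F|. A limit L ≠ 0 would force the latter to be at least κ/ρ for small ρ, and 1/ρ is not
integrable at 0. -/
theorem circleEdge_limit_eq_zero {θ : ℝ} {F : ℂ → ℂ} (hF : IsFunctionElement θ F) {p L : ℂ}
    (hp : p ≠ 1) (hL : Tendsto (circleEdge θ F p) (𝓝[>] 0) (𝓝 L)) : L = 0 := by
  by_contra hL0
  have hpos : 0 < ‖L‖ := norm_pos_iff.2 hL0
  have hd : 0 < ‖p - 1‖ := norm_pos_iff.2 (sub_ne_zero.2 hp)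
  set d := ‖p - 1‖
  set κ := ‖L‖ / 2 * (d / 2) with hκ
  have hκ0 : 0 < κ := by positivity
  have hev : ∀ᶠ ρ in 𝓝[>] (0 : ℝ), ENNReal.ofReal (κ * ρ⁻¹) ≤
      ∫⁻ y in Ioo (0 : ℝ) (2 * Real.pi), ‖F (cutPoint (θ + y) ρ)‖ₑ := by
    filter_upwards [hL.norm.eventually_const_lt (half_lt_self hpos), self_mem_nhdsWithin,
      nhdsWithin_le_nhds (Iio_mem_nhds (show 0 < d / 2 by positivity))] with ρ h1 h2 h3
    have hρ : 0 < ρ := h2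
    have hρd : ρ < d / 2 := h3
    have h4 : ‖circleEdge θ F p ρ‖ₑ ≤ ∫⁻ y in Ioo (0 : ℝ) (2 * Real.pi),
        ENNReal.ofReal (ρ / (d / 2)) * ‖F (cutPoint (θ + y) ρ)‖ₑ := by
      refine (enorm_integral_le_lintegral_enorm _).trans ?_
      refine setLIntegral_mono' measurableSet_Ioo fun y hy => ?_
      rw [← ofReal_norm, ← ofReal_norm, ← ENNReal.ofReal_mul (by positivity)]
      refine ENNReal.ofReal_le_ofReal ?_
      rw [norm_mul, norm_div, norm_ofReal_mul_exp hρ.le]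
      have h5 := sub_le_norm_cutPoint_sub' (θ + y) p hρ.le
      have h6 : d / 2 ≤ ‖cutPoint (θ + y) ρ - p‖ := by
        change d - ρ ≤ _ at h5
        linarith
      calc _ ≤ ‖F (cutPoint (θ + y) ρ)‖ / (d / 2) * ρ := by gcongr
        _ = _ := by ring
    rw [lintegral_const_mul' _ _ ENNReal.ofReal_ne_top] at h4
    have h5 : ENNReal.ofReal (‖L‖ / 2) ≤ ‖circleEdge θ F p ρ‖ₑ := by
      rw [← ofReal_norm]
      exact ENNReal.ofReal_le_ofReal h1.le
    have h6 : ENNReal.ofReal (κ * ρ⁻¹) =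
        ENNReal.ofReal ((ρ / (d / 2))⁻¹) * ENNReal.ofReal (‖L‖ / 2) := by
      rw [← ENNReal.ofReal_mul (by positivity), hκ]
      congr 1
      field_simp
    rw [h6]
    refine (mul_le_mul_right (h5.trans h4) _).trans ?_
    rw [← mul_assoc, ← ENNReal.ofReal_mul (by positivity), inv_mul_cancel₀ (by positivity),
      ENNReal.ofReal_one, one_mul]
  obtain ⟨ε₀, hε₀, hsub⟩ := mem_nhdsGT_iff_exists_Ioo_subset.1 hev
  obtain ⟨δ, hδ, hfin⟩ := hF.lintegral_circle_lt_top
  set η := min ε₀ δ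
  have hη : 0 < η := lt_min hε₀ hδ
  have hlt : ∫⁻ ρ in Ioo (0 : ℝ) η, ENNReal.ofReal (κ * ρ⁻¹) < ⊤ := by
    refine lt_of_le_of_lt ?_ hfin
    refine (setLIntegral_mono' measurableSet_Ioo fun ρ hρ =>
      hsub ⟨hρ.1, hρ.2.trans_le (min_le_left _ _)⟩).trans ?_
    exact lintegral_mono_set (Ioo_subset_Ioo_right (min_le_right _ _))
  have hint : IntegrableOn (fun ρ : ℝ => κ * ρ⁻¹) (Ioo 0 η) := by
    refine ⟨Measurable.aestronglyMeasurable (by fun_prop), ?_⟩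
    rw [hasFiniteIntegral_iff_ofReal]
    · exact hlt
    · filter_upwards [ae_restrict_mem measurableSet_Ioo] with ρ hρ
      have := hρ.1
      positivity
  have hint2 : IntervalIntegrable (fun ρ : ℝ => ρ⁻¹) volume 0 η := by
    rw [intervalIntegrable_iff_integrableOn_Ioo_of_le hη.le]
    have := hint.const_mul κ⁻¹
    refine this.congr (Eventually.of_forall fun ρ => ?_)
    simp only
    field_simp
  rcases intervalIntegrable_inv_iff.1 hint2 with h | h
  · exact hη.ne h
  · exact h (by rw [uIcc_of_le hη.le]; exact ⟨le_rfl, hη.le⟩)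

/-- First R → ∞. In the resulting identity everything except the small circle converges as ε → 0, so
the small circle has a limit too, and that limit must vanish. -/
theorem IsFunctionElement.cauchy_formula {θ : ℝ} {F : ℂ → ℂ} (hF : IsFunctionElement θ F) {p : ℂ}
    (hp : p ∈ (borelCut θ)ᶜ) :
    F p = cauchyFactor θ * ∫ t in Ioi (0 : ℝ), branchJump θ F t * (1 / (cutPoint θ t - p)) := by
  have hp1 : p ≠ 1 := by
    rintro rfl
    exact hp ⟨0, le_rfl, by simp [cutPoint]⟩
  have hd : 0 < ‖p - 1‖ := norm_pos_iff.2 (sub_ne_zero.2 hp1)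
  obtain ⟨d, hd0, hball⟩ := Metric.isOpen_iff.1 (isClosed_borelCut θ).isOpen_compl p hp
  have hint : IntegrableOn (fun t => branchJump θ F t * (1 / (cutPoint θ t - p))) (Ioi 0) := by
    have := measurable_cutPoint θ
    refine Integrable.mul_bdd (c := 1 / d) hF.integrableOn_branchJump
      (Measurable.aestronglyMeasurable (by fun_prop)) ?_
    filter_upwards [ae_restrict_mem measurableSet_Ioi] with t ht
    have : d ≤ ‖cutPoint θ t - p‖ := by
      by_contra hlt
      exact hball (by simpa [dist_eq_norm] using hlt) ⟨t, le_of_lt ht, rfl⟩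
    rw [norm_div, norm_one]
    gcongr
  have hout : ∀ ε : ℝ, 0 < ε → ε < ‖p - 1‖ → 2 * Real.pi * Complex.I * F p =
      Complex.exp (θ * Complex.I) *
        (∫ t in Ioi ε, branchJump θ F t * (1 / (cutPoint θ t - p))) -
      Complex.I * circleEdge θ F p ε := by
    intro ε hε hεp
    have h1 := intervalIntegral_tendsto_integral_Ioi ε
      (hint.mono_set (Ioi_subset_Ioi hε.le)) tendsto_id
    have h2 := ((h1.const_mul (Complex.exp (θ * Complex.I))).add
      ((tendsto_circleEdge_atTop hF p).const_mul Complex.I)).sub_const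
        (Complex.I * circleEdge θ F p ε)
    rw [mul_zero, add_zero] at h2
    refine tendsto_nhds_unique (tendsto_const_nhds.congr' ?_) h2
    filter_upwards [eventually_gt_atTop ‖p - 1‖] with R hR
    exact contour_identity hF hp hε hεp hR
  have h1 : Tendsto (fun ε : ℝ => ∫ t in Ioi ε, branchJump θ F t * (1 / (cutPoint θ t - p)))
      (𝓝[>] 0) (𝓝 (∫ t in Ioi (0 : ℝ), branchJump θ F t * (1 / (cutPoint θ t - p)))) := by
    have hc := aecover_Ioi_of_Ioi (μ := volume) (A := (0 : ℝ)) (a := fun ε : ℝ => ε)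
      (l := 𝓝[>] (0 : ℝ)) (tendsto_id.mono_left nhdsWithin_le_nhds)
    have h2 := hc.integral_tendsto_of_countably_generated hint
    refine h2.congr' ?_
    filter_upwards [self_mem_nhdsWithin] with ε hε
    rw [Measure.restrict_restrict measurableSet_Ioi,
      inter_eq_left.2 (Ioi_subset_Ioi (le_of_lt hε))]
  have h2 : Tendsto (circleEdge θ F p) (𝓝[>] 0) (𝓝 (Complex.I⁻¹ *
      (Complex.exp (θ * Complex.I) * (∫ t in Ioi (0 : ℝ),
        branchJump θ F t * (1 / (cutPoint θ t - p))) - 2 * Real.pi * Complex.I * F p))) := by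
    refine (((h1.const_mul (Complex.exp (θ * Complex.I))).sub_const
      (2 * Real.pi * Complex.I * F p)).const_mul Complex.I⁻¹).congr' ?_
    filter_upwards [self_mem_nhdsWithin, nhdsWithin_le_nhds (Iio_mem_nhds hd)] with ε h3 h4
    rw [hout ε h3 h4, sub_sub_cancel, inv_mul_cancel_left₀ Complex.I_ne_zero]
  have h3 := circleEdge_limit_eq_zero hF hp1 h2
  have h4 := (mul_eq_zero.1 h3).resolve_left (inv_ne_zero Complex.I_ne_zero)
  rw [cauchyFactor, div_mul_eq_mul_div, eq_div_iff Complex.two_pi_I_ne_zero]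
  linear_combination -h4

/-! ### The Laplace transform of a function element -/

theorem IsFunctionElement.continuousOn_rayPoint {θ φ : ℝ} {F : ℂ → ℂ} (hF : IsFunctionElement θ F)
    (hφ : ∀ r : ℝ, 0 ≤ r → rayPoint φ r ∉ borelCut θ) :
    ContinuousOn (fun r => F (rayPoint φ r)) (Ici 0) := by
  intro r hr
  have hc : ContinuousAt (rayPoint φ) r := by unfold rayPoint; fun_prop
  exact (ContinuousAt.comp (g := F) (hF.analytic _ (hφ r hr)).continuousAt hc).continuousWithinAt

theorem IsFunctionElement.exists_norm_rayPoint_le {θ φ : ℝ} {F : ℂ → ℂ}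
    (hF : IsFunctionElement θ F) (hφ : ∀ r : ℝ, 0 ≤ r → rayPoint φ r ∉ borelCut θ) :
    ∃ M : ℝ, ∀ r : ℝ, 0 ≤ r → ‖F (rayPoint φ r)‖ ≤ M := by
  obtain ⟨α, hα, C, R, hR, hdec⟩ := hF.decay
  obtain ⟨M, hM⟩ := isCompact_Icc.exists_bound_of_continuousOn
    ((hF.continuousOn_rayPoint hφ).mono (Icc_subset_Ici_self : Icc 0 R ⊆ _))
  refine ⟨max M (|C| * R ^ (-α)), fun r hr => ?_⟩
  by_cases h : r ≤ R
  · exact (hM r ⟨hr, h⟩).trans (le_max_left _ _)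
  · have hn : ‖rayPoint φ r‖ = r := by
      rw [rayPoint, norm_mul, Complex.norm_exp_ofReal_mul_I, mul_one, Complex.norm_of_nonneg hr]
    have hRr : R ≤ r := (not_le.1 h).le
    refine (hdec _ (hφ r hr) (hn.symm ▸ hRr)).trans (le_trans ?_ (le_max_right _ _))
    have h1 : ‖rayPoint φ r‖ ^ (-α) ≤ R ^ (-α) := by
      rw [hn]
      exact Real.rpow_le_rpow_of_nonpos hR hRr (by linarith)
    have := le_abs_self C
    gcongr

theorem IsFunctionElement.integrableOn_laplaceIntegrand {θ φ : ℝ} {F : ℂ → ℂ}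
    (hF : IsFunctionElement θ F) (hφ : ∀ r : ℝ, 0 ≤ r → rayPoint φ r ∉ borelCut θ) {x : ℂ}
    (hx : 0 < (x * Complex.exp (φ * Complex.I)).re) :
    IntegrableOn (laplaceIntegrand φ F x) (Ioi 0) := by
  obtain ⟨M, hM⟩ := hF.exists_norm_rayPoint_le hφ
  exact _root_.integrableOn_laplaceIntegrand hx
    (((hF.continuousOn_rayPoint hφ).mono Ioi_subset_Ici_self).aestronglyMeasurable
      measurableSet_Ioi) (fun r hr => hM r hr.le)

theorem isOpen_halfPlane (φ : ℝ) : IsOpen {x : ℂ | 0 < (x * Complex.exp (φ * Complex.I)).re} :=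
  isOpen_lt continuous_const (by fun_prop)

theorem IsFunctionElement.differentiableOn_laplaceRay {θ φ : ℝ} {F : ℂ → ℂ}
    (hF : IsFunctionElement θ F) (hφ : ∀ r : ℝ, 0 ≤ r → rayPoint φ r ∉ borelCut θ) :
    DifferentiableOn ℂ (laplaceRay φ F) {x : ℂ | 0 < (x * Complex.exp (φ * Complex.I)).re} := by
  intro x₀ hx₀
  obtain ⟨M, hM⟩ := hF.exists_norm_rayPoint_le hφ
  have hM0 : 0 ≤ M := (norm_nonneg _).trans (hM 0 le_rfl)
  set c := (x₀ * Complex.exp (φ * Complex.I)).re with hc_def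
  have hc : 0 < c := hx₀
  have hs : {x : ℂ | c / 2 < (x * Complex.exp (φ * Complex.I)).re} ∈ 𝓝 x₀ :=
    (isOpen_lt continuous_const (by fun_prop)).mem_nhds (half_lt_self hc)
  have hi : ∀ {x : ℂ}, c / 2 < (x * Complex.exp (φ * Complex.I)).re →
      IntegrableOn (laplaceIntegrand φ F x) (Ioi 0) := fun {x} hx =>
    hF.integrableOn_laplaceIntegrand hφ (by linarith)
  have hd := hasDerivAt_integral_of_dominated_loc_of_deriv_le (μ := volume.restrict (Ioi (0 : ℝ)))
    (F := fun x r => laplaceIntegrand φ F x r)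
    (F' := fun x r => -rayPoint φ r * laplaceIntegrand φ F x r)
    (bound := fun r => 4 / c * M * Real.exp (-(r * (c / 4)))) hs
    (by filter_upwards [hs] with x hx using (hi hx).aestronglyMeasurable)
    (hi (half_lt_self hc))
    ((measurable_rayPoint φ).neg.aestronglyMeasurable.mul (hi (half_lt_self hc)).aestronglyMeasurable)
    ?_ ((integrableOn_exp_neg_mul_re (by positivity)).const_mul _) ?_
  · exact hd.2.differentiableAt.differentiableWithinAt
  · filter_upwards [ae_restrict_mem measurableSet_Ioi] with r hr x hx
    have hr0 : 0 < r := hr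
    have hn : ‖rayPoint φ r‖ = r := by
      rw [rayPoint, norm_mul, Complex.norm_exp_ofReal_mul_I, mul_one,
        Complex.norm_of_nonneg hr0.le]
    rw [norm_mul, norm_neg, hn, norm_laplaceIntegrand]
    have h1 : Real.exp (-(r * (x * Complex.exp (φ * Complex.I)).re)) ≤
        Real.exp (-(r * (c / 4))) * Real.exp (-(r * (c / 4))) := by
      rw [← Real.exp_add, Real.exp_le_exp]
      have : r * (c / 2) ≤ r * (x * Complex.exp (φ * Complex.I)).re := by
        have : c / 2 < (x * Complex.exp (φ * Complex.I)).re := hx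
        gcongr
      linarith
    -- Differentiation brings down a factor r. Half of the available decay absorbs it, through 1 + u
    -- ≤ e^u; the other half remains as the integrable majorant.
    have h2 : r * Real.exp (-(r * (c / 4))) ≤ 4 / c := by
      have h3 := Real.add_one_le_exp (r * (c / 4))
      rw [Real.exp_neg, ← div_eq_mul_inv, div_le_div_iff₀ (Real.exp_pos _) hc]
      linarith
    have h4 := hM r hr0.le
    calc _ ≤ r * (Real.exp (-(r * (c / 4))) * Real.exp (-(r * (c / 4))) * M) := by gcongr
      _ = r * Real.exp (-(r * (c / 4))) * M * Real.exp (-(r * (c / 4))) := by ring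
      _ ≤ _ := by gcongr
  · refine Eventually.of_forall fun r x _ => ?_
    have d1 : HasDerivAt (fun x : ℂ => -x * rayPoint φ r) (-1 * rayPoint φ r) x :=
      (hasDerivAt_id x).neg.mul_const _
    have d2 := (d1.cexp.mul_const (F (rayPoint φ r))).mul_const (Complex.exp (φ * Complex.I))
    refine d2.congr_deriv ?_
    rw [laplaceIntegrand]
    ring

/-! ### Bounds and asymptotics of the remainders on the cut. -/

namespace AdmissibleParameter

variable {β : ℂ} {b θ : ℝ}

theorem of_polar (hβ : β ≠ 0) (hb : β = (‖β‖ : ℂ) * Complex.exp (b * Complex.I))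
    (hbmem : b ∈ Icc (Real.pi / 2) (3 * Real.pi / 2)) (hcβ : 0 < cBeta β)
    (hβpi : ‖β‖ ≤ Real.pi) (hbθ : ∃ j : ℤ, b + θ = Real.pi + 2 * Real.pi * j) :
    AdmissibleParameter β b θ where
  ne_zero := hβ
  polar := hb
  re_nonpos := by
    rw [hb, Complex.re_ofReal_mul, Complex.exp_ofReal_mul_I_re]
    exact mul_nonpos_of_nonneg_of_nonpos (norm_nonneg _)
      (Real.cos_nonpos_of_pi_div_two_le_of_le hbmem.1 (by linarith [hbmem.2]))
  cBeta_pos := hcβ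
  norm_le_pi := hβpi
  exp_theta := by
    obtain ⟨j, hj⟩ := hbθ
    have : (θ : ℂ) * Complex.I =
        -(b * Complex.I) + Real.pi * Complex.I + j * (2 * Real.pi * Complex.I) := by
      have : θ = Real.pi + 2 * Real.pi * j - b := by linarith
      rw [this]; push_cast; ring
    rw [this, Complex.exp_add, Complex.exp_add, Complex.exp_int_mul_two_pi_mul_I,
      Complex.exp_pi_mul_I]
    ring

theorem norm_rhoZero_le (h : AdmissibleParameter β b θ) {c₀ : ℝ}
    (hc : IsDenominatorBound β θ (-b) c₀) {x : ℂ} (hx : 0 < (x / β).re) {t : ℝ} (ht : 0 ≤ t)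
    (n : ℕ) : ‖rhoZero β θ n x t‖ ≤
      cOne β ^ n / c₀ * (1 / (x / β).re) * ((n.factorial : ℝ) / ‖poch (x / β) n‖) := by
  refine norm_lerchTail_le (cOne_lt_one h.cBeta_pos) hc.1 (fun q hq => ?_)
    (fun q hq => h.norm_exp_le_zero ht hq) hx n
  -- On the ray φ = -b this radius makes βp = q, so the denominator bound is the one required for
  -- the Lerch integral.
  have h1 := (hc.2 t (q / ‖β‖) ht (by positivity)).1
  rw [neg_mul, h.mul_rayPoint_neg, div_mul_cancel₀ _ h.norm_pos.ne'] at h1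
  exact h1.le

theorem norm_rhoDyadic_le (h : AdmissibleParameter β b θ) {c₀ : ℝ}
    (hc : IsDenominatorBound β θ (-b) c₀) {x : ℂ} (hx : 0 < (x / β).re) {t : ℝ} (ht : 0 ≤ t)
    (l : ℕ) {k : ℕ} (hk : 1 ≤ k) : ‖rhoDyadic β θ l k x t‖ ≤
      cOne β ^ l / c₀ * (1 / 2 ^ k) * (1 / (x / β).re) *
        ((l.factorial : ℝ) / ‖poch (2 ^ k * x / β) l‖) := by
  have hre : (2 ^ k * x / β).re = 2 ^ k * (x / β).re := by
    have : 2 ^ k * x / β = ((2 ^ k : ℝ) : ℂ) * (x / β) := by push_cast; ring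
    rw [this, Complex.re_ofReal_mul]
  have h2 := norm_lerchTail_le (w := -Complex.exp (β * cutPoint θ t / 2 ^ k))
    (y := 2 ^ k * x / β) (cOne_lt_one h.cBeta_pos) hc.1 (fun q hq => ?_)
    (fun q hq => h.norm_exp_le_dyadic hk ht hq) (by rw [hre]; positivity) l
  · rw [← zDyadic_eq, hre] at h2
    refine h2.trans_eq ?_
    ring
  · have h1 := (hc.2 t (q * 2 ^ k / ‖β‖) ht (by positivity)).2 k hk
    rw [neg_mul, h.mul_rayPoint_neg, div_mul_cancel₀ _ h.norm_pos.ne', neg_div] at h1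
    push_cast at h1
    rw [mul_div_cancel_right₀ _ (pow_ne_zero _ two_ne_zero)] at h1
    rw [neg_mul, sub_neg_eq_add]
    exact h1.le

theorem rhoZero_asymptotic (h : AdmissibleParameter β b θ) {x : ℂ} (hx : x ∈ laplaceDomain b)
    {ε : ℝ} (hε : 0 < ε) : ∀ᶠ n : ℕ in atTop, ∀ t : ℝ, 0 ≤ t → ∃ e : ℂ, ‖e‖ ≤ ε ∧
      rhoZero β θ n x t =
        Complex.exp (β * cutPoint θ t * (n : ℂ)) * ((n - 1).factorial : ℂ) /
          ((Complex.exp (β * cutPoint θ t) - 1) ^ n * poch (x / β) n) * (1 + e) := by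
  filter_upwards [lerchTail_asymptotic (cOne_pos β).le (cOne_lt_one h.cBeta_pos)
    (add_natCast_ne_zero_of_mem_slitPlane (h.div_mem_slitPlane hx)) hε] with n hn t ht
  obtain ⟨e, he, heq⟩ := hn _ (h.norm_zZero_le ht)
  refine ⟨e, he, ?_⟩
  rw [rhoZero, heq, zZero, div_pow, ← Complex.exp_nat_mul, mul_comm (n : ℂ)]
  ring

theorem rhoDyadic_asymptotic (h : AdmissibleParameter β b θ) {x : ℂ} (hx : x ∈ laplaceDomain b)
    {k : ℕ} (hk : 1 ≤ k) {ε : ℝ} (hε : 0 < ε) :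
    ∀ᶠ l : ℕ in atTop, ∀ t : ℝ, 0 ≤ t → ∃ e : ℂ, ‖e‖ ≤ ε ∧
      rhoDyadic β θ l k x t =
        Complex.exp (β * cutPoint θ t * (l : ℂ) / 2 ^ k) * ((l - 1).factorial : ℂ) /
          ((Complex.exp (β * cutPoint θ t / 2 ^ k) + 1) ^ l * poch (2 ^ k * x / β) l) *
          (1 + e) := by
  filter_upwards [lerchTail_asymptotic (cOne_pos β).le (cOne_lt_one h.cBeta_pos)
    (add_natCast_ne_zero_of_mem_slitPlane (h.two_pow_mul_div_mem_slitPlane hx k)) hε] with l hl t ht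
  obtain ⟨e, he, heq⟩ := hl _ (h.norm_zDyadic_le hk ht)
  refine ⟨e, he, ?_⟩
  have e1 : (l : ℂ) * (β * cutPoint θ t / 2 ^ k) = β * cutPoint θ t * (l : ℂ) / 2 ^ k := by ring
  rw [rhoDyadic, heq, zDyadic, div_pow, ← Complex.exp_nat_mul, e1]
  ring

end AdmissibleParameter

end

/-! ### Assembly. -/

theorem theorem6 (β : ℂ) (b θ : ℝ) (hβ : β ≠ 0)
    (hb : β = (‖β‖ : ℂ) * Complex.exp (b * Complex.I))
    (hbmem : b ∈ Icc (Real.pi / 2) (3 * Real.pi / 2))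
    (hcβ : 0 < cBeta β) (hβpi : ‖β‖ ≤ Real.pi)
    (hθ : θ ∈ Icc (-(Real.pi / 2)) (Real.pi / 2))
    (hbθ : ∃ j : ℤ, b + θ = Real.pi + 2 * Real.pi * j)
    (F : ℂ → ℂ) (hF : IsFunctionElement θ F) :
    -- the Laplace transform, with its analytic continuation to the cut plane
    ∃ f : ℂ → ℂ, AnalyticOnNhd ℂ f (laplaceDomain b) ∧
      (∀ x : ℂ, 0 < (x * Complex.exp (-(b * Complex.I))).re →
        IntegrableOn (laplaceIntegrand (-b) F x) (Ioi 0) ∧ f x = laplaceRay (-b) F x) ∧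
    -- the jump and the coefficients are given by convergent integrals
      IntegrableOn (branchJump θ F) (Ioi 0) ∧
      (∀ m : ℕ, 1 ≤ m → IntegrableOn (coeffZeroIntegrand β θ F m) (Ioi 0)) ∧
      (∀ m k : ℕ, 1 ≤ m → 1 ≤ k → IntegrableOn (coeffIntegrand β θ F m k) (Ioi 0)) ∧
    -- the series and the integrals that define the remainders converge
      (∀ x ∈ laplaceDomain b, ∀ t : ℝ, 0 ≤ t →
        Summable (lerchTerm (zZero β θ t) (x / β)) ∧
        ∀ k : ℕ, 1 ≤ k → Summable (lerchTerm (zDyadic β θ k t) (2 ^ k * x / β))) ∧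
      (∀ x : ℂ, ∀ φ : ℝ, |φ + b| < Real.pi / 2 → 0 < (x * Complex.exp (φ * Complex.I)).re →
        ∀ N : ℕ, 1 ≤ N → ∀ t : ℝ, 0 ≤ t →
          IntegrableOn
            (laplaceIntegrand φ (fun p => kernelRemainder β N p (cutPoint θ t)) x) (Ioi 0)) ∧
    -- the dyadic expansion with remainder
      (∀ x ∈ laplaceDomain b, ∀ φ : ℝ, |φ + b| < Real.pi / 2 →
        0 < (x * Complex.exp (φ * Complex.I)).re → ∀ n N l : ℕ, 1 ≤ N →
          IntegrableOn (remainderIntegrand β θ φ F n N l x) (Ioi 0) ∧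
          f x = ∑ m ∈ Finset.Icc 1 n,
                ((m - 1).factorial : ℂ) / poch (x / β) m * coeffZero β θ F m +
              ∑ k ∈ Finset.Icc 1 (N - 1), ∑ m ∈ Finset.Icc 1 l,
                ((m - 1).factorial : ℂ) / poch (2 ^ k * x / β) m * coeff β θ F m k +
              totalRemainder β θ φ F n N l x) ∧
    -- `ρ_{ℓ,k}(t)` for large `ℓ`, with `o(1)` uniform in `t`
      (∀ x ∈ laplaceDomain b, ∀ k : ℕ, 1 ≤ k → ∀ ε : ℝ, 0 < ε → ∀ᶠ l : ℕ in atTop,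
        ∀ t : ℝ, 0 ≤ t → ∃ e : ℂ, ‖e‖ ≤ ε ∧
          rhoDyadic β θ l k x t =
            Complex.exp (β * cutPoint θ t * (l : ℂ) / 2 ^ k) * ((l - 1).factorial : ℂ) /
              ((Complex.exp (β * cutPoint θ t / 2 ^ k) + 1) ^ l * poch (2 ^ k * x / β) l) *
              (1 + e)) ∧
    -- `ρ_{n,0}(t)` for large `n`, with `o(1)` uniform in `t`
      (∀ x ∈ laplaceDomain b, ∀ ε : ℝ, 0 < ε → ∀ᶠ n : ℕ in atTop,
        ∀ t : ℝ, 0 ≤ t → ∃ e : ℂ, ‖e‖ ≤ ε ∧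
          rhoZero β θ n x t =
            Complex.exp (β * cutPoint θ t * (n : ℂ)) * ((n - 1).factorial : ℂ) /
              ((Complex.exp (β * cutPoint θ t) - 1) ^ n * poch (x / β) n) *
              (1 + e)) ∧
    -- the bound of `R_N(t)`
      (∀ φ : ℝ, |φ + b| < Real.pi / 2 → ∃ c₀ : ℝ, IsDenominatorBound β θ φ c₀) ∧
      (∀ φ : ℝ, |φ + b| < Real.pi / 2 → ∀ c₀ : ℝ, IsDenominatorBound β θ φ c₀ →
        ∀ x : ℂ, 0 < (x * Complex.exp (φ * Complex.I)).re →
        ∀ N : ℕ, 1 ≤ N → ∀ t : ℝ, 0 ≤ t →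
          ‖dyadicRemainder β θ φ N x t‖ ≤
            1 / 2 ^ (N - 1) * (‖β‖ / c₀) * (1 / (x * Complex.exp (φ * Complex.I)).re)) ∧
    -- the bounds of `ρ_{n,0}(t)` and `ρ_{ℓ,k}(t)` for any `n` and `ℓ`
      (∀ c₀ : ℝ, IsDenominatorBound β θ (-b) c₀ → ∀ x : ℂ, 0 < (x / β).re →
        ∀ t : ℝ, 0 ≤ t →
          (∀ n : ℕ, ‖rhoZero β θ n x t‖ ≤
            cOne β ^ n / c₀ * (1 / (x / β).re) * ((n.factorial : ℝ) / ‖poch (x / β) n‖)) ∧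
          (∀ l k : ℕ, 1 ≤ k → ‖rhoDyadic β θ l k x t‖ ≤
            cOne β ^ l / c₀ * (1 / 2 ^ k) * (1 / (x / β).re) *
              ((l.factorial : ℝ) / ‖poch (2 ^ k * x / β) l‖))) ∧
    -- absolute convergence of the double series, with sum `f`
      (∀ x ∈ laplaceDomain b,
        Summable (fun m : ℕ => ‖(m.factorial : ℂ) / poch (x / β) (m + 1) *
          coeffZero β θ F (m + 1)‖) ∧
        Summable (fun q : ℕ × ℕ => ‖(q.2.factorial : ℂ) / poch (2 ^ (q.1 + 1) * x / β) (q.2 + 1) *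
          coeff β θ F (q.2 + 1) (q.1 + 1)‖) ∧
        f x = ∑' m : ℕ, (m.factorial : ℂ) / poch (x / β) (m + 1) * coeffZero β θ F (m + 1) +
          ∑' q : ℕ × ℕ, (q.2.factorial : ℂ) / poch (2 ^ (q.1 + 1) * x / β) (q.2 + 1) *
            coeff β θ F (q.2 + 1) (q.1 + 1)) := by
  have h : AdmissibleParameter β b θ := .of_polar hβ hb hbmem hcβ hβpi hbθ
  have hJ := hF.integrableOn_branchJump
  have hray : ∀ {φ : ℝ}, |φ + b| < Real.pi / 2 → ∀ r : ℝ, 0 ≤ r → rayPoint φ r ∉ borelCut θ :=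
    fun hφ r hr => h.rayPoint_notMem_borelCut hφ hr
  -- Defining `f` by the series, which mentions no φ, makes the Laplace integrals in different
  -- directions agree without any rotation of contours.
  let f : ℂ → ℂ := fun x =>
    ∑' m : ℕ, (m.factorial : ℂ) / poch (x / β) (m + 1) * coeffZero β θ F (m + 1) +
      ∑' q : ℕ × ℕ, (q.2.factorial : ℂ) / poch (2 ^ (q.1 + 1) * x / β) (q.2 + 1) *
        coeff β θ F (q.2 + 1) (q.1 + 1)
  have hfR : ∀ {φ : ℝ}, |φ + b| < Real.pi / 2 → ∀ {x : ℂ},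
      0 < (x * Complex.exp (φ * Complex.I)).re → f x = totalRemainder β θ φ F 0 1 0 x :=
    fun hφ x hx => (h.factorialSeries hJ hφ hx).2.2.symm
  have hfL : ∀ {φ : ℝ}, |φ + b| < Real.pi / 2 → ∀ {x : ℂ},
      0 < (x * Complex.exp (φ * Complex.I)).re → f x = laplaceRay φ F x := fun hφ x hx => by
    rw [hfR hφ hx, h.laplaceRay_eq_totalRemainder hJ (fun p hp => hF.cauchy_formula hp) hφ hx]
  refine ⟨f, ?_, ?_, hJ, fun m hm => h.integrableOn_coeffZeroIntegrand hJ hm,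
    fun m k hm hk => h.integrableOn_coeffIntegrand hJ hm hk, ?_, ?_, ?_,
    fun x hx k hk ε hε => h.rhoDyadic_asymptotic hx hk hε,
    fun x hx ε hε => h.rhoZero_asymptotic hx hε,
    fun φ hφ => h.exists_isDenominatorBound hφ, ?_, ?_, ?_⟩
  -- Near x the series coincides with the Laplace integral along a direction suited to x, which is
  -- holomorphic on an open half-plane.
  · intro x hx
    obtain ⟨φ, hφ, hφx⟩ := h.exists_direction hx
    have hnhds := (isOpen_halfPlane φ).mem_nhds hφx
    refine ((hF.differentiableOn_laplaceRay (hray hφ)).analyticAt hnhds).congr ?_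
    filter_upwards [hnhds] with y hy
    exact (hfL hφ hy).symm
  · intro x hx
    have hφ : |-b + b| < Real.pi / 2 := by
      rw [neg_add_cancel, abs_zero]
      exact Real.pi_div_two_pos
    have hx' : 0 < (x * Complex.exp ((-b : ℝ) * Complex.I)).re := by
      rwa [Complex.ofReal_neg, neg_mul]
    exact ⟨hF.integrableOn_laplaceIntegrand (hray hφ) hx', hfL hφ hx'⟩
  · exact fun x _ t ht => ⟨summable_lerchTerm (h.norm_zZero_lt_one ht) _,
      fun k hk => summable_lerchTerm (h.norm_zDyadic_lt_one hk ht) _⟩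
  · intro x φ hφ hx N hN t ht
    obtain ⟨M, rfl⟩ : ∃ M, N = M + 1 := ⟨N - 1, by omega⟩
    obtain ⟨c₀, hc⟩ := h.exists_isDenominatorBound hφ
    exact integrableOn_laplaceIntegrand_kernelRemainder hc hx ht M
  · intro x _ φ hφ hx n N l hN
    exact ⟨h.integrableOn_remainderIntegrand hJ hφ hx n l hN,
      (hfR hφ hx).trans (h.totalRemainder_zero_one hJ hφ hx n l hN)⟩
  · intro φ _ c₀ hc x hx N hN t ht
    obtain ⟨M, rfl⟩ : ∃ M, N = M + 1 := ⟨N - 1, by omega⟩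
    exact norm_dyadicRemainder_le hc hx ht M
  · exact fun c₀ hc x hx t ht => ⟨fun n => h.norm_rhoZero_le hc hx ht n,
      fun l k hk => h.norm_rhoDyadic_le hc hx ht l hk⟩
  · intro x hx
    obtain ⟨φ, hφ, hφx⟩ := h.exists_direction hx
    obtain ⟨h1, h2, -⟩ := h.factorialSeries hJ hφ hφx
    exact ⟨h1, h2, rfl⟩
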